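/- Let $F$ be a smooth local eigenfunction of the hyperbolic Laplacian with eigenvalue $3/4$, i.e. a smooth solution of $F_{\rho\rho}+F_{\eta\eta}=\frac{3F}{4\rho^2}$ on an open subset $U$ of the half-plane $\{(\rho,\eta):\rho>0\}$. Put $\alpha=\sqrt\rho\,d\phi$, $\beta=(d\psi+\eta\,d\phi)/\sqrt\rho$, $\Delta=F^2-4\rho^2(F_\rho^2+F_\eta^2)$ and $$g=\frac{\Delta}{4F^2}\,\frac{d\rho^2+d\eta^2}{\rho^2}+\frac{\bigl((F-2\rho F_\rho)\alpha-2\rho F_\eta\beta\bigr)^2+\bigl(-2\rho F_\eta\alpha+(F+2\rho F_\rho)\beta\bigr)^2}{F^2\Delta}.$$ Let $\varepsilon\in\{1,-1\}$ and let $M$ be the set of $(\rho,\eta,\phi,\psi)$ with $(\rho,\eta)\in U$, $F\neq0$ and $\varepsilon\Delta>0$, oriented by $\varepsilon\,d\rho\wedge d\eta\wedge d\phi\wedge d\psi$. Wedge products of quaternion-valued $1$-forms are $(a\wedge b)(X,Y)=a(X)b(Y)-a(Y)b(X)$, and a triple of Kähler forms of a metric $h$ is an $\mathrm{Im}\,\mathbb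 H$-valued $2$-form with components $h(I_a\cdot,\cdot)$, where $I_1,I_2,I_3$ satisfy the quaternion relations $I_1^2=I_2^2=-1$, $I_1I_2=I_3=-I_2I_1$. Put $$\Theta=\tfrac1{F^2}\Bigl(\bigl(-\tfrac14F^2+\rho^2(F_\rho^2+F_\eta^2)\bigr)\tfrac{d\rho\wedge d\eta}{\rho^2}+\alpha\wedge\beta\Bigr)\boldsymbol i+\tfrac1{F^2}\Bigl((\rho F_\rho+\boldsymbol i\rho F_\eta)(\alpha-\boldsymbol i\beta)-\tfrac12F(\alpha+\boldsymbol i\beta)\Bigr)\wedge\tfrac{d\rho-\boldsymbol i\,d\eta}{\rho}\,\boldsymbol j,$$ $$\omega=-\tfrac12\Bigl[\tfrac1F\Bigl(-\rho F_\eta\tfrac{d\rho}{\rho}+(\tfrac12F+\rho F_\rho)\tfrac{d\eta}{\rho}\Bigr)\boldsymbol i-\tfrac1F(\alpha-\boldsymbol i\beta)\boldsymbol j\Bigr].$$ (1) $h=\varepsilon g$ is a Riemannian metric on $M$, $\varepsilon\Theta$ is a frame of its bundle of antiselfdual $2$-forms and a triple of Kähler forms pointwise, $\omega$ is the connection form induced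 by the Levi-Civita connection in this frame, i.e. $d\Theta-\omega\wedge\Theta+\Theta\wedge\omega=0$, and the selfdual Einstein equation $d\omega-\omega\wedge\omega=2s\,(\varepsilon\Theta)$ holds with $s=\varepsilon/4$. In the corresponding trivialization $M\times\mathbb H^\times$, with fibre coordinate $q$, of the double cover of the Swann bundle of $h$, let $$\tilde g=4\bigl(s|q|^2h+|dq+q\omega|^2\bigr)=|q|^2g+4|dq+q\omega|^2,\qquad \Omega=4\bigl(s\,q(\varepsilon\Theta)\bar q-\tfrac12(dq+q\omega)\wedge\overline{(dq+q\omega)}\bigr)$$ be the Swann metric, normalized by the constant factor $4$, and its $\mathrm{Im}\,\mathbb H$-valued Kähler form. (2) $(\tilde g,\Omega)$ is (pseudo-)hyperkähler: $\tilde g$ is smooth and nondegenerate, $\Omega$ is pointwise a triple of Kähler forms of $\tilde g$, and $d\Omega=0$. (3) $\mathrm{Im}\,\mathbb H$-valued momentum maps of $\partial_\psi$ and $\partial_\phi$, i.e. solutions of $\iota_X\Omega=d\boldsymbol x_X$, are $$\boldsymbol x_\psi=\frac{q\boldsymbol k\bar q}{\sqrt\rho\,F},\qquad \boldsymbol x_\phi=\frac{q(\eta+\rho\boldsymbol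 i)\boldsymbol k\bar q}{\sqrt\rho\,F}.$$ (4) $\tilde g$ is given by the generalized Gibbons–Hawking Ansatz. Write $(t_1,t_2)=(\phi,\psi)$ and $\boldsymbol x=(\boldsymbol x_1,\boldsymbol x_2)=(\boldsymbol x_\phi,\boldsymbol x_\psi)$. The image $B$ of $\boldsymbol x$ in $\mathbb R^2\otimes\mathrm{Im}\,\mathbb H=(\mathbb R^3)^2$ is open; two points of $M\times\mathbb H^\times$ have the same image if and only if they have the same $(\rho,\eta)$ and the same $q$ up to sign; and there are a smooth function $\Phi$ on $B$ with values in the invertible symmetric $2\times2$ matrices and smooth $1$-forms $A_1,A_2$ on $B$ which satisfy the generalized abelian monopole equation $$\frac{\partial\Phi_{ij}}{\partial x_k^a}=\frac{\partial\Phi_{kj}}{\partial x_i^a},\qquad dA_i(X,Y)=-\sum_{j,k,a,b,c}\epsilon_{abc}\,X_j^aY_k^b\,\frac{\partial\Phi_{ki}}{\partial x_j^c}\quad(\text{all } X,Y\in(\mathbb R^3)^2),$$ such that, pulling back by $\boldsymbol x$, $$\tilde g=\sum_{i,j}\Phi_{ij}\langle d\boldsymbol x_i,d\boldsymbol x_j\rangle+\sum_{i,j}(\Phi^{-1})_{ij}(dt_i+A_i)(dt_j+A_j),$$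 and the matrix of $\Phi$ in the frame dual to $(\alpha,\beta)$, i.e. $\underline\Phi=P\,\Phi\,P^{T}$ with $P=\begin{pmatrix}\alpha(\partial_\phi)&\alpha(\partial_\psi)\\ \beta(\partial_\phi)&\beta(\partial_\psi)\end{pmatrix}$, is $$\underline\Phi=\frac F{|q|^2}\begin{pmatrix}\tfrac12F+\rho F_\rho&\rho F_\eta\\ \rho F_\eta&\tfrac12F-\rho F_\rho\end{pmatrix}.$$ -/

import Mathlib

open scoped Quaternion Matrix ContDiff

noncomputable section

namespace SwannGH

/-! ### Differential forms on normed spaces -/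

section Forms

variable {E : Type*} [NormedAddCommGroup E] [NormedSpace ℝ E]

/-- Wedge product of two quaternion-valued `1`-forms:
`(a ∧ b)(X, Y) = a(X) b(Y) - a(Y) b(X)`. -/
def wedge (a b : E →L[ℝ] ℍ[ℝ]) : E [⋀^Fin 2]→L[ℝ] ℍ[ℝ] :=
  ContinuousMultilinearMap.alternatization
    ((ContinuousMultilinearMap.mkPiAlgebraFin ℝ 2 ℍ[ℝ]).compContinuousLinearMap ![a, b])

theorem wedge_apply (a b : E →L[ℝ] ℍ[ℝ]) (X Y : E) :
    wedge a b ![X, Y] = a X * b Y - a Y * b X := by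
  have h : (Finset.univ : Finset (Equiv.Perm (Fin 2))) = {1, Equiv.swap 0 1} := by decide
  have h' : (1 : Equiv.Perm (Fin 2)) ≠ Equiv.swap 0 1 := by decide
  simp [wedge, ContinuousMultilinearMap.alternatization_apply_apply, h, Finset.sum_pair h',
    sub_eq_add_neg]

/-- The exterior derivative of a `1`-form, where `1`-forms are given as fields of linear maps. -/
def dOne {V : Type*} [NormedAddCommGroup V] [NormedSpace ℝ V] (a : E → E →L[ℝ] V) (x : E) :
    E [⋀^Fin 2]→L[ℝ] V :=
  extDeriv (fun y => ContinuousAlternatingMap.ofSubsingleton ℝ E V (0 : Fin 1) (a y)) x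

/-- The three imaginary components of a quaternion. -/
def imVec (q : ℍ[ℝ]) : Fin 3 → ℝ := ![q.imI, q.imJ, q.imK]

/-- The quaternion-valued `2`-form `Ω` on the vector space `E` is imaginary and its components are
the Kähler forms `Ω_a(X, Y) = g(I_a X, Y)` of three endomorphisms `I_0 = I`, `I_1 = J`, `I_2 = K`
which satisfy the quaternion relations `I² = J² = -1`, `I J = K = -J I`. -/
def IsQuaternionicTriple (g : LinearMap.BilinForm ℝ E) (Ω : E [⋀^Fin 2]→L[ℝ] ℍ[ℝ]) : Prop :=
  (∀ X Y, (Ω ![X, Y]).re = 0) ∧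
  ∃ I : Fin 3 → E →ₗ[ℝ] E,
    I 0 ∘ₗ I 0 = -LinearMap.id ∧ I 1 ∘ₗ I 1 = -LinearMap.id ∧
    I 0 ∘ₗ I 1 = I 2 ∧ I 1 ∘ₗ I 0 = -I 2 ∧
    ∀ a X Y, imVec (Ω ![X, Y]) a = g (I a X) Y

/-- `(G, Ω)` is a (pseudo-)hyperkähler structure on the open set `U`: `G` is a smooth
nondegenerate symmetric form, the components of `Ω` are the Kähler forms of a pointwise
quaternionic triple, and `Ω` is closed.  (Closedness of the three forms is equivalent to the three
almost complex structures being parallel for the Levi-Civita connection of `G`.) -/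
structure IsHyperkahler (U : Set E) (G : E → LinearMap.BilinForm ℝ E)
    (Ω : E → E [⋀^Fin 2]→L[ℝ] ℍ[ℝ]) : Prop where
  isOpen : IsOpen U
  smooth_metric : ∀ X Y, ContDiffOn ℝ ∞ (fun p => G p X Y) U
  smooth_form : ContDiffOn ℝ ∞ Ω U
  symm : ∀ p ∈ U, (G p).IsSymm
  nondegenerate : ∀ p ∈ U, (G p).Nondegenerate
  triple : ∀ p ∈ U, IsQuaternionicTriple (G p) (Ω p)
  closed : ∀ p ∈ U, extDeriv Ω p = 0

/-- `μ` is an `Im ℍ`-valued momentum map of the vector field `K`, with respect to the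
`Im ℍ`-valued symplectic form `Ω` on `U`:  `ι_K Ω = dμ`. -/
def IsMomentumMap (U : Set E) (Ω : E → E [⋀^Fin 2]→L[ℝ] ℍ[ℝ]) (K : E → E) (μ : E → ℍ[ℝ]) : Prop :=
  ∀ p ∈ U, (μ p).re = 0 ∧ DifferentiableAt ℝ μ p ∧ ∀ Y, fderiv ℝ μ p Y = Ω p ![K p, Y]

end Forms

/-! ### The generalized Gibbons–Hawking Ansatz in dimension eight -/

/-- `ℝ² ⊗ Im ℍ`, with `Im ℍ = ℝ³`; a point is a pair `(x 0, x 1)` of vectors of `ℝ³`. -/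
abbrev MomentumSpace := Fin 2 → Fin 3 → ℝ

/-- `(Φ, A)` is a solution on the open set `B` of the generalized abelian monopole equation on
`ℝ² ⊗ Im ℍ`: `Φ` is symmetric and invertible,
`∂Φ_{ij}/∂x_k^a = ∂Φ_{kj}/∂x_i^a`, and `dA_i = -∑ ε_{abc} (∂Φ_{ki}/∂x_j^c) dx_j^a ⊗ dx_k^b`.
(The second equation is the generalization of the monopole equation `dA = -*dΦ` on `ℝ³`;
contracted with `X`, `Y` its right-hand side differentiates `Φ_{ki}` along the cross product
`X_j × Y_k`, placed in the `j`-th copy of `ℝ³`.) -/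
structure IsGeneralizedMonopole (B : Set MomentumSpace)
    (Φ : MomentumSpace → Matrix (Fin 2) (Fin 2) ℝ)
    (A : Fin 2 → MomentumSpace → MomentumSpace →L[ℝ] ℝ) : Prop where
  isOpen : IsOpen B
  smooth_higgs : ∀ i j, ContDiffOn ℝ ∞ (fun x => Φ x i j) B
  smooth_connection : ∀ i, ContDiffOn ℝ ∞ (A i) B
  symm : ∀ x ∈ B, (Φ x).IsSymm
  invertible : ∀ x ∈ B, IsUnit (Φ x).det
  gradient : ∀ x ∈ B, ∀ (i j k : Fin 2) (u : Fin 3 → ℝ),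
    fderiv ℝ (fun y => Φ y i j) x (Pi.single k u) = fderiv ℝ (fun y => Φ y k j) x (Pi.single i u)
  curvature : ∀ x ∈ B, ∀ (i : Fin 2) (X Y : MomentumSpace),
    dOne (A i) x ![X, Y] =
      -∑ j, ∑ k, fderiv ℝ (fun y => Φ y k i) x (Pi.single j (X j ⨯₃ Y k))

/-- The metric `∑ Φ_{ij} ⟨dx_i, dx_j⟩ + ∑ (Φ⁻¹)_{ij} (dt_i + A_i)(dt_j + A_j)` at a point
`(x, t)`, evaluated on two tangent vectors `X = (X.1, X.2)`, `Y = (Y.1, Y.2)`. -/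
def gibbonsHawkingMetric (Φ : MomentumSpace → Matrix (Fin 2) (Fin 2) ℝ)
    (A : Fin 2 → MomentumSpace → MomentumSpace →L[ℝ] ℝ) (x : MomentumSpace)
    (X Y : MomentumSpace × (Fin 2 → ℝ)) : ℝ :=
  ∑ i, ∑ j, Φ x i j * (X.1 i ⬝ᵥ Y.1 j) +
    ∑ i, ∑ j, (Φ x)⁻¹ i j * ((X.2 i + A i x X.1) * (Y.2 j + A j x Y.1))

/-! ### Hyperbolic eigenfunctions and the associated metrics

Points of the half-plane are written `z = (ρ, η)`. -/

/-- The partial derivative, with respect to `ρ`, of a function of `(ρ, η)`. -/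
def dRho (F : ℝ × ℝ → ℝ) (z : ℝ × ℝ) : ℝ := fderiv ℝ F z (1, 0)

/-- The partial derivative with respect to `η`. -/
def dEta (F : ℝ × ℝ → ℝ) (z : ℝ × ℝ) : ℝ := fderiv ℝ F z (0, 1)

/-- `F` is a (smooth) local eigenfunction, with eigenvalue `3/4`, of the Laplacian
`ρ² (∂_ρ² + ∂_η²)` of the hyperbolic plane, on the open subset `U` of the half-plane. -/
structure IsHyperbolicEigenfunction (U : Set (ℝ × ℝ)) (F : ℝ × ℝ → ℝ) : Prop where
  isOpen : IsOpen U
  rho_pos : ∀ z ∈ U, 0 < z.1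
  smooth : ContDiffOn ℝ ∞ F U
  eigen : ∀ z ∈ U, dRho (dRho F) z + dEta (dEta F) z = 3 * F z / (4 * z.1 ^ 2)

/-- `F² - 4 ρ² (F_ρ² + F_η²)`. -/
def discr (F : ℝ × ℝ → ℝ) (z : ℝ × ℝ) : ℝ :=
  F z ^ 2 - 4 * z.1 ^ 2 * (dRho F z ^ 2 + dEta F z ^ 2)

/-- The part of `U` on which `F ≠ 0` and `F² - 4 ρ² (F_ρ² + F_η²)` has the sign of `ε`. -/
def regularSet (ε : ℝ) (U : Set (ℝ × ℝ)) (F : ℝ × ℝ → ℝ) : Set (ℝ × ℝ) :=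
  {z | z ∈ U ∧ F z ≠ 0 ∧ 0 < ε * discr F z}

/-- The coordinate space of `M`, with points `p = ((ρ, η), (φ, ψ))`. -/
abbrev Base := (ℝ × ℝ) × (Fin 2 → ℝ)

/-- The coordinate differential `dρ`. -/
def formRho : Base →L[ℝ] ℝ := ContinuousLinearMap.fst ℝ ℝ ℝ ∘L ContinuousLinearMap.fst ℝ _ _

/-- The coordinate differential `dη`. -/
def formEta : Base →L[ℝ] ℝ := ContinuousLinearMap.snd ℝ ℝ ℝ ∘L ContinuousLinearMap.fst ℝ _ _

/-- The coordinate differential `dφ`. -/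
def formPhi : Base →L[ℝ] ℝ := ContinuousLinearMap.proj 0 ∘L ContinuousLinearMap.snd ℝ (ℝ × ℝ) _

/-- The coordinate differential `dψ`. -/
def formPsi : Base →L[ℝ] ℝ := ContinuousLinearMap.proj 1 ∘L ContinuousLinearMap.snd ℝ (ℝ × ℝ) _

/-- `α = √ρ dφ`. -/
def formAlpha (z : ℝ × ℝ) : Base →L[ℝ] ℝ := √z.1 • formPhi

/-- `β = (dψ + η dφ) / √ρ`. -/
def formBeta (z : ℝ × ℝ) : Base →L[ℝ] ℝ := (√z.1)⁻¹ • (formPsi + z.2 • formPhi)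

/-- The square of a `1`-form, as a symmetric bilinear form. -/
def sqForm (u : Base →L[ℝ] ℝ) : LinearMap.BilinForm ℝ Base :=
  LinearMap.BilinForm.linMulLin u.toLinearMap u.toLinearMap

/-- The metric
`(F² - 4ρ²(F_ρ² + F_η²))/(4F²) · (dρ² + dη²)/ρ²
  + (((F - 2ρF_ρ)α - 2ρF_η β)² + (-2ρF_η α + (F + 2ρF_ρ)β)²)/(F²(F² - 4ρ²(F_ρ² + F_η²)))`. -/
def baseMetric (F : ℝ × ℝ → ℝ) (p : Base) : LinearMap.BilinForm ℝ Base :=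
  let z := p.1
  let ρ := z.1
  let α := formAlpha z
  let β := formBeta z
  (discr F z / (4 * F z ^ 2) / ρ ^ 2) • (sqForm formRho + sqForm formEta) +
  (F z ^ 2 * discr F z)⁻¹ •
    (sqForm ((F z - 2 * ρ * dRho F z) • α - (2 * ρ * dEta F z) • β) +
     sqForm ((-2 * ρ * dEta F z) • α + (F z + 2 * ρ * dRho F z) • β))

/-! ### The Swann bundle, in a local trivialization -/

/-- The determinant of four vectors, with respect to the coordinates `(ρ, η, φ, ψ)`. -/
def coordDet (e : Fin 4 → Base) : ℝ :=
  Matrix.det (Matrix.of fun i => ![formRho (e i), formEta (e i), formPhi (e i), formPsi (e i)])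

/-- The `2`-form `Θ` is antiselfdual for the inner product `h` and the orientation given by
the sign of `ε · dρ ∧ dη ∧ dφ ∧ dψ`, i.e. `Θ(e₀, e₁) = -Θ(e₂, e₃)` for every oriented orthonormal
basis `e`. -/
def IsAntiSelfDual (ε : ℝ) (h : LinearMap.BilinForm ℝ Base) (Θ : Base [⋀^Fin 2]→L[ℝ] ℍ[ℝ]) : Prop :=
  ∀ e : Fin 4 → Base, (∀ i j, h (e i) (e j) = if i = j then 1 else 0) → 0 < ε * coordDet e →
    Θ ![e 0, e 1] = -Θ ![e 2, e 3]

/-- A local trivialization of the Swann bundle of the Riemannian metric `h` on the open set `N`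
(oriented by the sign `ε`), over which `h` is selfdual Einstein.

* `Θ` is an `Im ℍ`-valued `2`-form whose components are an oriented orthogonal frame of the bundle
  of antiselfdual `2`-forms, normalized to be a triple of Kähler forms;
* `conn`, written `ω` below, is the `Im ℍ`-valued `1`-form of the connection which the Levi-Civita connection of `h`
  induces on that bundle, in this frame: it is determined by `dΘ - ω ∧ Θ + Θ ∧ ω = 0`;
* the curvature of this connection is `dω - ω ∧ ω = 2 s Θ` with `s` constant: this is the selfdual
  Einstein equation, and `s` is, up to a positive factor, the scalar curvature. -/
structure IsSwannTrivialization (ε : ℝ) (N : Set Base) (h : Base → LinearMap.BilinForm ℝ Base)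
    (Θ : Base → Base [⋀^Fin 2]→L[ℝ] ℍ[ℝ]) (conn : Base → Base →L[ℝ] ℍ[ℝ]) (s : ℝ) : Prop where
  isOpen : IsOpen N
  smooth_metric : ∀ X Y, ContDiffOn ℝ ∞ (fun p => h p X Y) N
  smooth_frame : ContDiffOn ℝ ∞ Θ N
  smooth_connection : ContDiffOn ℝ ∞ conn N
  symm : ∀ p ∈ N, (h p).IsSymm
  pos : ∀ p ∈ N, ∀ X, X ≠ 0 → 0 < h p X X
  antiselfdual : ∀ p ∈ N, IsAntiSelfDual ε (h p) (Θ p)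
  frame : ∀ p ∈ N, IsQuaternionicTriple (h p) (Θ p)
  connection_im : ∀ p ∈ N, ∀ X, (conn p X).re = 0
  connection : ∀ p ∈ N, ∀ X Y Z,
    extDeriv Θ p ![X, Y, Z]
      - (conn p X * Θ p ![Y, Z] - conn p Y * Θ p ![X, Z] + conn p Z * Θ p ![X, Y])
      + (Θ p ![Y, Z] * conn p X - Θ p ![X, Z] * conn p Y + Θ p ![X, Y] * conn p Z) = 0
  curvature : ∀ p ∈ N, dOne conn p - wedge (conn p) (conn p) = (2 * s) • Θ p

/-- The coordinate space `M × ℍ` of (the double cover of) the Swann bundle,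
with points `P = (p, q)`. -/
abbrev Total := Base × ℍ[ℝ]

/-- The `ℍ`-valued `1`-form `dq + q ω` on `M × ℍ`. -/
def vertForm (conn : Base → Base →L[ℝ] ℍ[ℝ]) (P : Total) : Total →L[ℝ] ℍ[ℝ] :=
  ContinuousLinearMap.snd ℝ Base ℍ[ℝ] +
    ContinuousLinearMap.mul ℝ ℍ[ℝ] P.2 ∘L conn P.1 ∘L ContinuousLinearMap.fst ℝ Base ℍ[ℝ]

/-- The Swann metric `s |q|² h + |dq + q ω|²`. -/
def swannMetric (h : Base → LinearMap.BilinForm ℝ Base) (conn : Base → Base →L[ℝ] ℍ[ℝ]) (s : ℝ)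
    (P : Total) : LinearMap.BilinForm ℝ Total :=
  (s * ‖P.2‖ ^ 2) • (h P.1).compl₁₂ (LinearMap.fst ℝ Base ℍ[ℝ]) (LinearMap.fst ℝ Base ℍ[ℝ]) +
    (innerₗ ℍ[ℝ]).compl₁₂ (vertForm conn P).toLinearMap (vertForm conn P).toLinearMap

/-- Quaternionic conjugation as a continuous linear map. -/
def conjL : ℍ[ℝ] →L[ℝ] ℍ[ℝ] :=
  LinearMap.toContinuousLinearMap
    { toFun := fun q => star q
      map_add' := fun a b => star_add a b
      map_smul' := fun c a => Quaternion.star_smul c a }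

/-- The `Im ℍ`-valued Kähler form
`s q Θ q̄ - ½ (dq + q ω) ∧ conj (dq + q ω)` of the Swann metric. -/
def swannForm (Θ : Base → Base [⋀^Fin 2]→L[ℝ] ℍ[ℝ]) (conn : Base → Base →L[ℝ] ℍ[ℝ]) (s : ℝ)
    (P : Total) : Total [⋀^Fin 2]→L[ℝ] ℍ[ℝ] :=
  s • (ContinuousLinearMap.mulLeftRight ℝ ℍ[ℝ] P.2 (star P.2)).compContinuousAlternatingMap
      ((Θ P.1).compContinuousLinearMap (ContinuousLinearMap.fst ℝ Base ℍ[ℝ])) -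
    (1 / 2 : ℝ) • wedge (vertForm conn P)
      (conjL ∘L vertForm conn P)

/-! ### The frame and the connection form for the metrics above -/

/-- The quaternion unit `i`. -/
def qi : ℍ[ℝ] := ⟨0, 1, 0, 0⟩

/-- The quaternion unit `j`. -/
def qj : ℍ[ℝ] := ⟨0, 0, 1, 0⟩

/-- The quaternion unit `k`. -/
def qk : ℍ[ℝ] := ⟨0, 0, 0, 1⟩

/-- The quaternion-valued `1`-form `u c`, for a real `1`-form `u` and a quaternion `c`. -/
def tensor (u : Base →L[ℝ] ℝ) (c : ℍ[ℝ]) : Base →L[ℝ] ℍ[ℝ] := u.smulRight c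

/-- The quaternion-valued `1`-form `a c`, for a quaternion-valued `1`-form `a`. -/
def rightMul (a : Base →L[ℝ] ℍ[ℝ]) (c : ℍ[ℝ]) : Base →L[ℝ] ℍ[ℝ] :=
  (ContinuousLinearMap.mul ℝ ℍ[ℝ]).flip c ∘L a

/-- The frame
`Θ = F⁻² ((-¼F² + ρ²(F_ρ² + F_η²)) dρ ∧ dη/ρ² + α ∧ β) i
  + F⁻² ((ρF_ρ + iρF_η)(α - iβ) - ½F(α + iβ)) ∧ (dρ - i dη)/ρ j`. -/
def frameForm (F : ℝ × ℝ → ℝ) (p : Base) : Base [⋀^Fin 2]→L[ℝ] ℍ[ℝ] :=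
  let z := p.1
  let ρ := z.1
  let α := formAlpha z
  let β := formBeta z
  let c : ℍ[ℝ] := ((ρ * dRho F z : ℝ) : ℍ[ℝ]) + (ρ * dEta F z) • qi
  (F z ^ 2)⁻¹ •
    (((-(1 / 4) * F z ^ 2 + ρ ^ 2 * (dRho F z ^ 2 + dEta F z ^ 2)) / ρ ^ 2) •
        wedge (tensor formRho 1) (tensor formEta qi) +
      wedge (tensor α 1) (tensor β qi) +
      wedge
        (ContinuousLinearMap.mul ℝ ℍ[ℝ] c ∘L (tensor α 1 - tensor β qi) -
          (F z / 2) • (tensor α 1 + tensor β qi))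
        (rightMul (ρ⁻¹ • (tensor formRho 1 - tensor formEta qi)) qj))

/-- The connection form
`ω = -½ [F⁻¹ (-ρF_η dρ/ρ + (½F + ρF_ρ) dη/ρ) i - F⁻¹ (α - iβ) j]`. -/
def connectionForm (F : ℝ × ℝ → ℝ) (p : Base) : Base →L[ℝ] ℍ[ℝ] :=
  let z := p.1
  let ρ := z.1
  (-1 / 2 : ℝ) •
    ((F z)⁻¹ • tensor
        ((-ρ * dEta F z / ρ) • formRho + ((F z / 2 + ρ * dRho F z) / ρ) • formEta) qi -
      (F z)⁻¹ • rightMul (tensor (formAlpha z) 1 - tensor (formBeta z) qi) qj)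

/-! ### The data in the statement -/

/-- The region of `M` over the part of the half-plane selected by `ε`. -/
def baseRegion (ε : ℝ) (U : Set (ℝ × ℝ)) (F : ℝ × ℝ → ℝ) : Set Base :=
  {p | p.1 ∈ regularSet ε U F}

/-- The corresponding region of `M × ℍˣ`. -/
def totalRegion (ε : ℝ) (U : Set (ℝ × ℝ)) (F : ℝ × ℝ → ℝ) : Set Total :=
  {P | P.1 ∈ baseRegion ε U F ∧ P.2 ≠ 0}

/-- The selfdual Einstein metric: `g` where `F² > 4ρ²(F_ρ² + F_η²)` (`ε = 1`) and `-g` where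
`F² < 4ρ²(F_ρ² + F_η²)` (`ε = -1`). -/
def einsteinMetric (ε : ℝ) (F : ℝ × ℝ → ℝ) (p : Base) : LinearMap.BilinForm ℝ Base :=
  ε • baseMetric F p

/-- The frame of antiselfdual forms for the selfdual Einstein metric `ε g`. -/
def einsteinFrame (ε : ℝ) (F : ℝ × ℝ → ℝ) (p : Base) : Base [⋀^Fin 2]→L[ℝ] ℍ[ℝ] :=
  ε • frameForm F p

/-- The hyperkähler metric on the Swann bundle of the selfdual Einstein metric `ε g`, normalized
by the constant factor `4`; explicitly it is `|q|² g + 4 |dq + q ω|²`. -/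
def totalMetric (ε : ℝ) (F : ℝ × ℝ → ℝ) (P : Total) : LinearMap.BilinForm ℝ Total :=
  (4 : ℝ) • swannMetric (einsteinMetric ε F) (connectionForm F) (ε / 4) P

/-- The `Im ℍ`-valued Kähler form of that hyperkähler metric. -/
def totalForm (ε : ℝ) (F : ℝ × ℝ → ℝ) (P : Total) : Total [⋀^Fin 2]→L[ℝ] ℍ[ℝ] :=
  (4 : ℝ) • swannForm (einsteinFrame ε F) (connectionForm F) (ε / 4) P

/-- The vector fields `∂_φ` (index `0`) and `∂_ψ` (index `1`) on `M × ℍ`. -/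
def killingField (i : Fin 2) (_P : Total) : Total := ((0, Pi.single i 1), 0)

/-- `x_φ = q (η + ρ i) k q̄ / (√ρ F)`. -/
def momentPhi (F : ℝ × ℝ → ℝ) (P : Total) : ℍ[ℝ] :=
  (√P.1.1.1 * F P.1.1)⁻¹ • (P.2 * ((P.1.1.2 : ℍ[ℝ]) + P.1.1.1 • qi) * qk * star P.2)

/-- `x_ψ = q k q̄ / (√ρ F)`. -/
def momentPsi (F : ℝ × ℝ → ℝ) (P : Total) : ℍ[ℝ] :=
  (√P.1.1.1 * F P.1.1)⁻¹ • (P.2 * qk * star P.2)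

/-- The coordinates `(x_φ, x_ψ)`, as a map to `ℝ² ⊗ Im ℍ`. -/
def momentMap (F : ℝ × ℝ → ℝ) (P : Total) : MomentumSpace :=
  ![imVec (momentPhi F P), imVec (momentPsi F P)]

/-- The matrix of the coframe `(α, β)` with respect to `(dφ, dψ)`, i.e. `α(∂_φ), α(∂_ψ)` in the
first row and `β(∂_φ), β(∂_ψ)` in the second. -/
def coframeMatrix (p : Base) : Matrix (Fin 2) (Fin 2) ℝ :=
  Matrix.of ![fun i => formAlpha p.1 (0, Pi.single i 1), fun i => formBeta p.1 (0, Pi.single i 1)]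

/-- The matrix `F/|q|² · [[½F + ρF_ρ, ρF_η], [ρF_η, ½F - ρF_ρ]]`. -/
def higgsMatrix (F : ℝ × ℝ → ℝ) (P : Total) : Matrix (Fin 2) (Fin 2) ℝ :=
  let z := P.1.1
  (F z / ‖P.2‖ ^ 2) •
    !![F z / 2 + z.1 * dRho F z, z.1 * dEta F z;
       z.1 * dEta F z, F z / 2 - z.1 * dRho F z]

end SwannGH

end

/-!
The base.  `quatCoframe` is an orthonormal coframe of the Einstein metric `ε g`,
collected into one quaternion-valued `1`-form `E`: the metric is `⟨E, E⟩` and the frame `ε Θ` is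
`-½ E ∧ Ē` (`einsteinMetric_eq_inner`, `einsteinFrame_eq`).  Hence the components of `ε Θ` are the
Kähler forms of left multiplication by `i`, `j`, `k`; they are antiselfdual because `E` reverses the
orientation and complementary `2 × 2` minors of an orthogonal matrix of determinant `-1` are opposite.
The curvature equation `dω - ω ∧ ω = ½ Θ` is checked in components, and is the place where the
eigenvalue equation is used (`curvature_connectionForm`).  As `Θ` is a multiple of the curvature, the
equation `dΘ - ω ∧ Θ + Θ ∧ ω = 0` is the Bianchi identity (`bianchi`).

The total space.  With `λ = (dq + q ω) q̄`, the curvature equation says `Ω = 2 dλ`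
(`swannForm_eq_dOne`), so that `Ω` is closed, and the invariant vector fields `∂_φ`, `∂_ψ` have the
momentum maps `-2 λ(∂_φ)`, `-2 λ(∂_ψ)` (`isMomentumMap_of_eq`).  The `ℍ²`-valued coframe
`(q E, dq + q ω)` shows that `(g̃, Ω)` is pointwise pseudo-hyperkähler.

The Gibbons–Hawking Ansatz.  The momentum map is a function of `((ρ, η), q)`, of the form
`x_k = q m_k q̄` with `m_k` depending on `(ρ, η)` only.  The scalar products of `x_φ` and `x_ψ`
determine `(ρ, η)` and `|q|`, and then the vectors themselves determine `q` up to sign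
(`reducedMap_injective`).  On the six-dimensional quotient with points `((ρ, η), q)` there are
explicit Higgs fields and connection forms (`reducedHiggs`, `reducedConn`).  At the point `q` all
differentials are evaluated on tangent vectors `(δ, q c)`, so that every identity becomes one between
vectors in `ℝ³`, rotated by `q`:

* the hyperkähler metric is `∑ Φ_{ij} ⟨dx_i, dx_j⟩ + ∑ (Φ⁻¹)_{ij} (dt_i + A_i)(dt_j + A_j)`
  (`totalMetric_eq_reduced`);
* `dΦ_{ij} = ∑_k ⟨γ_{ijk}, dx_k⟩` with `γ_{ijk} ∈ ℝ³` totally symmetric in its indices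
  (`fderiv_reducedHiggs_eq`), which contains the first monopole equation;
* `dA_i = -∑ ⟨γ_{kij}, dx_j × dx_k⟩` (`curvature_reducedConn_eq`), which is the second.

The differential of the momentum map is invertible: a kernel vector, lifted horizontally, would be
orthogonal to everything for the nondegenerate metric (`fderiv_reducedMap_injective`).  By the inverse
function theorem the image is open, and `Φ` and `A`, being unchanged by `q ↦ -q`, descend to smooth
objects on the image, where the chain rule gives the monopole equations (`isGeneralizedMonopole`).
-/

noncomputable section

namespace SwannGH

/-! ### Exterior calculus in low degree -/

section Forms

variable {E : Type*} [NormedAddCommGroup E] [NormedSpace ℝ E]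

theorem twoForm_ext {V : Type*} [NormedAddCommGroup V] [NormedSpace ℝ V] {f g : E [⋀^Fin 2]→L[ℝ] V}
    (h : ∀ X Y, f ![X, Y] = g ![X, Y]) : f = g := by
  ext v
  have hv : v = ![v 0, v 1] := by
    ext i; fin_cases i <;> rfl
  rw [hv]
  exact h _ _

theorem dOne_apply {V : Type*} [NormedAddCommGroup V] [NormedSpace ℝ V] {a : E → E →L[ℝ] V} {x : E}
    (ha : DifferentiableAt ℝ a x) (X Y : E) :
    dOne a x ![X, Y] = fderiv ℝ a x X Y - fderiv ℝ a x Y X := by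
  have hd : DifferentiableAt ℝ
      (fun y => ContinuousAlternatingMap.ofSubsingleton ℝ E V (0 : Fin 1) (a y)) x :=
    DifferentiableAt.comp (g := ContinuousAlternatingMap.ofSubsingleton ℝ E V (0 : Fin 1)) x
      (ContinuousAlternatingMap.ofSubsingletonLIE (𝕜 := ℝ) (E := E) (F := V)
        (0 : Fin 1)).toContinuousLinearEquiv.differentiableAt ha
  have key : ∀ X, fderiv ℝ (fun y => a y X) x = (fderiv ℝ a x).flip X := fun X => by
    rw [fderiv_clm_apply ha (differentiableAt_const X)]
    ext; simp
  rw [dOne, extDeriv_apply hd, Fin.sum_univ_two]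
  simp [Fin.removeNth, key, sub_eq_add_neg]

theorem extDeriv_two_apply {V : Type*} [NormedAddCommGroup V] [NormedSpace ℝ V]
    {w : E → E [⋀^Fin 2]→L[ℝ] V} {x : E} (hw : DifferentiableAt ℝ w x) (X Y Z : E) :
    extDeriv w x ![X, Y, Z] =
      fderiv ℝ w x X ![Y, Z] - fderiv ℝ w x Y ![X, Z] + fderiv ℝ w x Z ![X, Y] := by
  have key : ∀ v X, fderiv ℝ (fun y => w y v) x X = fderiv ℝ w x X v := fun v X => by
    simp [fderiv_continuousAlternatingMap_apply_const_apply hw]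
  rw [extDeriv_apply hw, Fin.sum_univ_three, key, key, key]
  have h0 : (0 : Fin 3).removeNth ![X, Y, Z] = ![Y, Z] := by
    ext i; fin_cases i <;> rfl
  have h1 : (1 : Fin 3).removeNth ![X, Y, Z] = ![X, Z] := by
    ext i; fin_cases i <;> rfl
  have h2 : (2 : Fin 3).removeNth ![X, Y, Z] = ![X, Y] := by
    ext i; fin_cases i <;> rfl
  rw [h0, h1, h2]
  simp [sub_eq_add_neg]

theorem extDeriv_sub_apply {V : Type*} [NormedAddCommGroup V] [NormedSpace ℝ V] {n : ℕ}
    {w w' : E → E [⋀^Fin n]→L[ℝ] V} {x : E} (hw : DifferentiableAt ℝ w x)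
    (hw' : DifferentiableAt ℝ w' x) :
    extDeriv (fun y => w y - w' y) x = extDeriv w x - extDeriv w' x := by
  have h : (fun y => w y - w' y) = w + (-1 : ℝ) • w' := by
    ext1 y; simp [sub_eq_add_neg]
  rw [h, extDeriv_add hw (hw'.const_smul _), extDeriv_smul]
  simp [sub_eq_add_neg]

theorem isBoundedBilinearMap_wedge (E : Type*) [NormedAddCommGroup E] [NormedSpace ℝ E] :
    IsBoundedBilinearMap ℝ
      (fun p : (E →L[ℝ] ℍ[ℝ]) × (E →L[ℝ] ℍ[ℝ]) => SwannGH.wedge p.1 p.2) where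
  add_left a a' b := twoForm_ext fun X Y => by simp [wedge_apply]; noncomm_ring
  smul_left c a b := twoForm_ext fun X Y => by simp [wedge_apply, smul_sub]
  add_right a b b' := twoForm_ext fun X Y => by simp [wedge_apply]; noncomm_ring
  smul_right c a b := twoForm_ext fun X Y => by simp [wedge_apply, smul_sub]
  bound := by
    refine ⟨2, two_pos, fun a b => ?_⟩
    refine ContinuousAlternatingMap.opNorm_le_bound _ (by positivity) fun v => ?_
    have hv : v = ![v 0, v 1] := by
      ext i; fin_cases i <;> rfl
    rw [hv]
    simp only [wedge_apply, Fin.prod_univ_two, Matrix.cons_val_zero, Matrix.cons_val_one]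
    calc ‖a (v 0) * b (v 1) - a (v 1) * b (v 0)‖
        ≤ ‖a (v 0)‖ * ‖b (v 1)‖ + ‖a (v 1)‖ * ‖b (v 0)‖ := by
          rw [← norm_mul, ← norm_mul]; exact norm_sub_le _ _
      _ ≤ (‖a‖ * ‖v 0‖) * (‖b‖ * ‖v 1‖) + (‖a‖ * ‖v 1‖) * (‖b‖ * ‖v 0‖) := by
          gcongr <;> exact ContinuousLinearMap.le_opNorm _ _
      _ = 2 * ‖a‖ * ‖b‖ * (‖v 0‖ * ‖v 1‖) := by ring

section Bilinear

variable {V W X H : Type*} [NormedAddCommGroup V] [NormedSpace ℝ V] [NormedAddCommGroup W]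
  [NormedSpace ℝ W] [NormedAddCommGroup X] [NormedSpace ℝ X] [NormedAddCommGroup H]
  [NormedSpace ℝ H] {f : V × W → X} {a : H → V} {b : H → W}

theorem hasFDerivAt_of_bilinear (h : IsBoundedBilinearMap ℝ f) {x : H} (ha : DifferentiableAt ℝ a x)
    (hb : DifferentiableAt ℝ b x) :
    HasFDerivAt (fun x => f (a x, b x))
      ((h.deriv (a x, b x)) ∘L ((fderiv ℝ a x).prod (fderiv ℝ b x))) x :=
  (h.hasFDerivAt (a x, b x)).comp x (ha.hasFDerivAt.prodMk hb.hasFDerivAt)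

theorem differentiableAt_of_bilinear (h : IsBoundedBilinearMap ℝ f) {x : H}
    (ha : DifferentiableAt ℝ a x) (hb : DifferentiableAt ℝ b x) :
    DifferentiableAt ℝ (fun x => f (a x, b x)) x :=
  (hasFDerivAt_of_bilinear h ha hb).differentiableAt

theorem fderiv_of_bilinear (h : IsBoundedBilinearMap ℝ f) {x : H} (ha : DifferentiableAt ℝ a x)
    (hb : DifferentiableAt ℝ b x) (Y : H) :
    fderiv ℝ (fun x => f (a x, b x)) x Y =
      f (a x, fderiv ℝ b x Y) + f (fderiv ℝ a x Y, b x) := by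
  rw [(hasFDerivAt_of_bilinear h ha hb).fderiv]
  rfl

end Bilinear

theorem differentiableAt_wedge {H : Type*} [NormedAddCommGroup H] [NormedSpace ℝ H]
    {a b : H → E →L[ℝ] ℍ[ℝ]} {x : H} (ha : DifferentiableAt ℝ a x) (hb : DifferentiableAt ℝ b x) :
    DifferentiableAt ℝ (fun x => SwannGH.wedge (a x) (b x)) x :=
  differentiableAt_of_bilinear (V := E →L[ℝ] ℍ[ℝ]) (W := E →L[ℝ] ℍ[ℝ])
    (X := E [⋀^Fin 2]→L[ℝ] ℍ[ℝ]) (isBoundedBilinearMap_wedge E) ha hb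

theorem fderiv_wedge {H : Type*} [NormedAddCommGroup H] [NormedSpace ℝ H]
    {a b : H → E →L[ℝ] ℍ[ℝ]} {x : H} (ha : DifferentiableAt ℝ a x) (hb : DifferentiableAt ℝ b x)
    (X : H) :
    fderiv ℝ (fun x => SwannGH.wedge (a x) (b x)) x X =
      SwannGH.wedge (a x) (fderiv ℝ b x X) + SwannGH.wedge (fderiv ℝ a x X) (b x) :=
  fderiv_of_bilinear (V := E →L[ℝ] ℍ[ℝ]) (W := E →L[ℝ] ℍ[ℝ])
    (X := E [⋀^Fin 2]→L[ℝ] ℍ[ℝ]) (isBoundedBilinearMap_wedge E) ha hb X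

theorem contDiffAt_dOne {E V : Type*} [NormedAddCommGroup E] [NormedSpace ℝ E]
    [NormedAddCommGroup V] [NormedSpace ℝ V] {a : E → E →L[ℝ] V} {x : E}
    (ha : ContDiffAt ℝ ∞ a x) : ContDiffAt ℝ ∞ (dOne a) x := by
  have hs : ContDiffAt ℝ ∞
      (fun y => ContinuousAlternatingMap.ofSubsingleton ℝ E V (0 : Fin 1) (a y)) x :=
    ContDiffAt.comp (g := ContinuousAlternatingMap.ofSubsingleton ℝ E V (0 : Fin 1)) x
      (ContinuousAlternatingMap.ofSubsingletonLIE (𝕜 := ℝ) (E := E) (F := V)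
        (0 : Fin 1)).toContinuousLinearEquiv.contDiff.contDiffAt ha
  exact ContDiffAt.comp (g := ContinuousAlternatingMap.alternatizeUncurryFinCLM ℝ E V (n := 1)) x
    (ContinuousLinearMap.contDiff _).contDiffAt (hs.fderiv_right (by simp))

theorem extDeriv_dOne {E V : Type*} [NormedAddCommGroup E] [NormedSpace ℝ E]
    [NormedAddCommGroup V] [NormedSpace ℝ V] {a : E → E →L[ℝ] V} {x : E}
    (ha : ContDiffAt ℝ ∞ a x) : extDeriv (dOne a) x = 0 := by
  have hs : ContDiffAt ℝ ∞
      (fun y => ContinuousAlternatingMap.ofSubsingleton ℝ E V (0 : Fin 1) (a y)) x :=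
    ContDiffAt.comp (g := ContinuousAlternatingMap.ofSubsingleton ℝ E V (0 : Fin 1)) x
      (ContinuousAlternatingMap.ofSubsingletonLIE (𝕜 := ℝ) (E := E) (F := V)
        (0 : Fin 1)).toContinuousLinearEquiv.contDiff.contDiffAt ha
  exact extDeriv_extDeriv_apply hs (by
    simp only [minSmoothness_of_isRCLikeNormedField]
    exact WithTop.coe_le_coe.2 (le_top (a := (2 : ℕ∞))))

theorem extDeriv_smul_dOne {E V : Type*} [NormedAddCommGroup E] [NormedSpace ℝ E]
    [NormedAddCommGroup V] [NormedSpace ℝ V] (c : ℝ) {a : E → E →L[ℝ] V} {x : E}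
    (ha : ContDiffAt ℝ ∞ a x) : extDeriv (fun y => c • dOne a y) x = 0 := by
  refine (extDeriv_fun_smul c (dOne a)).trans ?_
  rw [extDeriv_dOne ha, smul_zero]

/-- The covariant exterior derivative of the curvature `F = da - a ∧ a` vanishes. -/
theorem bianchi {a : E → E →L[ℝ] ℍ[ℝ]} {x : E} (ha : ContDiffAt ℝ ∞ a x) (X Y Z : E) :
    extDeriv (fun y => dOne a y - wedge (a y) (a y)) x ![X, Y, Z]
      - (a x X * (dOne a x - wedge (a x) (a x)) ![Y, Z]
        - a x Y * (dOne a x - wedge (a x) (a x)) ![X, Z]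
        + a x Z * (dOne a x - wedge (a x) (a x)) ![X, Y])
      + ((dOne a x - wedge (a x) (a x)) ![Y, Z] * a x X
        - (dOne a x - wedge (a x) (a x)) ![X, Z] * a x Y
        + (dOne a x - wedge (a x) (a x)) ![X, Y] * a x Z) = 0 := by
  have hd : DifferentiableAt ℝ a x := ha.differentiableAt (by simp)
  have hw := differentiableAt_wedge hd hd
  have hdd : extDeriv (dOne a) x = 0 := extDeriv_dOne (V := ℍ[ℝ]) ha
  have hdo : DifferentiableAt ℝ (dOne a) x :=
    (contDiffAt_dOne (V := ℍ[ℝ]) ha).differentiableAt (by simp)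
  have h3 : extDeriv (fun y => dOne a y - wedge (a y) (a y)) x ![X, Y, Z] =
      - extDeriv (fun y => wedge (a y) (a y)) x ![X, Y, Z] := by
    rw [extDeriv_sub_apply hdo hw, hdd]
    simp
  rw [h3, extDeriv_two_apply hw, fderiv_wedge hd hd, fderiv_wedge hd hd, fderiv_wedge hd hd]
  simp only [ContinuousAlternatingMap.sub_apply, dOne_apply hd, wedge_apply,
    ContinuousAlternatingMap.add_apply]
  noncomm_ring

end Forms

section Units

/-- The quaternion `a + b i + c j + d k`. -/
def quat (a b c d : ℝ) : ℍ[ℝ] := ⟨a, b, c, d⟩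

@[simp] theorem quat_re (a b c d : ℝ) : (quat a b c d).re = a := rfl
@[simp] theorem quat_imI (a b c d : ℝ) : (quat a b c d).imI = b := rfl
@[simp] theorem quat_imJ (a b c d : ℝ) : (quat a b c d).imJ = c := rfl
@[simp] theorem quat_imK (a b c d : ℝ) : (quat a b c d).imK = d := rfl

@[simp] theorem qi_re : qi.re = 0 := rfl
@[simp] theorem qi_imI : qi.imI = 1 := rfl
@[simp] theorem qi_imJ : qi.imJ = 0 := rfl
@[simp] theorem qi_imK : qi.imK = 0 := rfl
@[simp] theorem qj_re : qj.re = 0 := rfl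
@[simp] theorem qj_imI : qj.imI = 0 := rfl
@[simp] theorem qj_imJ : qj.imJ = 1 := rfl
@[simp] theorem qj_imK : qj.imK = 0 := rfl
@[simp] theorem qk_re : qk.re = 0 := rfl
@[simp] theorem qk_imI : qk.imI = 0 := rfl
@[simp] theorem qk_imJ : qk.imJ = 0 := rfl
@[simp] theorem qk_imK : qk.imK = 1 := rfl

end Units

/-! ### Quaternionic triples from left multiplication -/

/-- A linear coframe with values in a left quaternionic vector space pulls back the complex
structures given by left multiplication with `i`, `j`, `k` to a quaternionic triple. -/
theorem isQuaternionicTriple_of_linearEquiv {E W : Type*} [NormedAddCommGroup E] [NormedSpace ℝ E]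
    [AddCommGroup W] [Module ℝ W] [Module ℍ[ℝ] W] [IsScalarTower ℝ ℍ[ℝ] W]
    [SMulCommClass ℍ[ℝ] ℝ W] (T : E ≃ₗ[ℝ] W) (B : W → W → ℝ) {g : LinearMap.BilinForm ℝ E}
    {Ω : E [⋀^Fin 2]→L[ℝ] ℍ[ℝ]} (hg : ∀ X Y, g X Y = B (T X) (T Y))
    (hre : ∀ X Y, (Ω ![X, Y]).re = 0)
    (hΩ : ∀ a X Y, imVec (Ω ![X, Y]) a = B ((![qi, qj, qk] a) • T X) (T Y)) :
    IsQuaternionicTriple g Ω := by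
  have hsm : ∀ a b : ℍ[ℝ], ∀ w : W, a • b • w = (a * b) • w := fun a b w => (mul_smul a b w).symm
  have hii : qi * qi = -1 := by ext <;> simp
  have hjj : qj * qj = -1 := by ext <;> simp
  have hij : qi * qj = qk := by ext <;> simp
  have hji : qj * qi = -qk := by ext <;> simp
  refine ⟨hre, fun a => (T.symm : W →ₗ[ℝ] E) ∘ₗ
    (DistribSMul.toLinearMap ℝ W (![qi, qj, qk] a)) ∘ₗ (T : E →ₗ[ℝ] W), ?_, ?_, ?_, ?_, ?_⟩
  · ext X; simp [hsm, hii]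
  · ext X; simp [hsm, hjj]
  · ext X; simp [hsm, hij]
  · ext X; simp [hsm, hji]
  · intro a X Y
    rw [hΩ, hg]; simp

/-- The Kähler forms of left multiplication: `-½ (x ȳ - y x̄)` has components `⟨e_a x, y⟩`. -/
theorem imVec_kaehler (x y : ℍ[ℝ]) (a : Fin 3) :
    imVec ((-(1 / 2) : ℝ) • (x * star y - y * star x)) a =
      inner ℝ (![qi, qj, qk] a * x) y := by
  fin_cases a <;> simp [imVec, Quaternion.inner_def] <;> ring

theorem re_kaehler (x y : ℍ[ℝ]) : ((-(1 / 2) : ℝ) • (x * star y - y * star x)).re = 0 := by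
  simp; ring

/-! ### The quaternion-valued coframe of the Einstein metric -/

@[simp] theorem formRho_apply (X : Base) : formRho X = X.1.1 := rfl
@[simp] theorem formEta_apply (X : Base) : formEta X = X.1.2 := rfl
@[simp] theorem formPhi_apply (X : Base) : formPhi X = X.2 0 := rfl
@[simp] theorem formPsi_apply (X : Base) : formPsi X = X.2 1 := rfl
@[simp] theorem tensor_apply (u : Base →L[ℝ] ℝ) (c : ℍ[ℝ]) (X : Base) :
    tensor u c X = u X • c := rfl
@[simp] theorem rightMul_apply (a : Base →L[ℝ] ℍ[ℝ]) (c : ℍ[ℝ]) (X : Base) :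
    rightMul a c X = a X * c := rfl
@[simp] theorem sqForm_apply (u : Base →L[ℝ] ℝ) (X Y : Base) : sqForm u X Y = u X * u Y := rfl

/-- The `1`-form `(F - 2ρF_ρ)α - 2ρF_η β`. -/
def fibreForm₁ (F : ℝ × ℝ → ℝ) (z : ℝ × ℝ) : Base →L[ℝ] ℝ :=
  (F z - 2 * z.1 * dRho F z) • formAlpha z - (2 * z.1 * dEta F z) • formBeta z

/-- The `1`-form `-2ρF_η α + (F + 2ρF_ρ)β`. -/
def fibreForm₂ (F : ℝ × ℝ → ℝ) (z : ℝ × ℝ) : Base →L[ℝ] ℝ :=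
  (-2 * z.1 * dEta F z) • formAlpha z + (F z + 2 * z.1 * dRho F z) • formBeta z

theorem fibreForm₁_apply (F : ℝ × ℝ → ℝ) (z : ℝ × ℝ) (X : Base) :
    fibreForm₁ F z X = (F z - 2 * z.1 * dRho F z) * formAlpha z X
      - (2 * z.1 * dEta F z) * formBeta z X := rfl

theorem fibreForm₂_apply (F : ℝ × ℝ → ℝ) (z : ℝ × ℝ) (X : Base) :
    fibreForm₂ F z X = (-2 * z.1 * dEta F z) * formAlpha z X
      + (F z + 2 * z.1 * dRho F z) * formBeta z X := rfl

theorem fibreForm_wedge (F : ℝ × ℝ → ℝ) (z : ℝ × ℝ) (X Y : Base) :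
    fibreForm₁ F z X * fibreForm₂ F z Y - fibreForm₁ F z Y * fibreForm₂ F z X =
      discr F z * (formAlpha z X * formBeta z Y - formAlpha z Y * formBeta z X) := by
  rw [fibreForm₁_apply, fibreForm₁_apply, fibreForm₂_apply, fibreForm₂_apply, discr]
  ring

theorem baseMetric_apply (F : ℝ × ℝ → ℝ) (p X Y : Base) :
    baseMetric F p X Y = discr F p.1 / (4 * F p.1 ^ 2) / p.1.1 ^ 2 * (X.1.1 * Y.1.1 + X.1.2 * Y.1.2)
      + (F p.1 ^ 2 * discr F p.1)⁻¹ * (fibreForm₁ F p.1 X * fibreForm₁ F p.1 Y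
        + fibreForm₂ F p.1 X * fibreForm₂ F p.1 Y) := rfl

theorem frameForm_apply (F : ℝ × ℝ → ℝ) (p X Y : Base) :
    frameForm F p ![X, Y] = quat 0 ((F p.1 ^ 2)⁻¹ *
        (-(discr F p.1) / 4 / p.1.1 ^ 2 * (X.1.1 * Y.1.2 - Y.1.1 * X.1.2)
          + (formAlpha p.1 X * formBeta p.1 Y - formAlpha p.1 Y * formBeta p.1 X)))
      (-(1 / 2) * (F p.1 ^ 2)⁻¹ * p.1.1⁻¹ *
        (fibreForm₁ F p.1 X * Y.1.1 - fibreForm₁ F p.1 Y * X.1.1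
          + (fibreForm₂ F p.1 X * Y.1.2 - fibreForm₂ F p.1 Y * X.1.2)))
      (-(1 / 2) * (F p.1 ^ 2)⁻¹ * p.1.1⁻¹ *
        (fibreForm₂ F p.1 X * Y.1.1 - fibreForm₂ F p.1 Y * X.1.1
          - (fibreForm₁ F p.1 X * Y.1.2 - fibreForm₁ F p.1 Y * X.1.2))) := by
  simp only [fibreForm₁_apply, fibreForm₂_apply, discr]
  ext <;> simp [frameForm, wedge_apply] <;> ring

/-- A coframe of the Einstein metric, as a single quaternion-valued `1`-form: the metric is
`⟨E, E⟩` and the frame of antiselfdual forms is `-½ E ∧ Ē`.  The square root of `ε Δ`, with `Δ = discr F`, is real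
on the region where the metric is positive definite. -/
def quatCoframe (ε : ℝ) (F : ℝ × ℝ → ℝ) (p : Base) : Base →L[ℝ] ℍ[ℝ] :=
  (ε * √(ε * discr F p.1) / (2 * F p.1 * p.1.1)) • (tensor formRho 1 - tensor formEta qi) +
    (F p.1 * √(ε * discr F p.1))⁻¹ •
      (tensor (fibreForm₁ F p.1) qj + tensor (fibreForm₂ F p.1) qk)

theorem quatCoframe_apply (ε : ℝ) (F : ℝ × ℝ → ℝ) (p X : Base) :
    quatCoframe ε F p X = quat (ε * √(ε * discr F p.1) / (2 * F p.1 * p.1.1) * X.1.1)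
      (-(ε * √(ε * discr F p.1) / (2 * F p.1 * p.1.1) * X.1.2))
      ((F p.1 * √(ε * discr F p.1))⁻¹ * fibreForm₁ F p.1 X)
      ((F p.1 * √(ε * discr F p.1))⁻¹ * fibreForm₂ F p.1 X) := by
  ext <;> simp [quatCoframe]

section Coframe

variable {ε : ℝ} {F : ℝ × ℝ → ℝ} {p : Base}

theorem einsteinMetric_eq_inner (hε : ε * ε = 1) (h0 : F p.1 ≠ 0) (hρ : p.1.1 ≠ 0)
    (hd : 0 < ε * discr F p.1) (X Y : Base) :
    einsteinMetric ε F p X Y = inner ℝ (quatCoframe ε F p X) (quatCoframe ε F p Y) := by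
  have hw := Real.sq_sqrt hd.le
  have hw0 : √(ε * discr F p.1) ≠ 0 := (Real.sqrt_pos.2 hd).ne'
  have hd' : discr F p.1 ≠ 0 := right_ne_zero_of_mul hd.ne'
  have hD : discr F p.1 = ε * √(ε * discr F p.1) ^ 2 := by
    rw [hw, ← mul_assoc, hε, one_mul]
  have hεi : ε⁻¹ = ε := inv_eq_of_mul_eq_one_left hε
  have hεn : ε ≠ 0 := left_ne_zero_of_mul hd.ne'
  rw [einsteinMetric, LinearMap.smul_apply, LinearMap.smul_apply, baseMetric_apply,
    quatCoframe_apply, quatCoframe_apply, Quaternion.inner_def]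
  generalize √(ε * discr F p.1) = w at *
  rw [hD]
  simp
  field_simp
  ring

theorem einsteinFrame_eq (hε : ε * ε = 1) (h0 : F p.1 ≠ 0) (hρ : p.1.1 ≠ 0)
    (hd : 0 < ε * discr F p.1) (X Y : Base) :
    einsteinFrame ε F p ![X, Y] = (-(1 / 2) : ℝ) •
      (quatCoframe ε F p X * star (quatCoframe ε F p Y)
        - quatCoframe ε F p Y * star (quatCoframe ε F p X)) := by
  have hw := Real.sq_sqrt hd.le
  have hw0 : √(ε * discr F p.1) ≠ 0 := (Real.sqrt_pos.2 hd).ne'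
  have hD : discr F p.1 = ε * √(ε * discr F p.1) ^ 2 := by
    rw [hw, ← mul_assoc, hε, one_mul]
  have huv := fibreForm_wedge F p.1 X Y
  have hεn : ε ≠ 0 := left_ne_zero_of_mul hd.ne'
  rw [einsteinFrame, ContinuousAlternatingMap.smul_apply, frameForm_apply,
    quatCoframe_apply, quatCoframe_apply]
  generalize √(ε * discr F p.1) = w at *
  rw [hD] at huv ⊢
  ext
  · simp; ring
  · simp
    field_simp
    linear_combination (-32 * p.1.1 ^ 2) * huv
  · simp
    field_simp
    ring
  · simp
    field_simp
    ring

theorem quatCoframe_injective (h0 : F p.1 ≠ 0) (hρ : 0 < p.1.1)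
    (hd : 0 < ε * discr F p.1) : Function.Injective (quatCoframe ε F p) := by
  rw [injective_iff_map_eq_zero]
  intro X hX
  have hw0 : √(ε * discr F p.1) ≠ 0 := (Real.sqrt_pos.2 hd).ne'
  have hεn : ε ≠ 0 := left_ne_zero_of_mul hd.ne'
  have hd' : discr F p.1 ≠ 0 := right_ne_zero_of_mul hd.ne'
  have hs : √p.1.1 ≠ 0 := (Real.sqrt_pos.2 hρ).ne'
  rw [quatCoframe_apply] at hX
  have h1 := congrArg QuaternionAlgebra.re hX
  have h2 := congrArg QuaternionAlgebra.imI hX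
  have h3 := congrArg QuaternionAlgebra.imJ hX
  have h4 := congrArg QuaternionAlgebra.imK hX
  simp [hw0, hεn, h0, hρ.ne'] at h1 h2 h3 h4
  -- the forms `α`, `β` are recovered from the two fibre forms by Cramer's rule
  have hα : discr F p.1 * formAlpha p.1 X = 0 := by
    rw [fibreForm₁_apply] at h3; rw [fibreForm₂_apply] at h4; rw [discr]
    linear_combination (F p.1 + 2 * p.1.1 * dRho F p.1) * h3 + 2 * p.1.1 * dEta F p.1 * h4
  have hβ : discr F p.1 * formBeta p.1 X = 0 := by
    rw [fibreForm₁_apply] at h3; rw [fibreForm₂_apply] at h4; rw [discr]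
    linear_combination (F p.1 - 2 * p.1.1 * dRho F p.1) * h4 + 2 * p.1.1 * dEta F p.1 * h3
  have hα' : X.2 0 = 0 := by
    simpa [hd', formAlpha, hs] using hα
  have hβ' : X.2 1 = 0 := by
    simpa [hd', formBeta, hs, hα'] using hβ
  ext i
  · exact h1
  · exact h2
  · fin_cases i
    · exact hα'
    · exact hβ'

theorem finrank_base : Module.finrank ℝ Base = 4 := by
  simp

/-- The coframe as a linear isomorphism of the tangent space with the quaternions. -/
def quatCoframeEquiv (h0 : F p.1 ≠ 0) (hρ : 0 < p.1.1)
    (hd : 0 < ε * discr F p.1) : Base ≃ₗ[ℝ] ℍ[ℝ] :=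
  LinearEquiv.ofInjectiveOfFinrankEq (quatCoframe ε F p).toLinearMap
    (quatCoframe_injective h0 hρ hd) (by rw [finrank_base, Quaternion.finrank_eq_four])

end Coframe

/-! ### Antiselfduality -/

/-- Complementary `2 × 2` minors of the rows of an orthogonal matrix of determinant `-1`. -/
theorem minor_eq_of_orthogonal {R : Matrix (Fin 4) (Fin 4) ℝ} (hR : R * Rᵀ = 1)
    (hdet : R.det = -1) (v w : Fin 4 → ℝ) :
    (Matrix.of ![v, w, R 2, R 3]).det =
      -((v ⬝ᵥ R 0) * (w ⬝ᵥ R 1) - (v ⬝ᵥ R 1) * (w ⬝ᵥ R 0)) := by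
  have hrow : ∀ i j, R i ⬝ᵥ R j = (1 : Matrix (Fin 4) (Fin 4) ℝ) i j := fun i j => by
    rw [← hR]; rfl
  have h : (Matrix.of ![v, w, R 2, R 3]) * Rᵀ =
      Matrix.of ![fun j => v ⬝ᵥ R j, fun j => w ⬝ᵥ R j, Pi.single 2 1, Pi.single 3 1] := by
    ext i j
    have : ((Matrix.of ![v, w, R 2, R 3]) * Rᵀ) i j = (![v, w, R 2, R 3] i) ⬝ᵥ R j := rfl
    rw [this]
    fin_cases i
    · rfl
    · rfl
    · simp [hrow, Matrix.one_apply, Pi.single_apply, eq_comm]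
    · simp [hrow, Matrix.one_apply, Pi.single_apply, eq_comm]
  have h2 := congrArg Matrix.det h
  rw [Matrix.det_mul, Matrix.det_transpose, hdet] at h2
  have h3 : (Matrix.of ![fun j => v ⬝ᵥ R j, fun j => w ⬝ᵥ R j, Pi.single 2 1, Pi.single 3 1]).det
      = (v ⬝ᵥ R 0) * (w ⬝ᵥ R 1) - (v ⬝ᵥ R 1) * (w ⬝ᵥ R 0) := by
    simp [Matrix.det_succ_row_zero, Fin.sum_univ_succ, Fin.succAbove, Pi.single_apply]
    ring
  linarith

/-- The matrix of components of a quadruple of quaternions. -/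
def componentMatrix (x : Fin 4 → ℍ[ℝ]) : Matrix (Fin 4) (Fin 4) ℝ :=
  Matrix.of fun i => ![(x i).re, (x i).imI, (x i).imJ, (x i).imK]

theorem componentMatrix_mul_transpose (x : Fin 4 → ℍ[ℝ])
    (hx : ∀ i j, inner ℝ (x i) (x j) = if i = j then (1 : ℝ) else 0) :
    componentMatrix x * (componentMatrix x)ᵀ = 1 := by
  ext i j
  rw [Matrix.one_apply, ← hx, Matrix.mul_apply, Quaternion.inner_def]
  simp [componentMatrix, Fin.sum_univ_succ]
  ring

/-- For an orthonormal basis of the quaternions, negatively oriented with respect to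
`1, i, j, k`, the Kähler forms of left multiplication are antiselfdual. -/
theorem kaehler_antiselfdual (x : Fin 4 → ℍ[ℝ])
    (hx : ∀ i j, inner ℝ (x i) (x j) = if i = j then (1 : ℝ) else 0)
    (hdet : (componentMatrix x).det < 0) :
    x 0 * star (x 1) - x 1 * star (x 0) = -(x 2 * star (x 3) - x 3 * star (x 2)) := by
  have hR := componentMatrix_mul_transpose x hx
  have h1 : (componentMatrix x).det = -1 := by
    have := congrArg Matrix.det hR
    rw [Matrix.det_mul, Matrix.det_transpose, Matrix.det_one] at this
    nlinarith
  -- the components of `x ȳ - y x̄` are sums of two minors, one for each of two complementary pairs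
  have key := fun v w => minor_eq_of_orthogonal hR h1 v w
  have m01 := key (Pi.single 0 1) (Pi.single 1 1)
  have m02 := key (Pi.single 0 1) (Pi.single 2 1)
  have m03 := key (Pi.single 0 1) (Pi.single 3 1)
  have m12 := key (Pi.single 1 1) (Pi.single 2 1)
  have m13 := key (Pi.single 1 1) (Pi.single 3 1)
  have m23 := key (Pi.single 2 1) (Pi.single 3 1)
  simp [componentMatrix, Matrix.det_succ_row_zero, Fin.sum_univ_succ, Fin.succAbove,
    Pi.single_apply] at m01 m02 m03 m12 m13 m23
  ext
  · simp; ring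
  · simp; linarith
  · simp; linarith
  · simp; linarith

/-- The sign of the right-hand side shows that the coframe is negatively oriented for the orientation
`ε dρ ∧ dη ∧ dφ ∧ dψ`. -/
theorem det_componentMatrix_quatCoframe {ε : ℝ} {F : ℝ × ℝ → ℝ} {p : Base} (hε : ε * ε = 1)
    (h0 : F p.1 ≠ 0) (hρ : 0 < p.1.1) (hd : 0 < ε * discr F p.1) (e : Fin 4 → Base) :
    (componentMatrix fun i => quatCoframe ε F p (e i)).det =
      -(discr F p.1 / (4 * F p.1 ^ 4 * p.1.1 ^ 2)) * coordDet e := by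
  have hw0 : √(ε * discr F p.1) ≠ 0 := (Real.sqrt_pos.2 hd).ne'
  have hs : √p.1.1 ≠ 0 := (Real.sqrt_pos.2 hρ).ne'
  set w := √(ε * discr F p.1) with hw
  set s := √p.1.1 with hs'
  -- the coframe factors through the coordinate differentials
  have h : (componentMatrix fun i => quatCoframe ε F p (e i)) =
      (Matrix.of fun i => ![formRho (e i), formEta (e i), formPhi (e i), formPsi (e i)]) *
      !![ε * w / (2 * F p.1 * p.1.1), 0, 0, 0;
         0, -(ε * w / (2 * F p.1 * p.1.1)), 0, 0;
         0, 0, (F p.1 * w)⁻¹ * ((F p.1 - 2 * p.1.1 * dRho F p.1) * s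
            - (2 * p.1.1 * dEta F p.1) * (s⁻¹ * p.1.2)),
          (F p.1 * w)⁻¹ * ((-2 * p.1.1 * dEta F p.1) * s
            + (F p.1 + 2 * p.1.1 * dRho F p.1) * (s⁻¹ * p.1.2));
         0, 0, (F p.1 * w)⁻¹ * (-(2 * p.1.1 * dEta F p.1) * s⁻¹),
          (F p.1 * w)⁻¹ * ((F p.1 + 2 * p.1.1 * dRho F p.1) * s⁻¹)] := by
    ext i j
    rw [Matrix.mul_apply]
    fin_cases j <;>
    simp [componentMatrix, quatCoframe_apply, Fin.sum_univ_succ, fibreForm₁_apply,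
      fibreForm₂_apply, formAlpha, formBeta, ← hs', ← hw] <;> ring
  rw [h, Matrix.det_mul, coordDet, mul_comm]
  congr 1
  simp [Matrix.det_succ_row_zero, Fin.sum_univ_succ, Fin.succAbove]
  rw [discr]
  field_simp
  linear_combination (4 * s ^ 2 *
    (F p.1 ^ 2 - p.1.1 ^ 2 * 4 * (dRho F p.1 ^ 2 + dEta F p.1 ^ 2))) * hε

theorem einsteinFrame_antiselfdual {ε : ℝ} {F : ℝ × ℝ → ℝ} {p : Base} (hε : ε * ε = 1)
    (h0 : F p.1 ≠ 0) (hρ : 0 < p.1.1) (hd : 0 < ε * discr F p.1) :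
    IsAntiSelfDual ε (einsteinMetric ε F p) (einsteinFrame ε F p) := by
  intro e he hor
  simp only [einsteinFrame_eq hε h0 hρ.ne' hd]
  rw [kaehler_antiselfdual (fun i => quatCoframe ε F p (e i)), smul_neg]
  · intro i j
    rw [← einsteinMetric_eq_inner hε h0 hρ.ne' hd, he]
  · rw [det_componentMatrix_quatCoframe hε h0 hρ hd]
    have h : 0 < discr F p.1 * coordDet e := by
      have := mul_pos hd hor
      calc 0 < ε * discr F p.1 * (ε * coordDet e) := this
        _ = (ε * ε) * (discr F p.1 * coordDet e) := by ring
        _ = _ := by rw [hε, one_mul]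
    have hc : 0 < (4 * F p.1 ^ 4 * p.1.1 ^ 2)⁻¹ := by positivity
    calc _ = -((4 * F p.1 ^ 4 * p.1.1 ^ 2)⁻¹ * (discr F p.1 * coordDet e)) := by ring
      _ < 0 := neg_lt_zero.2 (mul_pos hc h)

theorem einsteinFrame_triple {ε : ℝ} {F : ℝ × ℝ → ℝ} {p : Base} (hε : ε * ε = 1)
    (h0 : F p.1 ≠ 0) (hρ : 0 < p.1.1) (hd : 0 < ε * discr F p.1) :
    IsQuaternionicTriple (einsteinMetric ε F p) (einsteinFrame ε F p) := by
  refine isQuaternionicTriple_of_linearEquiv (quatCoframeEquiv h0 hρ hd)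
    (fun x y => inner ℝ x y) (einsteinMetric_eq_inner hε h0 hρ.ne' hd) ?_ ?_
  · intro X Y
    rw [einsteinFrame_eq hε h0 hρ.ne' hd, re_kaehler]
  · intro a X Y
    rw [einsteinFrame_eq hε h0 hρ.ne' hd, imVec_kaehler]
    rfl

/-! ### Derivatives of a hyperbolic eigenfunction -/

section Jets

variable {U : Set (ℝ × ℝ)} {F : ℝ × ℝ → ℝ} {z : ℝ × ℝ}

theorem fderiv_eq_dRho_dEta (f : ℝ × ℝ → ℝ) (z : ℝ × ℝ) :
    fderiv ℝ f z = dRho f z • ContinuousLinearMap.fst ℝ ℝ ℝ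
      + dEta f z • ContinuousLinearMap.snd ℝ ℝ ℝ := by
  ext <;> simp [dRho, dEta]

theorem hasFDerivAt_dRho_dEta {f : ℝ × ℝ → ℝ} (hf : DifferentiableAt ℝ f z) :
    HasFDerivAt f (dRho f z • ContinuousLinearMap.fst ℝ ℝ ℝ
      + dEta f z • ContinuousLinearMap.snd ℝ ℝ ℝ) z := by
  rw [← fderiv_eq_dRho_dEta]
  exact hf.hasFDerivAt

theorem contDiffOn_dRho {f : ℝ × ℝ → ℝ} (hU : IsOpen U) (hf : ContDiffOn ℝ ∞ f U) :
    ContDiffOn ℝ ∞ (dRho f) U :=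
  (hf.fderiv_of_isOpen hU (by simp)).clm_apply contDiffOn_const

theorem contDiffOn_dEta {f : ℝ × ℝ → ℝ} (hU : IsOpen U) (hf : ContDiffOn ℝ ∞ f U) :
    ContDiffOn ℝ ∞ (dEta f) U :=
  (hf.fderiv_of_isOpen hU (by simp)).clm_apply contDiffOn_const

theorem dRho_dEta_comm {f : ℝ × ℝ → ℝ} (hU : IsOpen U) (hf : ContDiffOn ℝ ∞ f U) (hz : z ∈ U) :
    dRho (dEta f) z = dEta (dRho f) z := by
  have hfz : ContDiffAt ℝ ∞ f z := hf.contDiffAt (hU.mem_nhds hz)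
  have hd : DifferentiableAt ℝ (fderiv ℝ f) z :=
    ((hf.fderiv_of_isOpen hU (m := ∞) (by simp)).contDiffAt (hU.mem_nhds hz)).differentiableAt
      (by simp)
  have hs : IsSymmSndFDerivAt ℝ f z := hfz.isSymmSndFDerivAt (by
    simp only [minSmoothness_of_isRCLikeNormedField]
    exact WithTop.coe_le_coe.2 (le_top (a := (2 : ℕ∞))))
  have key : ∀ v w : ℝ × ℝ, fderiv ℝ (fun y => fderiv ℝ f y v) z w = fderiv ℝ (fderiv ℝ f) z w v :=
    fun v w => by
      rw [fderiv_clm_apply hd (differentiableAt_const v)]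
      simp
  change fderiv ℝ (fun y => fderiv ℝ f y (0, 1)) z (1, 0) =
    fderiv ℝ (fun y => fderiv ℝ f y (1, 0)) z (0, 1)
  rw [key, key]
  exact hs _ _

namespace IsHyperbolicEigenfunction

theorem hasFDerivAt (hF : IsHyperbolicEigenfunction U F) (hz : z ∈ U) :
    HasFDerivAt F (dRho F z • ContinuousLinearMap.fst ℝ ℝ ℝ
      + dEta F z • ContinuousLinearMap.snd ℝ ℝ ℝ) z :=
  hasFDerivAt_dRho_dEta ((hF.smooth.contDiffAt (hF.isOpen.mem_nhds hz)).differentiableAt (by simp))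

theorem hasFDerivAt_dRho (hF : IsHyperbolicEigenfunction U F) (hz : z ∈ U) :
    HasFDerivAt (dRho F) (dRho (dRho F) z • ContinuousLinearMap.fst ℝ ℝ ℝ
      + dEta (dRho F) z • ContinuousLinearMap.snd ℝ ℝ ℝ) z :=
  hasFDerivAt_dRho_dEta (((contDiffOn_dRho hF.isOpen hF.smooth).contDiffAt
    (hF.isOpen.mem_nhds hz)).differentiableAt (by simp))

/-- The derivative `F_ηη` is eliminated by the eigenvalue equation. -/
theorem hasFDerivAt_dEta (hF : IsHyperbolicEigenfunction U F) (hz : z ∈ U) :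
    HasFDerivAt (dEta F) (dEta (dRho F) z • ContinuousLinearMap.fst ℝ ℝ ℝ
      + (3 * F z / (4 * z.1 ^ 2) - dRho (dRho F) z) • ContinuousLinearMap.snd ℝ ℝ ℝ) z := by
  have h := hasFDerivAt_dRho_dEta (((contDiffOn_dEta hF.isOpen hF.smooth).contDiffAt
    (hF.isOpen.mem_nhds hz)).differentiableAt (by simp))
  rw [dRho_dEta_comm hF.isOpen hF.smooth hz] at h
  rwa [← hF.eigen z hz, add_sub_cancel_left]

theorem continuousOn_discr (hF : IsHyperbolicEigenfunction U F) : ContinuousOn (discr F) U := by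
  have h1 := hF.smooth.continuousOn
  have h2 := (contDiffOn_dRho hF.isOpen hF.smooth).continuousOn
  have h3 := (contDiffOn_dEta hF.isOpen hF.smooth).continuousOn
  unfold discr
  fun_prop

theorem isOpen_regularSet (hF : IsHyperbolicEigenfunction U F) (ε : ℝ) :
    IsOpen (regularSet ε U F) := by
  have h1 := hF.smooth.continuousOn.isOpen_inter_preimage hF.isOpen isOpen_ne (t := {x | x ≠ 0})
  have h2 := (continuousOn_const.mul hF.continuousOn_discr).isOpen_inter_preimage hF.isOpen
    isOpen_Ioi (f := fun z => ε * discr F z) (t := Set.Ioi 0)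
  have h : regularSet ε U F = (U ∩ F ⁻¹' {x | x ≠ 0}) ∩ (U ∩ (fun z => ε * discr F z) ⁻¹' Set.Ioi 0) :=
    Set.ext fun z => ⟨fun h => ⟨⟨h.1, h.2.1⟩, ⟨h.1, h.2.2⟩⟩, fun h => ⟨h.1.1, h.1.2, h.2.2⟩⟩
  rw [h]
  exact h1.inter h2

theorem isOpen_baseRegion (hF : IsHyperbolicEigenfunction U F) (ε : ℝ) :
    IsOpen (baseRegion ε U F) :=
  (hF.isOpen_regularSet ε).preimage continuous_fst

end IsHyperbolicEigenfunction

end Jets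

/-! ### Smoothness of the base data -/

section Smooth

variable {ε : ℝ} {U : Set (ℝ × ℝ)} {F : ℝ × ℝ → ℝ}

/-- The coefficients of `connectionForm` with respect to
`i dρ`, `i dη`, `j dφ`, `k dφ`, `k dψ`. -/
def connCoeff (F : ℝ × ℝ → ℝ) : Fin 5 → ℝ × ℝ → ℝ :=
  ![fun z => 2⁻¹ * (F z)⁻¹ * dEta F z, fun z => -2⁻¹ * (2⁻¹ * z.1⁻¹ + (F z)⁻¹ * dRho F z),
    fun z => 2⁻¹ * (F z)⁻¹ * √z.1, fun z => -2⁻¹ * (F z)⁻¹ * (√z.1)⁻¹ * z.2,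
    fun z => -2⁻¹ * (F z)⁻¹ * (√z.1)⁻¹]

/-- The constant quaternion-valued `1`-forms `i dρ`, `i dη`, `j dφ`, `k dφ`, `k dψ`. -/
def connBasis : Fin 5 → Base →L[ℝ] ℍ[ℝ] :=
  ![tensor formRho qi, tensor formEta qi, tensor formPhi qj, tensor formPhi qk, tensor formPsi qk]

theorem connectionForm_apply {p : Base} (X : Base) : connectionForm F p X = quat 0
    (-(1 / 2) * (F p.1)⁻¹ * ((-p.1.1 * dEta F p.1 / p.1.1) * X.1.1
      + ((F p.1 / 2 + p.1.1 * dRho F p.1) / p.1.1) * X.1.2))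
    (1 / 2 * (F p.1)⁻¹ * formAlpha p.1 X) (-(1 / 2) * (F p.1)⁻¹ * formBeta p.1 X) := by
  ext <;> simp [connectionForm] <;> ring

theorem connectionForm_eq_sum {p : Base} (h0 : F p.1 ≠ 0) (hρ : p.1.1 ≠ 0) :
    connectionForm F p = ∑ a, connCoeff F a p.1 • connBasis a := by
  refine ContinuousLinearMap.ext fun X => ?_
  rw [connectionForm_apply]
  simp only [Fin.sum_univ_succ, connCoeff, connBasis]
  ext
  · simp
  · simp; field_simp; ring
  · simp [formAlpha]; ring
  · simp [formBeta]; ring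

theorem contDiffOn_connCoeff (hF : IsHyperbolicEigenfunction U F) (a : Fin 5) :
    ContDiffOn ℝ ∞ (connCoeff F a) (regularSet ε U F) := by
  have hsub : regularSet ε U F ⊆ U := fun z hz => hz.1
  have h1 := hF.smooth.mono hsub
  have h2 := (contDiffOn_dRho hF.isOpen hF.smooth).mono hsub
  have h3 := (contDiffOn_dEta hF.isOpen hF.smooth).mono hsub
  have hi : ContDiffOn ℝ ∞ (fun z => (F z)⁻¹) (regularSet ε U F) := h1.inv fun z hz => hz.2.1
  have hr : ContDiffOn ℝ ∞ (fun z : ℝ × ℝ => z.1⁻¹) (regularSet ε U F) :=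
    contDiff_fst.contDiffOn.inv fun z hz => (hF.rho_pos z hz.1).ne'
  have hs : ContDiffOn ℝ ∞ (fun z : ℝ × ℝ => √z.1) (regularSet ε U F) :=
    contDiff_fst.contDiffOn.sqrt fun z hz => (hF.rho_pos z hz.1).ne'
  have hsi : ContDiffOn ℝ ∞ (fun z : ℝ × ℝ => (√z.1)⁻¹) (regularSet ε U F) :=
    hs.inv fun z hz => (Real.sqrt_pos.2 (hF.rho_pos z hz.1)).ne'
  have hη : ContDiffOn ℝ ∞ (fun z : ℝ × ℝ => z.2) (regularSet ε U F) := contDiff_snd.contDiffOn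
  fin_cases a
  · exact (contDiffOn_const.mul hi).mul h3
  · exact contDiffOn_const.mul ((contDiffOn_const.mul hr).add (hi.mul h2))
  · exact (contDiffOn_const.mul hi).mul hs
  · exact ((contDiffOn_const.mul hi).mul hsi).mul hη
  · exact (contDiffOn_const.mul hi).mul hsi

theorem smul_sum_smul {V : Type*} [NormedAddCommGroup V] [NormedSpace ℝ V] {n : ℕ} (c : ℝ)
    (f : Fin n → ℝ) (C : Fin n → V) : c • ∑ a, f a • C a = ∑ a, (c * f a) • C a := by
  rw [Finset.smul_sum]
  simp only [mul_smul]

theorem contDiffOn_sum_smul {E V : Type*} [NormedAddCommGroup E] [NormedSpace ℝ E]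
    [NormedAddCommGroup V] [NormedSpace ℝ V] {n : ℕ} {s : Set E} {f : Fin n → E → ℝ} {C : Fin n → V}
    (hf : ∀ a, ContDiffOn ℝ ∞ (f a) s) : ContDiffOn ℝ ∞ (fun x => ∑ a, f a x • C a) s :=
  ContDiffOn.sum fun a _ => (hf a).smul contDiffOn_const

theorem contDiffOn_connectionForm (hF : IsHyperbolicEigenfunction U F) :
    ContDiffOn ℝ ∞ (connectionForm F) (baseRegion ε U F) := by
  have h : ContDiffOn ℝ ∞ (fun p : Base => ∑ a, connCoeff F a p.1 • connBasis a)
      (baseRegion ε U F) :=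
    contDiffOn_sum_smul (V := Base →L[ℝ] ℍ[ℝ]) (f := fun a (p : Base) => connCoeff F a p.1)
      fun a => (contDiffOn_connCoeff hF a).comp contDiff_fst.contDiffOn fun p hp => hp
  exact h.congr fun p hp => connectionForm_eq_sum hp.2.1 (hF.rho_pos _ hp.1).ne'

/-- The coefficients of `frameForm` with respect to constant `2`-forms. -/
def frameCoeff (F : ℝ × ℝ → ℝ) : Fin 6 → ℝ × ℝ → ℝ :=
  ![fun z => (F z)⁻¹ ^ 2 * discr F z * z.1⁻¹ ^ 2, fun z => (F z)⁻¹ ^ 2,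
    fun z => (F z)⁻¹ ^ 2 * z.1⁻¹ *
      ((F z - 2 * z.1 * dRho F z) * √z.1 - 2 * z.1 * dEta F z * ((√z.1)⁻¹ * z.2)),
    fun z => (F z)⁻¹ ^ 2 * z.1⁻¹ * (2 * z.1 * dEta F z * (√z.1)⁻¹),
    fun z => (F z)⁻¹ ^ 2 * z.1⁻¹ *
      ((F z + 2 * z.1 * dRho F z) * ((√z.1)⁻¹ * z.2) - 2 * z.1 * dEta F z * √z.1),
    fun z => (F z)⁻¹ ^ 2 * z.1⁻¹ * ((F z + 2 * z.1 * dRho F z) * (√z.1)⁻¹)]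

/-- The constant `2`-forms in which `frameForm` is expanded. -/
def frameBasis : Fin 6 → Base [⋀^Fin 2]→L[ℝ] ℍ[ℝ] :=
  let W : (Base →L[ℝ] ℝ) → (Base →L[ℝ] ℝ) → ℍ[ℝ] → Base [⋀^Fin 2]→L[ℝ] ℍ[ℝ] := fun a b c =>
    wedge (tensor a 1) (tensor b c)
  ![(-(1 / 4) : ℝ) • W formRho formEta qi, W formPhi formPsi qi,
    (-(1 / 2) : ℝ) • (W formPhi formRho qj - W formPhi formEta qk),
    (1 / 2 : ℝ) • (W formPsi formRho qj - W formPsi formEta qk),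
    (-(1 / 2) : ℝ) • (W formPhi formEta qj + W formPhi formRho qk),
    (-(1 / 2) : ℝ) • (W formPsi formEta qj + W formPsi formRho qk)]

theorem frameForm_eq_sum {p : Base} (hρ : 0 < p.1.1) :
    frameForm F p = ∑ a, frameCoeff F a p.1 • frameBasis a := by
  have hs : √p.1.1 ≠ 0 := (Real.sqrt_pos.2 hρ).ne'
  refine twoForm_ext fun X Y => ?_
  rw [frameForm_apply]
  simp only [Fin.sum_univ_succ, frameCoeff, frameBasis, fibreForm₁_apply, fibreForm₂_apply,
    formAlpha, formBeta]
  ext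
  · simp [wedge_apply]
  · simp [wedge_apply]; field_simp; ring
  · simp [wedge_apply]; ring
  · simp [wedge_apply]; ring

theorem contDiffOn_frameCoeff (hF : IsHyperbolicEigenfunction U F) (a : Fin 6) :
    ContDiffOn ℝ ∞ (frameCoeff F a) (regularSet ε U F) := by
  have hsub : regularSet ε U F ⊆ U := fun z hz => hz.1
  have h1 := hF.smooth.mono hsub
  have h2 := (contDiffOn_dRho hF.isOpen hF.smooth).mono hsub
  have h3 := (contDiffOn_dEta hF.isOpen hF.smooth).mono hsub
  have hi : ContDiffOn ℝ ∞ (fun z => (F z)⁻¹) (regularSet ε U F) := h1.inv fun z hz => hz.2.1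
  have hr : ContDiffOn ℝ ∞ (fun z : ℝ × ℝ => z.1⁻¹) (regularSet ε U F) :=
    contDiff_fst.contDiffOn.inv fun z hz => (hF.rho_pos z hz.1).ne'
  have hs : ContDiffOn ℝ ∞ (fun z : ℝ × ℝ => √z.1) (regularSet ε U F) :=
    contDiff_fst.contDiffOn.sqrt fun z hz => (hF.rho_pos z hz.1).ne'
  have hsi : ContDiffOn ℝ ∞ (fun z : ℝ × ℝ => (√z.1)⁻¹) (regularSet ε U F) :=
    hs.inv fun z hz => (Real.sqrt_pos.2 (hF.rho_pos z hz.1)).ne'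
  unfold frameCoeff discr
  fin_cases a <;> simp only [Matrix.cons_val, Fin.reduceFinMk] <;> fun_prop

theorem contDiffOn_einsteinFrame (hF : IsHyperbolicEigenfunction U F) :
    ContDiffOn ℝ ∞ (einsteinFrame ε F) (baseRegion ε U F) := by
  have h : ContDiffOn ℝ ∞ (fun p : Base => ∑ a, (ε * frameCoeff F a p.1) • frameBasis a)
      (baseRegion ε U F) :=
    contDiffOn_sum_smul (V := Base [⋀^Fin 2]→L[ℝ] ℍ[ℝ])
      (f := fun a (p : Base) => ε * frameCoeff F a p.1) fun a =>
      contDiffOn_const.mul ((contDiffOn_frameCoeff hF a).comp contDiff_fst.contDiffOn fun p hp => hp)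
  refine h.congr fun p hp => ?_
  rw [einsteinFrame, frameForm_eq_sum (hF.rho_pos _ hp.1)]
  exact smul_sum_smul (V := Base [⋀^Fin 2]→L[ℝ] ℍ[ℝ]) ε (fun a => frameCoeff F a p.1) frameBasis

end Smooth

/-! ### The curvature of the connection form -/

section Curvature

variable {ε : ℝ} {U : Set (ℝ × ℝ)} {F : ℝ × ℝ → ℝ}

theorem hasFDerivAt_sqrt_fst {z : ℝ × ℝ} (hz : 0 < z.1) :
    HasFDerivAt (fun z : ℝ × ℝ => √z.1) ((1 / (2 * √z.1)) • ContinuousLinearMap.fst ℝ ℝ ℝ) z :=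
  hasFDerivAt_fst.sqrt hz.ne'

theorem hasFDerivAt_inv_sqrt_fst {z : ℝ × ℝ} (hz : 0 < z.1) :
    HasFDerivAt (fun z : ℝ × ℝ => (√z.1)⁻¹)
      ((-(1 / (2 * √z.1 * z.1))) • ContinuousLinearMap.fst ℝ ℝ ℝ) z := by
  have hs : √z.1 ≠ 0 := (Real.sqrt_pos.2 hz).ne'
  refine HasFDerivAt.congr_fderiv
    ((hasDerivAt_inv hs).comp_hasFDerivAt z (hasFDerivAt_sqrt_fst hz)) ?_
  rw [smul_smul, Real.sq_sqrt hz.le]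
  congr 1
  field_simp

theorem hasFDerivAt_inv_fst {z : ℝ × ℝ} (hz : z.1 ≠ 0) :
    HasFDerivAt (fun z : ℝ × ℝ => z.1⁻¹) ((-(1 / z.1 ^ 2)) • ContinuousLinearMap.fst ℝ ℝ ℝ) z := by
  have h : HasFDerivAt (fun z : ℝ × ℝ => z.1) (ContinuousLinearMap.fst ℝ ℝ ℝ) z := hasFDerivAt_fst
  refine HasFDerivAt.congr_fderiv ((hasDerivAt_inv hz).comp_hasFDerivAt z h) ?_
  ext <;> simp

/-- The partial derivatives of `connCoeff`, with `F_ηη` eliminated by the eigenvalue equation. -/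
def connCoeffDeriv (F : ℝ × ℝ → ℝ) (z : ℝ × ℝ) : Fin 5 → ℝ × ℝ :=
  let ρ := z.1
  let s := √z.1
  let f := F z
  let a := dRho F z
  let b := dEta F z
  let aa := dRho (dRho F) z
  let ab := dEta (dRho F) z
  let bb := 3 * F z / (4 * z.1 ^ 2) - dRho (dRho F) z
  ![(2⁻¹ * (ab / f - b * a / f ^ 2), 2⁻¹ * (bb / f - b * b / f ^ 2)),
    (-2⁻¹ * (-2⁻¹ / ρ ^ 2 + aa / f - a * a / f ^ 2), -2⁻¹ * (ab / f - a * b / f ^ 2)),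
    (2⁻¹ * (1 / (2 * s * f) - s * a / f ^ 2), -2⁻¹ * (s * b / f ^ 2)),
    (2⁻¹ * z.2 * (1 / (2 * s * ρ * f) + a / (s * f ^ 2)),
      -2⁻¹ * (1 / (s * f) - z.2 * b / (s * f ^ 2))),
    (2⁻¹ * (1 / (2 * s * ρ * f) + a / (s * f ^ 2)), 2⁻¹ * (b / (s * f ^ 2)))]

theorem hasFDerivAt_connCoeff (hF : IsHyperbolicEigenfunction U F) {z : ℝ × ℝ} (hz : z ∈ U)
    (h0 : F z ≠ 0) (a : Fin 5) :
    HasFDerivAt (connCoeff F a) ((connCoeffDeriv F z a).1 • ContinuousLinearMap.fst ℝ ℝ ℝ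
      + (connCoeffDeriv F z a).2 • ContinuousLinearMap.snd ℝ ℝ ℝ) z := by
  have hρ := hF.rho_pos z hz
  have hs : √z.1 ≠ 0 := (Real.sqrt_pos.2 hρ).ne'
  have h1 := (hasDerivAt_inv h0).comp_hasFDerivAt z (hF.hasFDerivAt hz)
  have h2 := hF.hasFDerivAt_dRho hz
  have h3 := hF.hasFDerivAt_dEta hz
  have h4 := hasFDerivAt_sqrt_fst hρ
  have h5 := hasFDerivAt_inv_sqrt_fst hρ
  have h6 := hasFDerivAt_inv_fst hρ.ne'
  have h7 : HasFDerivAt (fun z : ℝ × ℝ => z.2) (ContinuousLinearMap.snd ℝ ℝ ℝ) z := hasFDerivAt_snd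
  have hρ' := hρ.ne'
  fin_cases a
  · refine HasFDerivAt.congr_fderiv ((h1.const_mul 2⁻¹).mul h3) ?_
    ext <;> simp [connCoeffDeriv] <;> field_simp <;> ring
  · refine HasFDerivAt.congr_fderiv (((h6.const_mul 2⁻¹).add (h1.mul h2)).const_mul (-2⁻¹)) ?_
    ext <;> simp [connCoeffDeriv] <;> field_simp <;> ring
  · refine HasFDerivAt.congr_fderiv ((h1.const_mul 2⁻¹).mul h4) ?_
    ext <;> simp [connCoeffDeriv]
    · field_simp; ring
    · field_simp
  · refine HasFDerivAt.congr_fderiv (((h1.const_mul (-2⁻¹)).mul h5).mul h7) ?_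
    ext <;> simp [connCoeffDeriv] <;> field_simp <;> ring
  · refine HasFDerivAt.congr_fderiv ((h1.const_mul (-2⁻¹)).mul h5) ?_
    ext <;> simp [connCoeffDeriv] <;> field_simp

theorem hasFDerivAt_sum_smul {E V : Type*} [NormedAddCommGroup E] [NormedSpace ℝ E]
    [NormedAddCommGroup V] [NormedSpace ℝ V] {n : ℕ} {x : E} {f : Fin n → E → ℝ}
    {f' : Fin n → E →L[ℝ] ℝ} {C : Fin n → V} (hf : ∀ a, HasFDerivAt (f a) (f' a) x) :
    HasFDerivAt (fun x => ∑ a, f a x • C a) (∑ a, (f' a).smulRight (C a)) x :=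
  HasFDerivAt.fun_sum fun a _ => (hf a).smul_const (C a)

theorem hasFDerivAt_connectionForm (hF : IsHyperbolicEigenfunction U F) {p : Base}
    (hp : p ∈ baseRegion ε U F) :
    HasFDerivAt (connectionForm F) (∑ a, (((connCoeffDeriv F p.1 a).1 • formRho
      + (connCoeffDeriv F p.1 a).2 • formEta : Base →L[ℝ] ℝ)).smulRight (connBasis a)) p := by
  have h : HasFDerivAt (fun p : Base => ∑ a, connCoeff F a p.1 • connBasis a)
      (∑ a, (((connCoeffDeriv F p.1 a).1 • formRho
      + (connCoeffDeriv F p.1 a).2 • formEta : Base →L[ℝ] ℝ)).smulRight (connBasis a)) p :=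
    hasFDerivAt_sum_smul (V := Base →L[ℝ] ℍ[ℝ]) (f := fun a (p : Base) => connCoeff F a p.1)
      fun a => (hasFDerivAt_connCoeff hF hp.1 hp.2.1 a).comp p hasFDerivAt_fst
  refine h.congr_of_eventuallyEq ?_
  filter_upwards [(hF.isOpen_baseRegion ε).mem_nhds hp] with p hp
  exact connectionForm_eq_sum hp.2.1 (hF.rho_pos _ hp.1).ne'

/-- The curvature of the connection form.  This is where the eigenvalue equation enters. -/
theorem curvature_connectionForm (hF : IsHyperbolicEigenfunction U F) {p : Base}
    (hp : p ∈ baseRegion ε U F) :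
    dOne (connectionForm F) p - wedge (connectionForm F p) (connectionForm F p) =
      (1 / 2 : ℝ) • frameForm F p := by
  have hρ := hF.rho_pos p.1 hp.1
  have h0 : F p.1 ≠ 0 := hp.2.1
  have h := hasFDerivAt_connectionForm hF hp
  have hs := Real.sqrt_pos.2 hρ
  have hsq := Real.sq_sqrt hρ.le
  refine twoForm_ext fun X Y => ?_
  rw [ContinuousAlternatingMap.sub_apply, ContinuousAlternatingMap.smul_apply,
    dOne_apply h.differentiableAt, h.fderiv, wedge_apply, frameForm_apply, connectionForm_apply,
    connectionForm_apply]
  simp only [Fin.sum_univ_succ, connCoeffDeriv, connBasis, fibreForm₁_apply, fibreForm₂_apply,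
    discr]
  simp only [formAlpha, formBeta]
  generalize √p.1.1 = s at *
  generalize dRho (dRho F) p.1 = aa at *
  generalize dEta (dRho F) p.1 = ab at *
  generalize dRho F p.1 = a at *
  generalize dEta F p.1 = b at *
  generalize F p.1 = f at *
  generalize p.1.2 = η at *
  generalize p.1.1 = ρ at *
  have hs' := hs.ne'
  subst hsq
  ext
  · simp; ring
  · simp
    field_simp
    ring
  · simp
    field_simp
    ring
  · simp
    field_simp
    ring

end Curvature

/-! ### The Swann trivialization over the Einstein metric -/

section Trivialization

variable {ε : ℝ} {U : Set (ℝ × ℝ)} {F : ℝ × ℝ → ℝ}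

theorem contDiffOn_einsteinMetric (hF : IsHyperbolicEigenfunction U F) (X Y : Base) :
    ContDiffOn ℝ ∞ (fun p => einsteinMetric ε F p X Y) (baseRegion ε U F) := by
  have hsub : regularSet ε U F ⊆ U := fun z hz => hz.1
  have hm : Set.MapsTo Prod.fst (baseRegion ε U F) (regularSet ε U F) := fun p hp => hp
  have h1 := (hF.smooth.mono hsub).comp contDiff_fst.contDiffOn hm
  have h2 := ((contDiffOn_dRho hF.isOpen hF.smooth).mono hsub).comp contDiff_fst.contDiffOn hm
  have h3 := ((contDiffOn_dEta hF.isOpen hF.smooth).mono hsub).comp contDiff_fst.contDiffOn hm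
  have hr : ContDiffOn ℝ ∞ (fun p : Base => p.1.1) (baseRegion ε U F) :=
    (contDiff_fst.comp contDiff_fst).contDiffOn
  have hη : ContDiffOn ℝ ∞ (fun p : Base => p.1.2) (baseRegion ε U F) :=
    (contDiff_snd.comp contDiff_fst).contDiffOn
  have hs : ContDiffOn ℝ ∞ (fun p : Base => √p.1.1) (baseRegion ε U F) :=
    hr.sqrt fun p hp => (hF.rho_pos p.1 hp.1).ne'
  have hsi : ContDiffOn ℝ ∞ (fun p : Base => (√p.1.1)⁻¹) (baseRegion ε U F) :=
    hs.inv fun p hp => (Real.sqrt_pos.2 (hF.rho_pos p.1 hp.1)).ne'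
  have hd : ContDiffOn ℝ ∞ (fun p : Base => discr F p.1) (baseRegion ε U F) := by
    simp only [discr]
    exact (h1.pow 2).sub ((contDiffOn_const.mul (hr.pow 2)).mul ((h2.pow 2).add (h3.pow 2)))
  have hα : ∀ Z : Base, ContDiffOn ℝ ∞ (fun p : Base => formAlpha p.1 Z) (baseRegion ε U F) :=
    fun Z => hs.mul contDiffOn_const
  have hβ : ∀ Z : Base, ContDiffOn ℝ ∞ (fun p : Base => formBeta p.1 Z) (baseRegion ε U F) :=
    fun Z => hsi.mul (contDiffOn_const.add (hη.mul contDiffOn_const))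
  have hu : ∀ Z : Base, ContDiffOn ℝ ∞ (fun p : Base => fibreForm₁ F p.1 Z) (baseRegion ε U F) :=
    fun Z => ((h1.sub ((contDiffOn_const.mul hr).mul h2)).mul (hα Z)).sub
      (((contDiffOn_const.mul hr).mul h3).mul (hβ Z))
  have hv : ∀ Z : Base, ContDiffOn ℝ ∞ (fun p : Base => fibreForm₂ F p.1 Z) (baseRegion ε U F) :=
    fun Z => ((((contDiffOn_const.mul hr).mul h3)).mul (hα Z)).add
      ((h1.add ((contDiffOn_const.mul hr).mul h2)).mul (hβ Z))
  have h0 : ∀ p ∈ baseRegion ε U F, F p.1 ≠ 0 := fun p hp => hp.2.1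
  have hd0 : ∀ p ∈ baseRegion ε U F, discr F p.1 ≠ 0 := fun p hp =>
    right_ne_zero_of_mul hp.2.2.ne'
  refine contDiffOn_const.mul (ContDiffOn.add (ContDiffOn.mul ?_ contDiffOn_const)
    (ContDiffOn.mul ?_ (((hu X).mul (hu Y)).add ((hv X).mul (hv Y)))))
  · exact (hd.div (contDiffOn_const.mul (h1.pow 2)) fun p hp =>
      mul_ne_zero four_ne_zero (pow_ne_zero 2 (h0 p hp))).div (hr.pow 2) fun p hp =>
        pow_ne_zero 2 (hF.rho_pos p.1 hp.1).ne'
  · exact ((h1.pow 2).mul hd).inv fun p hp => mul_ne_zero (pow_ne_zero 2 (h0 p hp)) (hd0 p hp)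

theorem dOne_connectionForm (hε : ε * ε = 1) (hF : IsHyperbolicEigenfunction U F) {p : Base}
    (hp : p ∈ baseRegion ε U F) :
    dOne (connectionForm F) p - wedge (connectionForm F p) (connectionForm F p) =
      (2 * (ε / 4)) • einsteinFrame ε F p := by
  rw [curvature_connectionForm hF hp]
  refine twoForm_ext fun X Y => ?_
  rw [einsteinFrame, ContinuousAlternatingMap.smul_apply, ContinuousAlternatingMap.smul_apply,
    ContinuousAlternatingMap.smul_apply, smul_smul]
  congr 1
  linear_combination (-(1 / 2) : ℝ) * hε

theorem isSwannTrivialization (hε : ε * ε = 1) (hF : IsHyperbolicEigenfunction U F) :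
    IsSwannTrivialization ε (baseRegion ε U F) (einsteinMetric ε F) (einsteinFrame ε F)
      (connectionForm F) (ε / 4) where
  isOpen := hF.isOpen_baseRegion ε
  smooth_metric := contDiffOn_einsteinMetric hF
  smooth_frame := contDiffOn_einsteinFrame hF
  smooth_connection := contDiffOn_connectionForm hF
  symm p hp := ⟨fun X Y => by
    have hρ := hF.rho_pos _ hp.1
    rw [einsteinMetric_eq_inner hε hp.2.1 hρ.ne' hp.2.2,
      einsteinMetric_eq_inner hε hp.2.1 hρ.ne' hp.2.2, real_inner_comm]⟩
  pos p hp X hX := by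
    have hρ := hF.rho_pos _ hp.1
    rw [einsteinMetric_eq_inner hε hp.2.1 hρ.ne' hp.2.2, real_inner_self_eq_norm_sq]
    have : quatCoframe ε F p X ≠ 0 := fun h =>
      hX (quatCoframe_injective hp.2.1 hρ hp.2.2 (h.trans (map_zero _).symm))
    positivity
  antiselfdual p hp := einsteinFrame_antiselfdual hε hp.2.1 (hF.rho_pos _ hp.1) hp.2.2
  frame p hp := einsteinFrame_triple hε hp.2.1 (hF.rho_pos _ hp.1) hp.2.2
  connection_im p hp X := by rw [connectionForm_apply]; rfl
  connection p hp X Y Z := by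
    -- the frame is a multiple of the curvature, so this is the Bianchi identity
    have hN := (hF.isOpen_baseRegion ε).mem_nhds hp
    have hb := bianchi ((contDiffOn_connectionForm hF).contDiffAt hN) X Y Z
    have hd : DifferentiableAt ℝ (einsteinFrame ε F) p :=
      ((contDiffOn_einsteinFrame hF).contDiffAt hN).differentiableAt (by simp)
    have he : extDeriv (fun y => dOne (connectionForm F) y -
        wedge (connectionForm F y) (connectionForm F y)) p =
        (2 * (ε / 4)) • extDeriv (einsteinFrame ε F) p := by
      rw [← extDeriv_fun_smul]
      refine Filter.EventuallyEq.extDeriv_eq ?_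
      filter_upwards [hN] with y hy using dOne_connectionForm hε hF hy
    rw [he, dOne_connectionForm hε hF hp] at hb
    have hc : (2 * (ε / 4)) ≠ 0 := by
      have : ε ≠ 0 := left_ne_zero_of_mul (hε.trans_ne one_ne_zero)
      positivity
    refine (smul_right_inj hc).1 (Eq.trans ?_ (hb.trans (smul_zero _).symm))
    simp only [ContinuousAlternatingMap.smul_apply, smul_add, smul_sub, mul_smul_comm,
      smul_mul_assoc]
  curvature p hp := dOne_connectionForm hε hF hp

end Trivialization

/-! ### Exactness of the Kähler form of the Swann metric -/

section Swann

variable {ε : ℝ} {U : Set (ℝ × ℝ)} {F : ℝ × ℝ → ℝ}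

@[simp]
theorem vertForm_apply (conn : Base → Base →L[ℝ] ℍ[ℝ]) (P X : Total) :
    vertForm conn P X = X.2 + P.2 * conn P.1 X.1 := rfl

theorem swannMetric_apply (h : Base → LinearMap.BilinForm ℝ Base)
    (conn : Base → Base →L[ℝ] ℍ[ℝ]) (s : ℝ) (P X Y : Total) :
    swannMetric h conn s P X Y = s * ‖P.2‖ ^ 2 * h P.1 X.1 Y.1
      + inner ℝ (vertForm conn P X) (vertForm conn P Y) := rfl

theorem swannForm_apply (Θ : Base → Base [⋀^Fin 2]→L[ℝ] ℍ[ℝ])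
    (conn : Base → Base →L[ℝ] ℍ[ℝ]) (s : ℝ) (P X Y : Total) :
    swannForm Θ conn s P ![X, Y] = s • (P.2 * Θ P.1 ![X.1, Y.1] * star P.2)
      - (1 / 2 : ℝ) • (vertForm conn P X * star (vertForm conn P Y)
        - vertForm conn P Y * star (vertForm conn P X)) := by
  have h : ∀ i, (ContinuousLinearMap.fst ℝ Base ℍ[ℝ]) (![X, Y] i) = ![X.1, Y.1] i := by
    intro i; fin_cases i <;> rfl
  rw [swannForm, ContinuousAlternatingMap.sub_apply, ContinuousAlternatingMap.smul_apply,
    ContinuousAlternatingMap.smul_apply, wedge_apply]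
  simp only [ContinuousLinearMap.compContinuousAlternatingMap_coe, Function.comp_apply,
    ContinuousAlternatingMap.compContinuousLinearMap_apply]
  rw [show (⇑(ContinuousLinearMap.fst ℝ Base ℍ[ℝ]) ∘ ![X, Y]) = ![X.1, Y.1] from funext h]
  rfl

/-- The `ℍ`-valued `1`-form `(dq + q ω) q̄`; twice its exterior derivative is the Kähler form of
the Swann metric. -/
def primitiveForm (conn : Base → Base →L[ℝ] ℍ[ℝ]) (P : Total) : Total →L[ℝ] ℍ[ℝ] :=
  (ContinuousLinearMap.mul ℝ ℍ[ℝ]).flip (star P.2) ∘L vertForm conn P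

@[simp]
theorem primitiveForm_apply (conn : Base → Base →L[ℝ] ℍ[ℝ]) (P X : Total) :
    primitiveForm conn P X = (X.2 + P.2 * conn P.1 X.1) * star P.2 := rfl

theorem contDiff_star_quaternion {n : ℕ∞ω} : ContDiff ℝ n (fun q : ℍ[ℝ] => star q) :=
  conjL.contDiff

theorem contDiffOn_mul_comp_mul {A E T H : Type*} [NormedRing A] [NormedAlgebra ℝ A]
    [NormedAddCommGroup E] [NormedSpace ℝ E] [NormedAddCommGroup T] [NormedSpace ℝ T]
    [NormedAddCommGroup H] [NormedSpace ℝ H] (L : T →L[ℝ] E) (π : T →L[ℝ] A) {n : ℕ∞ω} {s : Set H}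
    {a b : H → A} {c : H → E →L[ℝ] A} (ha : ContDiffOn ℝ n a s) (hb : ContDiffOn ℝ n b s)
    (hc : ContDiffOn ℝ n c s) :
    ContDiffOn ℝ n (fun P => (ContinuousLinearMap.mul ℝ A).flip (b P) ∘L
      (π + ContinuousLinearMap.mul ℝ A (a P) ∘L c P ∘L L)) s := by
  fun_prop

theorem contDiffOn_primitiveForm {conn : Base → Base →L[ℝ] ℍ[ℝ]} {N : Set Base}
    (hc : ContDiffOn ℝ ∞ conn N) : ContDiffOn ℝ ∞ (primitiveForm conn) (Prod.fst ⁻¹' N) := by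
  have h1 : ContDiffOn ℝ ∞ (fun P : Total => conn P.1) (Prod.fst ⁻¹' N) :=
    hc.comp contDiff_fst.contDiffOn fun P hP => hP
  have h2 : ContDiffOn ℝ ∞ (fun P : Total => P.2) (Prod.fst ⁻¹' N) := contDiff_snd.contDiffOn
  have h3 : ContDiffOn ℝ ∞ (fun P : Total => star P.2) (Prod.fst ⁻¹' N) :=
    contDiff_star_quaternion.comp_contDiffOn h2
  exact contDiffOn_mul_comp_mul (A := ℍ[ℝ]) (T := Total) (E := Base) (H := Total)
    (ContinuousLinearMap.fst ℝ Base ℍ[ℝ]) (ContinuousLinearMap.snd ℝ Base ℍ[ℝ])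
    (a := fun P => P.2) (b := fun P => star P.2) (c := fun P => conn P.1) h2 h3 h1

theorem fderiv_apply_apply {E V W : Type*} [NormedAddCommGroup E] [NormedSpace ℝ E]
    [NormedAddCommGroup V] [NormedSpace ℝ V] [NormedAddCommGroup W] [NormedSpace ℝ W]
    {a : E → V →L[ℝ] W} {x : E} (ha : DifferentiableAt ℝ a x) (X : E) (Y : V) :
    fderiv ℝ a x X Y = fderiv ℝ (fun y => a y Y) x X := by
  rw [fderiv_clm_apply ha (differentiableAt_const Y)]
  simp

theorem hasFDerivAt_apply {E V W : Type*} [NormedAddCommGroup E] [NormedSpace ℝ E]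
    [NormedAddCommGroup V] [NormedSpace ℝ V] [NormedAddCommGroup W] [NormedSpace ℝ W]
    {a : E → V →L[ℝ] W} {x : E} (ha : DifferentiableAt ℝ a x) (Y : V) :
    HasFDerivAt (fun y => a y Y) ((fderiv ℝ a x).flip Y) x := by
  have h := ha.hasFDerivAt.clm_apply (hasFDerivAt_const Y x)
  refine h.congr_fderiv ?_
  ext; simp

theorem fderiv_primitiveForm {conn : Base → Base →L[ℝ] ℍ[ℝ]} {P : Total}
    (hc : DifferentiableAt ℝ conn P.1) (hl : DifferentiableAt ℝ (primitiveForm conn) P)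
    (X Y : Total) :
    fderiv ℝ (primitiveForm conn) P X Y =
      (X.2 * conn P.1 Y.1 + P.2 * fderiv ℝ conn P.1 X.1 Y.1) * star P.2
        + (Y.2 + P.2 * conn P.1 Y.1) * star X.2 := by
  have h1 : HasFDerivAt (fun P : Total => P.2) (ContinuousLinearMap.snd ℝ Base ℍ[ℝ]) P :=
    hasFDerivAt_snd
  have h2 : HasFDerivAt (fun P : Total => star P.2)
      (conjL ∘L ContinuousLinearMap.snd ℝ Base ℍ[ℝ]) P :=
    conjL.hasFDerivAt.comp P h1
  have h0 : HasFDerivAt (fun p : Base => conn p Y.1) ((fderiv ℝ conn P.1).flip Y.1) P.1 :=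
    hasFDerivAt_apply (V := Base) (W := ℍ[ℝ]) hc Y.1
  have h3 : HasFDerivAt (fun P : Total => conn P.1 Y.1)
      ((fderiv ℝ conn P.1).flip Y.1 ∘L ContinuousLinearMap.fst ℝ Base ℍ[ℝ]) P :=
    h0.comp P hasFDerivAt_fst
  have h4 := ((h1.mul' h3).const_add Y.2).mul' h2
  rw [fderiv_apply_apply (V := Total) (W := ℍ[ℝ]) hl]
  refine (congrArg (fun L => L X) h4.fderiv).trans ?_
  simp [conjL]
  noncomm_ring

/-- The Kähler form of the Swann metric is exact, by the structure equation
`dω - ω ∧ ω = 2 s Θ`. -/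
theorem swannForm_eq_dOne {conn : Base → Base →L[ℝ] ℍ[ℝ]} {Θ : Base → Base [⋀^Fin 2]→L[ℝ] ℍ[ℝ]}
    {s : ℝ} {P : Total} (hc : DifferentiableAt ℝ conn P.1)
    (hl : DifferentiableAt ℝ (primitiveForm conn) P) (him : ∀ X, (conn P.1 X).re = 0)
    (hcurv : dOne conn P.1 - wedge (conn P.1) (conn P.1) = (2 * s) • Θ P.1) :
    (4 : ℝ) • swannForm Θ conn s P = (2 : ℝ) • dOne (primitiveForm conn) P := by
  refine twoForm_ext fun X Y => ?_
  have hstar : ∀ X, star (conn P.1 X) = -conn P.1 X := fun X =>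
    (Quaternion.star_eq_neg).2 (him X)
  have hT := congrArg (fun w => w ![X.1, Y.1]) hcurv
  simp only [ContinuousAlternatingMap.sub_apply, ContinuousAlternatingMap.smul_apply,
    dOne_apply hc, wedge_apply] at hT
  rw [ContinuousAlternatingMap.smul_apply, ContinuousAlternatingMap.smul_apply, swannForm_apply,
    dOne_apply hl, fderiv_primitiveForm hc hl, fderiv_primitiveForm hc hl]
  simp only [vertForm_apply, star_add, star_mul, hstar]
  have h4 : (4 : ℝ) • s • (P.2 * Θ P.1 ![X.1, Y.1] * star P.2) =
      (2 : ℝ) • (P.2 * ((2 * s) • Θ P.1 ![X.1, Y.1]) * star P.2) := by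
    simp only [mul_smul_comm, smul_mul_assoc, smul_smul]
    congr 1; ring
  rw [smul_sub, h4, ← hT, smul_smul, show (4 : ℝ) * (1 / 2) = 2 by norm_num, ← smul_sub]
  congr 1
  noncomm_ring

theorem isOpen_totalRegion (hF : IsHyperbolicEigenfunction U F) (ε : ℝ) :
    IsOpen (totalRegion ε U F) :=
  ((hF.isOpen_baseRegion ε).preimage continuous_fst).inter
    (isOpen_ne.preimage continuous_snd)

theorem differentiableAt_connectionForm (hF : IsHyperbolicEigenfunction U F) {p : Base}
    (hp : p ∈ baseRegion ε U F) : DifferentiableAt ℝ (connectionForm F) p :=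
  (hasFDerivAt_connectionForm hF hp).differentiableAt

theorem contDiffAt_primitiveForm (hF : IsHyperbolicEigenfunction U F) {P : Total}
    (hP : P ∈ totalRegion ε U F) : ContDiffAt ℝ ∞ (primitiveForm (connectionForm F)) P :=
  (contDiffOn_primitiveForm (contDiffOn_connectionForm (ε := ε) hF)).contDiffAt
    (((hF.isOpen_baseRegion ε).preimage continuous_fst).mem_nhds hP.1)

theorem differentiableAt_primitiveForm (hF : IsHyperbolicEigenfunction U F) {P : Total}
    (hP : P ∈ totalRegion ε U F) : DifferentiableAt ℝ (primitiveForm (connectionForm F)) P :=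
  (contDiffAt_primitiveForm hF hP).differentiableAt (by simp)

theorem totalForm_eq_dOne (hε : ε * ε = 1) (hF : IsHyperbolicEigenfunction U F) {P : Total}
    (hP : P ∈ totalRegion ε U F) :
    totalForm ε F P = (2 : ℝ) • dOne (primitiveForm (connectionForm F)) P :=
  swannForm_eq_dOne (differentiableAt_connectionForm hF hP.1)
    (differentiableAt_primitiveForm hF hP)
    (fun X => by rw [connectionForm_apply]; rfl) (dOne_connectionForm hε hF hP.1)

theorem contDiffOn_totalForm (hε : ε * ε = 1) (hF : IsHyperbolicEigenfunction U F) :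
    ContDiffOn ℝ ∞ (totalForm ε F) (totalRegion ε U F) := by
  have h : ContDiffOn ℝ ∞ (fun P => (2 : ℝ) • dOne (primitiveForm (connectionForm F)) P)
      (totalRegion ε U F) := fun P hP =>
    ContDiffAt.contDiffWithinAt (ContDiffAt.const_smul (F := Total [⋀^Fin 2]→L[ℝ] ℍ[ℝ]) (2 : ℝ)
      (contDiffAt_dOne (E := Total) (V := ℍ[ℝ]) (contDiffAt_primitiveForm hF hP)))
  exact h.congr fun P hP => totalForm_eq_dOne hε hF hP

theorem extDeriv_totalForm (hε : ε * ε = 1) (hF : IsHyperbolicEigenfunction U F) {P : Total}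
    (hP : P ∈ totalRegion ε U F) : extDeriv (totalForm ε F) P = 0 := by
  have h : totalForm ε F =ᶠ[nhds P]
      fun P => (2 : ℝ) • dOne (primitiveForm (connectionForm F)) P := by
    filter_upwards [(isOpen_totalRegion hF ε).mem_nhds hP] with Q hQ
    exact totalForm_eq_dOne hε hF hQ
  rw [h.extDeriv_eq]
  exact extDeriv_smul_dOne (E := Total) (V := ℍ[ℝ]) 2 (contDiffAt_primitiveForm hF hP)

end Swann

/-! ### The hyperkähler metric and its quaternionic triple -/

section Metric

variable {ε : ℝ} {U : Set (ℝ × ℝ)} {F : ℝ × ℝ → ℝ}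

theorem inner_mul_mul_left (q x y : ℍ[ℝ]) :
    inner ℝ (q * x) (q * y) = ‖q‖ ^ 2 * inner ℝ x y := by
  rw [Quaternion.inner_def, Quaternion.inner_def, pow_two, ← Quaternion.normSq_eq_norm_mul_self,
    Quaternion.normSq_def']
  simp
  ring

theorem totalMetric_apply (P X Y : Total) :
    totalMetric ε F P X Y = ε * ‖P.2‖ ^ 2 * einsteinMetric ε F P.1 X.1 Y.1
      + 4 * inner ℝ (vertForm (connectionForm F) P X) (vertForm (connectionForm F) P Y) := by
  have h : totalMetric ε F P X Y =
    4 * swannMetric (einsteinMetric ε F) (connectionForm F) (ε / 4) P X Y := rfl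
  rw [h, swannMetric_apply]
  ring

theorem totalForm_apply (P X Y : Total) :
    totalForm ε F P ![X, Y] = ε • (P.2 * einsteinFrame ε F P.1 ![X.1, Y.1] * star P.2)
      - (2 : ℝ) • (vertForm (connectionForm F) P X * star (vertForm (connectionForm F) P Y)
        - vertForm (connectionForm F) P Y * star (vertForm (connectionForm F) P X)) := by
  have h : totalForm ε F P ![X, Y] =
    (4 : ℝ) • swannForm (einsteinFrame ε F) (connectionForm F) (ε / 4) P ![X, Y] := rfl
  rw [h, swannForm_apply, smul_sub, smul_smul, smul_smul]
  congr 2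
  · ring
  · norm_num

/-- The coframe of the Swann metric, with values in `ℍ²`. -/
def totalCoframe (ε : ℝ) (F : ℝ × ℝ → ℝ) (P : Total) : Total →ₗ[ℝ] ℍ[ℝ] × ℍ[ℝ] :=
  LinearMap.prod (LinearMap.mulLeft ℝ P.2 ∘ₗ (quatCoframe ε F P.1).toLinearMap ∘ₗ
    LinearMap.fst ℝ Base ℍ[ℝ]) (vertForm (connectionForm F) P).toLinearMap

theorem totalCoframe_apply (P X : Total) : totalCoframe ε F P X =
    (P.2 * quatCoframe ε F P.1 X.1, vertForm (connectionForm F) P X) := rfl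

theorem totalCoframe_injective (hF : IsHyperbolicEigenfunction U F) {P : Total}
    (hP : P ∈ totalRegion ε U F) : Function.Injective (totalCoframe ε F P) := by
  rw [injective_iff_map_eq_zero]
  intro X hX
  rw [totalCoframe_apply, Prod.mk_eq_zero, mul_eq_zero, or_iff_right hP.2] at hX
  have h1 : X.1 = 0 := quatCoframe_injective hP.1.2.1 (hF.rho_pos _ hP.1.1) hP.1.2.2
    (hX.1.trans (map_zero _).symm)
  have h2 : X.2 = 0 := by simpa [h1] using hX.2
  exact Prod.ext h1 h2

theorem finrank_total : Module.finrank ℝ Total = 8 := by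
  rw [Module.finrank_prod, finrank_base, Quaternion.finrank_eq_four]

/-- The coframe as a linear isomorphism. -/
def totalCoframeEquiv (hF : IsHyperbolicEigenfunction U F) {P : Total}
    (hP : P ∈ totalRegion ε U F) : Total ≃ₗ[ℝ] ℍ[ℝ] × ℍ[ℝ] :=
  LinearEquiv.ofInjectiveOfFinrankEq (totalCoframe ε F P) (totalCoframe_injective hF hP)
    (by rw [finrank_total, Module.finrank_prod, Quaternion.finrank_eq_four])

theorem totalCoframeEquiv_apply (hF : IsHyperbolicEigenfunction U F) {P : Total}
    (hP : P ∈ totalRegion ε U F) (X : Total) : totalCoframeEquiv hF hP X =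
    (P.2 * quatCoframe ε F P.1 X.1, vertForm (connectionForm F) P X) := rfl

theorem totalMetric_eq_inner (hε : ε * ε = 1) (hF : IsHyperbolicEigenfunction U F) {P : Total}
    (hP : P ∈ totalRegion ε U F) (X Y : Total) :
    totalMetric ε F P X Y =
      ε * inner ℝ (totalCoframeEquiv hF hP X).1 (totalCoframeEquiv hF hP Y).1
        + 4 * inner ℝ (totalCoframeEquiv hF hP X).2 (totalCoframeEquiv hF hP Y).2 := by
  rw [totalMetric_apply, einsteinMetric_eq_inner hε hP.1.2.1 (hF.rho_pos _ hP.1.1).ne' hP.1.2.2,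
    totalCoframeEquiv_apply, totalCoframeEquiv_apply, inner_mul_mul_left, mul_assoc]

theorem totalForm_eq_kaehler (hε : ε * ε = 1) (hF : IsHyperbolicEigenfunction U F) {P : Total}
    (hP : P ∈ totalRegion ε U F) (X Y : Total) :
    totalForm ε F P ![X, Y] = ε • ((-(1 / 2) : ℝ) •
        ((totalCoframeEquiv hF hP X).1 * star (totalCoframeEquiv hF hP Y).1
          - (totalCoframeEquiv hF hP Y).1 * star (totalCoframeEquiv hF hP X).1))
      + (4 : ℝ) • ((-(1 / 2) : ℝ) •
        ((totalCoframeEquiv hF hP X).2 * star (totalCoframeEquiv hF hP Y).2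
          - (totalCoframeEquiv hF hP Y).2 * star (totalCoframeEquiv hF hP X).2)) := by
  rw [totalForm_apply, einsteinFrame_eq hε hP.1.2.1 (hF.rho_pos _ hP.1.1).ne' hP.1.2.2,
    totalCoframeEquiv_apply, totalCoframeEquiv_apply, sub_eq_add_neg]
  congr 1
  · simp only [star_mul, mul_smul_comm, smul_mul_assoc]
    congr 2
    noncomm_ring
  · rw [smul_smul, ← neg_smul]
    norm_num

theorem totalForm_triple (hε : ε * ε = 1) (hF : IsHyperbolicEigenfunction U F) {P : Total}
    (hP : P ∈ totalRegion ε U F) :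
    IsQuaternionicTriple (totalMetric ε F P) (totalForm ε F P) := by
  refine isQuaternionicTriple_of_linearEquiv (totalCoframeEquiv hF hP)
    (fun x y => ε * inner ℝ x.1 y.1 + 4 * inner ℝ x.2 y.2) (totalMetric_eq_inner hε hF hP) ?_ ?_
  · intro X Y
    have h : ∀ x y : ℍ[ℝ], (ε • x + (4 : ℝ) • y).re = ε * x.re + 4 * y.re := by
      intro x y
      simp
    rw [totalForm_eq_kaehler hε hF hP, h, re_kaehler, re_kaehler, mul_zero, mul_zero, add_zero]
  · intro a X Y
    have h : ∀ (x y : ℍ[ℝ]), imVec (ε • x + (4 : ℝ) • y) a = ε * imVec x a + 4 * imVec y a := by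
      intro x y
      fin_cases a <;> simp [imVec]
    rw [totalForm_eq_kaehler hε hF hP, h, imVec_kaehler, imVec_kaehler]
    rfl

theorem totalMetric_isSymm (hε : ε * ε = 1) (hF : IsHyperbolicEigenfunction U F) {P : Total}
    (hP : P ∈ totalRegion ε U F) : (totalMetric ε F P).IsSymm := by
  refine ⟨fun X Y => ?_⟩
  rw [totalMetric_eq_inner hε hF hP, totalMetric_eq_inner hε hF hP, real_inner_comm,
    real_inner_comm (totalCoframeEquiv hF hP X).2]

theorem totalMetric_separating (hε : ε * ε = 1) (hF : IsHyperbolicEigenfunction U F) {P : Total}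
    (hP : P ∈ totalRegion ε U F) {X : Total} (hX : ∀ Y, totalMetric ε F P X Y = 0) : X = 0 := by
  set T := totalCoframeEquiv hF hP with hT
  -- pair `X` with the vector whose coframe components are those of `X`, up to the signature
  have h := hX (T.symm (ε • (T X).1, (T X).2))
  rw [totalMetric_eq_inner hε hF hP, ← hT, T.apply_symm_apply, inner_smul_right, ← mul_assoc, hε,
    one_mul, real_inner_self_eq_norm_sq, real_inner_self_eq_norm_sq] at h
  have h1 : ‖(T X).1‖ = 0 := by nlinarith [sq_nonneg ‖(T X).1‖, sq_nonneg ‖(T X).2‖]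
  have h2 : ‖(T X).2‖ = 0 := by nlinarith [sq_nonneg ‖(T X).1‖, sq_nonneg ‖(T X).2‖]
  exact T.map_eq_zero_iff.1 (Prod.ext (norm_eq_zero.1 h1) (norm_eq_zero.1 h2))

theorem totalMetric_nondegenerate (hε : ε * ε = 1) (hF : IsHyperbolicEigenfunction U F) {P : Total}
    (hP : P ∈ totalRegion ε U F) : (totalMetric ε F P).Nondegenerate :=
  ⟨fun X hX => totalMetric_separating hε hF hP hX, fun Y hY =>
    totalMetric_separating hε hF hP fun X => by rw [(totalMetric_isSymm hε hF hP).eq, hY]⟩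

theorem contDiffOn_apply_const {E V W : Type*} [NormedAddCommGroup E] [NormedSpace ℝ E]
    [NormedAddCommGroup V] [NormedSpace ℝ V] [NormedAddCommGroup W] [NormedSpace ℝ W]
    {a : E → V →L[ℝ] W} {s : Set E} (ha : ContDiffOn ℝ ∞ a s) (Y : V) :
    ContDiffOn ℝ ∞ (fun y => a y Y) s :=
  ha.clm_apply contDiffOn_const

theorem contDiffOn_totalMetric (hF : IsHyperbolicEigenfunction U F) (X Y : Total) :
    ContDiffOn ℝ ∞ (fun P => totalMetric ε F P X Y) (totalRegion ε U F) := by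
  have hm : Set.MapsTo Prod.fst (totalRegion ε U F) (baseRegion ε U F) := fun P hP => hP.1
  have hq : ContDiffOn ℝ ∞ (fun P : Total => P.2) (totalRegion ε U F) := contDiff_snd.contDiffOn
  have hθ : ∀ X : Total, ContDiffOn ℝ ∞ (fun P => vertForm (connectionForm F) P X)
      (totalRegion ε U F) := fun X => by
    have h : ContDiffOn ℝ ∞ (fun p => connectionForm F p X.1) (baseRegion ε U F) :=
      contDiffOn_apply_const (V := Base) (W := ℍ[ℝ]) (contDiffOn_connectionForm hF) X.1
    exact contDiffOn_const.add (hq.mul (h.comp contDiff_fst.contDiffOn hm))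
  simp only [totalMetric_apply]
  exact ((contDiffOn_const.mul (hq.norm_sq ℝ)).mul
    ((contDiffOn_einsteinMetric hF X.1 Y.1).comp contDiff_fst.contDiffOn hm)).add
    (contDiffOn_const.mul ((hθ X).inner ℝ (hθ Y)))

theorem isHyperkahler_total (hε : ε * ε = 1) (hF : IsHyperbolicEigenfunction U F) :
    IsHyperkahler (totalRegion ε U F) (totalMetric ε F) (totalForm ε F) where
  isOpen := isOpen_totalRegion hF ε
  smooth_metric := contDiffOn_totalMetric hF
  smooth_form := contDiffOn_totalForm hε hF
  symm _ hP := totalMetric_isSymm hε hF hP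
  nondegenerate _ hP := totalMetric_nondegenerate hε hF hP
  triple _ hP := totalForm_triple hε hF hP
  closed _ hP := extDeriv_totalForm hε hF hP

end Metric

/-! ### The momentum maps -/

section Momentum

variable {ε : ℝ} {U : Set (ℝ × ℝ)} {F : ℝ × ℝ → ℝ}

/-- Cartan's formula for `Ω = 2 dλ` and the invariant `1`-form `λ`. -/
theorem totalForm_killingField (hε : ε * ε = 1) (hF : IsHyperbolicEigenfunction U F) {P : Total}
    (hP : P ∈ totalRegion ε U F) (i : Fin 2) (Y : Total) :
    totalForm ε F P ![killingField i P, Y] = (-2 : ℝ) •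
      fderiv ℝ (fun Q => primitiveForm (connectionForm F) Q (killingField i P)) P Y := by
  have hl := differentiableAt_primitiveForm hF hP
  have hc := differentiableAt_connectionForm hF hP.1
  have hK : fderiv ℝ (connectionForm F) P.1 (killingField i P).1 = 0 := by
    rw [(hasFDerivAt_connectionForm hF hP.1).fderiv]
    refine ContinuousLinearMap.ext fun X => ?_
    simp [killingField]
  rw [totalForm_eq_dOne hε hF hP, ContinuousAlternatingMap.smul_apply, dOne_apply hl,
    ← fderiv_apply_apply (V := Total) (W := ℍ[ℝ]) hl, fderiv_primitiveForm hc hl (killingField i P), hK]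
  simp [killingField]

/-- The momentum map of an invariant vector field `K` is `-2 λ(K)`, for the invariant primitive `λ`
of half the Kähler form. -/
theorem isMomentumMap_of_eq (hε : ε * ε = 1) (hF : IsHyperbolicEigenfunction U F) (i : Fin 2)
    {μ : Total → ℍ[ℝ]} (hμ : ∀ P ∈ totalRegion ε U F,
      μ P = (-2 : ℝ) • primitiveForm (connectionForm F) P (killingField i P)) :
    IsMomentumMap (totalRegion ε U F) (totalForm ε F) (killingField i) μ := by
  intro P hP
  have hl := differentiableAt_primitiveForm hF hP
  have he : μ =ᶠ[nhds P]
      fun Q => (-2 : ℝ) • primitiveForm (connectionForm F) Q (killingField i P) := by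
    filter_upwards [(isOpen_totalRegion hF ε).mem_nhds hP] with Q hQ
    exact hμ Q hQ
  have hd : HasFDerivAt (fun Q => primitiveForm (connectionForm F) Q (killingField i P))
      ((fderiv ℝ (primitiveForm (connectionForm F)) P).flip (killingField i P)) P :=
    hasFDerivAt_apply (V := Total) (W := ℍ[ℝ]) hl _
  have hd2 := (hd.const_smul (-2 : ℝ)).congr_of_eventuallyEq he
  refine ⟨?_, hd2.differentiableAt, fun Y => ?_⟩
  · rw [hμ P hP, primitiveForm_apply, connectionForm_apply]
    simp [killingField]
    ring
  · rw [totalForm_killingField hε hF hP, hd2.fderiv, hd.fderiv]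
    rfl

theorem momentPhi_eq (hF : IsHyperbolicEigenfunction U F) {P : Total}
    (hP : P ∈ totalRegion ε U F) : momentPhi F P =
      (-2 : ℝ) • primitiveForm (connectionForm F) P (killingField 0 P) := by
  have hρ := hF.rho_pos _ hP.1.1
  have hs : √P.1.1.1 ≠ 0 := (Real.sqrt_pos.2 hρ).ne'
  have hsq := Real.sq_sqrt hρ.le
  have h0 := hP.1.2.1
  have hω : (-2 : ℝ) • connectionForm F P.1 (killingField 0 P).1 =
      (√P.1.1.1 * F P.1.1)⁻¹ • (((P.1.1.2 : ℍ[ℝ]) + P.1.1.1 • qi) * qk) := by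
    rw [connectionForm_apply]
    ext
    · simp
    · simp [killingField]
    · simp [killingField, formAlpha]
      field_simp
      exact hsq
    · simp [killingField, formBeta]
      field_simp
  have h2 : momentPhi F P = P.2 *
      ((√P.1.1.1 * F P.1.1)⁻¹ • (((P.1.1.2 : ℍ[ℝ]) + P.1.1.1 • qi) * qk)) * star P.2 := by
    rw [momentPhi, mul_smul_comm, smul_mul_assoc]
    simp only [mul_assoc]
  rw [h2, ← hω, primitiveForm_apply, show (killingField 0 P).2 = 0 from rfl, zero_add,
    mul_smul_comm, smul_mul_assoc]

theorem momentPsi_eq {P : Total} : momentPsi F P =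
      (-2 : ℝ) • primitiveForm (connectionForm F) P (killingField 1 P) := by
  have hω : (-2 : ℝ) • connectionForm F P.1 (killingField 1 P).1 =
      (√P.1.1.1 * F P.1.1)⁻¹ • qk := by
    rw [connectionForm_apply]
    ext
    · simp
    · simp [killingField]
    · simp [killingField, formAlpha]
    · simp [killingField, formBeta]
      ring
  have h2 : momentPsi F P = P.2 * ((√P.1.1.1 * F P.1.1)⁻¹ • qk) * star P.2 := by
    rw [momentPsi, mul_smul_comm, smul_mul_assoc]
  rw [h2, ← hω, primitiveForm_apply, show (killingField 1 P).2 = 0 from rfl, zero_add,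
    mul_smul_comm, smul_mul_assoc]

end Momentum

/-! ### Rotations of `ℝ³` by quaternions -/

section Rotation

/-- The imaginary quaternion with the given components. -/
def imQuat (v : Fin 3 → ℝ) : ℍ[ℝ] := quat 0 (v 0) (v 1) (v 2)

/-- The similarity `v ↦ q v q̄` of `Im ℍ = ℝ³`, which scales lengths by `|q|²`. -/
def rot (q : ℍ[ℝ]) : (Fin 3 → ℝ) →ₗ[ℝ] (Fin 3 → ℝ) where
  toFun v := imVec (q * imQuat v * star q)
  map_add' v w := by ext a; fin_cases a <;> simp [imVec, imQuat] <;> ring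
  map_smul' c v := by ext a; fin_cases a <;> simp [imVec, imQuat] <;> ring

theorem rot_apply (q : ℍ[ℝ]) (v : Fin 3 → ℝ) : rot q v = imVec (q * imQuat v * star q) := rfl

theorem norm_sq_quaternion (q : ℍ[ℝ]) :
    ‖q‖ ^ 2 = q.re ^ 2 + q.imI ^ 2 + q.imJ ^ 2 + q.imK ^ 2 := by
  rw [sq, ← Quaternion.normSq_eq_norm_mul_self, Quaternion.normSq_def']

theorem rot_neg (q : ℍ[ℝ]) : rot (-q) = rot q := by
  ext v a
  simp [rot_apply]

theorem dotProduct_rot (q : ℍ[ℝ]) (v w : Fin 3 → ℝ) :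
    rot q v ⬝ᵥ rot q w = (‖q‖ ^ 2) ^ 2 * (v ⬝ᵥ w) := by
  simp only [dotProduct, Fin.sum_univ_three, norm_sq_quaternion]
  simp [rot_apply, imVec, imQuat]
  ring

theorem cross_rot (q : ℍ[ℝ]) (v w : Fin 3 → ℝ) :
    rot q v ⨯₃ rot q w = ‖q‖ ^ 2 • rot q (v ⨯₃ w) := by
  ext a
  rw [norm_sq_quaternion]
  fin_cases a <;> simp [cross_apply, rot_apply, imVec, imQuat] <;> ring

theorem mul_imQuat_mul_star_eq {q q' : ℍ[ℝ]} {v : Fin 3 → ℝ} (h : rot q v = rot q' v) :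
    q * imQuat v * star q = q' * imQuat v * star q' := by
  have h0 : ∀ q : ℍ[ℝ], (q * imQuat v * star q).re = 0 := fun q => by
    simp [imQuat]
    ring
  have h1 := congrFun h 0
  have h2 := congrFun h 1
  have h3 := congrFun h 2
  ext
  exacts [(h0 q).trans (h0 q').symm, h1, h2, h3]

/-- Two quaternions of the same length which rotate the second and the third basis vector of `ℝ³` in
the same way agree up to sign: their quotient commutes with `j` and `k`. -/
theorem eq_or_eq_neg_of_rot_eq {q q' : ℍ[ℝ]} (hn : ‖q‖ ^ 2 = ‖q'‖ ^ 2) (hq : q' ≠ 0)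
    (hj : rot q ![0, 1, 0] = rot q' ![0, 1, 0]) (hk : rot q ![0, 0, 1] = rot q' ![0, 0, 1]) :
    q = q' ∨ q = -q' := by
  have hr : ‖q'‖ ^ 2 ≠ 0 := by positivity
  have hs : ∀ q : ℍ[ℝ], star q * q = ((‖q‖ ^ 2 : ℝ) : ℍ[ℝ]) := fun q => by
    rw [Quaternion.star_mul_self, Quaternion.normSq_eq_norm_mul_self, sq]
  have hcomm : ∀ m : ℍ[ℝ], q * m * star q = q' * m * star q' →
      star q' * q * m = m * (star q' * q) := fun m hm => by
    have h : ‖q'‖ ^ 2 • (star q' * q * m) = ‖q'‖ ^ 2 • (m * (star q' * q)) := by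
      calc ‖q'‖ ^ 2 • (star q' * q * m) = star q' * (q * m * star q) * q := by
            rw [← hn, ← Quaternion.coe_mul_eq_smul, Quaternion.coe_commutes, ← hs q]
            noncomm_ring
        _ = ‖q'‖ ^ 2 • (m * (star q' * q)) := by
            rw [hm, ← Quaternion.coe_mul_eq_smul, ← hs q']
            noncomm_ring
    exact smul_right_injective _ hr h
  have hj' := hcomm _ (mul_imQuat_mul_star_eq hj)
  have hk' := hcomm _ (mul_imQuat_mul_star_eq hk)
  generalize hp : star q' * q = p at hj' hk'
  have e1 := congrArg (fun x : ℍ[ℝ] => x.imK) hj'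
  have e2 := congrArg (fun x : ℍ[ℝ] => x.imI) hj'
  have e3 := congrArg (fun x : ℍ[ℝ] => x.imI) hk'
  simp [imQuat] at e1 e2 e3
  have p1 : p.imI = 0 := by linarith
  have p2 : p.imJ = 0 := by linarith
  have p3 : p.imK = 0 := by linarith
  have hpr : p = ((p.re : ℝ) : ℍ[ℝ]) := by
    ext
    exacts [by simp, by simpa using p1, by simpa using p2, by simpa using p3]
  have hq' : ‖q'‖ ^ 2 • q = p.re • q' := by
    rw [← Quaternion.coe_mul_eq_smul, ← hs, ← Quaternion.coe_mul_eq_smul, Quaternion.coe_commutes,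
      ← hpr, ← hp, ← mul_assoc, Quaternion.self_mul_star, Quaternion.star_mul_self]
  have hp2 : p.re ^ 2 = (‖q'‖ ^ 2) ^ 2 := by
    have h := congrArg norm hp
    rw [norm_mul, norm_star, hpr, Quaternion.norm_coe] at h
    have h4 : ‖q‖ = ‖q'‖ := by
      rwa [sq_eq_sq₀ (norm_nonneg _) (norm_nonneg _)] at hn
    rw [h4] at h
    rw [← sq_abs, ← Real.norm_eq_abs, ← h]
    ring
  rcases sq_eq_sq_iff_eq_or_eq_neg.1 hp2 with h | h
  · rw [h] at hq'
    exact Or.inl (smul_right_injective _ hr hq')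
  · rw [h, neg_smul, ← smul_neg] at hq'
    exact Or.inr (smul_right_injective _ hr hq')

end Rotation

/-! ### The momentum map determines `(ρ, η)` and `± q` -/

section Reduced

/-- The quotient of `M × ℍ` by the translations in `φ` and `ψ`, with points `w = ((ρ, η), q)`. -/
abbrev Reduced := (ℝ × ℝ) × ℍ[ℝ]

/-- The part of the quotient which lies under `totalRegion`. -/
def reducedRegion (ε : ℝ) (U : Set (ℝ × ℝ)) (F : ℝ × ℝ → ℝ) : Set Reduced :=
  {w | w.1 ∈ regularSet ε U F ∧ w.2 ≠ 0}

/-- The momentum maps at `q = 1`: `(η + ρ i) k / (√ρ F)` and `k / (√ρ F)`. -/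
def momentVec (F : ℝ × ℝ → ℝ) (z : ℝ × ℝ) : Fin 2 → Fin 3 → ℝ :=
  ![![0, -((√z.1 * F z)⁻¹ * z.1), (√z.1 * F z)⁻¹ * z.2], ![0, 0, (√z.1 * F z)⁻¹]]

/-- The momentum map as a function on the quotient by the translations in `φ` and `ψ`. -/
def reducedMap (F : ℝ × ℝ → ℝ) (w : Reduced) : MomentumSpace :=
  fun k => rot w.2 (momentVec F w.1 k)

theorem momentMap_eq_reducedMap (F : ℝ × ℝ → ℝ) (P : Total) :
    momentMap F P = reducedMap F (P.1.1, P.2) := by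
  ext k a
  fin_cases k <;> fin_cases a <;>
    simp [momentMap, reducedMap, rot_apply, momentVec, momentPhi, momentPsi, imVec, imQuat] <;> ring

theorem reducedMap_neg (F : ℝ × ℝ → ℝ) (z : ℝ × ℝ) (q : ℍ[ℝ]) :
    reducedMap F (z, -q) = reducedMap F (z, q) := by
  funext k
  exact congrArg (fun f => f (momentVec F z k)) (rot_neg q)

variable {ε : ℝ} {U : Set (ℝ × ℝ)} {F : ℝ × ℝ → ℝ}

/-- The scalar products of `x_φ` and `x_ψ` determine `(ρ, η)` and `|q|`. -/
theorem reducedMap_injective (hF : IsHyperbolicEigenfunction U F) {w w' : Reduced}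
    (hw : w ∈ reducedRegion ε U F) (hw' : w' ∈ reducedRegion ε U F)
    (h : reducedMap F w = reducedMap F w') : w.1 = w'.1 ∧ (w.2 = w'.2 ∨ w.2 = -w'.2) := by
  obtain ⟨⟨ρ, η⟩, q⟩ := w
  obtain ⟨⟨ρ', η'⟩, q'⟩ := w'
  have hρ : 0 < ρ := hF.rho_pos _ hw.1.1
  have hρ' : 0 < ρ' := hF.rho_pos _ hw'.1.1
  have h0 : F (ρ, η) ≠ 0 := hw.1.2.1
  have h0' : F (ρ', η') ≠ 0 := hw'.1.2.1
  have hq : q ≠ 0 := hw.2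
  have hq' : q' ≠ 0 := hw'.2
  have e0 : rot q (momentVec F (ρ, η) 0) = rot q' (momentVec F (ρ', η') 0) := congrFun h 0
  have e1 : rot q (momentVec F (ρ, η) 1) = rot q' (momentVec F (ρ', η') 1) := congrFun h 1
  have d11 := congrArg₂ (· ⬝ᵥ ·) e1 e1
  have d01 := congrArg₂ (· ⬝ᵥ ·) e0 e1
  have d00 := congrArg₂ (· ⬝ᵥ ·) e0 e0
  simp only [dotProduct_rot] at d11 d01 d00
  have hm : ∀ (ρ η : ℝ), momentVec F (ρ, η) = ![(√ρ * F (ρ, η))⁻¹ • ![0, -ρ, η],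
      (√ρ * F (ρ, η))⁻¹ • ![0, 0, 1]] := fun ρ η => by
    ext k a
    fin_cases k <;> fin_cases a <;> simp [momentVec]
  have hu : (√ρ * F (ρ, η))⁻¹ ≠ 0 := inv_ne_zero (mul_ne_zero (Real.sqrt_pos.2 hρ).ne' h0)
  rw [hm, hm] at d11 d01 d00 e0 e1
  generalize hκ : (√ρ * F (ρ, η))⁻¹ = u at *
  generalize hκ' : (√ρ' * F (ρ', η'))⁻¹ = u' at *
  simp [dotProduct, Fin.sum_univ_three] at d11 d01 d00
  have hκ0 : (‖q‖ ^ 2) ^ 2 * (u * u) ≠ 0 := by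
    have : ‖q‖ ≠ 0 := norm_ne_zero_iff.2 hq
    positivity
  have hη : η = η' := by
    refine mul_left_cancel₀ hκ0 ?_
    linear_combination d01 - η' * d11
  subst hη
  have hρρ : ρ = ρ' := by
    have h2 : ρ ^ 2 = ρ' ^ 2 := by
      refine mul_left_cancel₀ hκ0 ?_
      linear_combination d00 - (η ^ 2 + ρ' ^ 2) * d11
    rwa [sq_eq_sq₀ hρ.le hρ'.le] at h2
  subst hρρ
  have huu : u = u' := hκ.symm.trans hκ'
  subst huu
  refine ⟨rfl, eq_or_eq_neg_of_rot_eq ?_ hq' ?_ ?_⟩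
  · rw [← sq_eq_sq₀ (by positivity) (by positivity)]
    exact mul_right_cancel₀ (mul_ne_zero hu hu) d11
  all_goals
    have e1' : u • rot q ![0, 0, 1] = u • rot q' ![0, 0, 1] := by
      rw [← map_smul, ← map_smul]
      exact e1
    have hk := smul_right_injective _ hu e1'
  · have hv : (![0, -ρ, η] : Fin 3 → ℝ) = (-ρ) • ![0, 1, 0] + η • ![0, 0, 1] := by
      ext a
      fin_cases a <;> simp
    have e0' : u • rot q ![0, -ρ, η] = u • rot q' ![0, -ρ, η] := by
      rw [← map_smul, ← map_smul]
      exact e0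
    have hj := smul_right_injective _ hu e0'
    simp only [hv, map_add, map_smul, hk, add_left_inj] at hj
    exact smul_right_injective _ (neg_ne_zero.2 hρ.ne') hj
  · exact hk

theorem momentMap_eq_iff (hF : IsHyperbolicEigenfunction U F) {P P' : Total}
    (hP : P ∈ totalRegion ε U F) (hP' : P' ∈ totalRegion ε U F) :
    momentMap F P = momentMap F P' ↔ P.1.1 = P'.1.1 ∧ (P.2 = P'.2 ∨ P.2 = -P'.2) := by
  rw [momentMap_eq_reducedMap, momentMap_eq_reducedMap]
  refine ⟨fun h => reducedMap_injective (ε := ε) (w := (P.1.1, P.2)) (w' := (P'.1.1, P'.2)) hF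
    ⟨hP.1, hP.2⟩ ⟨hP'.1, hP'.2⟩ h, ?_⟩
  rintro ⟨h1, h2 | h2⟩
  · rw [h1, h2]
  · rw [h1, h2, reducedMap_neg]

end Reduced

/-! ### The differential of the momentum map -/

section LineDerivatives

theorem fderiv_apply_eq_of_hasDerivAt {E V : Type*} [NormedAddCommGroup E] [NormedSpace ℝ E]
    [NormedAddCommGroup V] [NormedSpace ℝ V] {f : E → V} {x X : E} {v : V}
    (hf : DifferentiableAt ℝ f x) (h : HasDerivAt (fun t : ℝ => f (x + t • X)) v 0) :
    fderiv ℝ f x X = v :=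
  (hf.hasFDerivAt.hasLineDerivAt X).unique h

variable {ε : ℝ} {U : Set (ℝ × ℝ)} {F : ℝ × ℝ → ℝ} {z : ℝ × ℝ}

theorem hasDerivAt_line_fst (z δ : ℝ × ℝ) :
    HasDerivAt (fun t : ℝ => (z + t • δ).1) δ.1 0 := by
  simpa using ((hasDerivAt_id (0 : ℝ)).mul_const δ.1).const_add z.1

theorem hasDerivAt_line_snd (z δ : ℝ × ℝ) :
    HasDerivAt (fun t : ℝ => (z + t • δ).2) δ.2 0 := by
  simpa using ((hasDerivAt_id (0 : ℝ)).mul_const δ.2).const_add z.2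

theorem hasDerivAt_line_sqrt (h : 0 < z.1) (δ : ℝ × ℝ) :
    HasDerivAt (fun t : ℝ => √(z + t • δ).1) (δ.1 / (2 * √z.1)) 0 := by
  have h1 := (hasDerivAt_line_fst z δ).sqrt (by simpa using h.ne')
  simpa using h1

theorem IsHyperbolicEigenfunction.hasDerivAt_line (hF : IsHyperbolicEigenfunction U F) (hz : z ∈ U)
    (δ : ℝ × ℝ) :
    HasDerivAt (fun t : ℝ => F (z + t • δ)) (dRho F z * δ.1 + dEta F z * δ.2) 0 := by
  simpa [HasLineDerivAt] using (hF.hasFDerivAt hz).hasLineDerivAt δ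

theorem IsHyperbolicEigenfunction.hasDerivAt_line_dRho (hF : IsHyperbolicEigenfunction U F)
    (hz : z ∈ U) (δ : ℝ × ℝ) :
    HasDerivAt (fun t : ℝ => dRho F (z + t • δ))
      (dRho (dRho F) z * δ.1 + dEta (dRho F) z * δ.2) 0 := by
  simpa [HasLineDerivAt] using (hF.hasFDerivAt_dRho hz).hasLineDerivAt δ

theorem IsHyperbolicEigenfunction.hasDerivAt_line_dEta (hF : IsHyperbolicEigenfunction U F)
    (hz : z ∈ U) (δ : ℝ × ℝ) :
    HasDerivAt (fun t : ℝ => dEta F (z + t • δ))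
      (dEta (dRho F) z * δ.1 + (3 * F z / (4 * z.1 ^ 2) - dRho (dRho F) z) * δ.2) 0 := by
  simpa [HasLineDerivAt] using (hF.hasFDerivAt_dEta hz).hasLineDerivAt δ

theorem hasDerivAt_line_quaternion (q δ : ℍ[ℝ]) : HasDerivAt (fun t : ℝ => q + t • δ) δ 0 := by
  simpa using ((hasDerivAt_id (0 : ℝ)).smul_const δ).const_add q

theorem hasDerivAt_line_star (q δ : ℍ[ℝ]) :
    HasDerivAt (fun t : ℝ => star (q + t • δ)) (star δ) 0 :=
  conjL.hasFDerivAt.comp_hasDerivAt 0 (hasDerivAt_line_quaternion q δ)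

end LineDerivatives

section Differential

variable {ε : ℝ} {U : Set (ℝ × ℝ)} {F : ℝ × ℝ → ℝ}

theorem isOpen_reducedRegion (hF : IsHyperbolicEigenfunction U F) (ε : ℝ) :
    IsOpen (reducedRegion ε U F) :=
  ((hF.isOpen_regularSet ε).preimage continuous_fst).inter
    (isOpen_ne.preimage continuous_snd)

/-- `imQuat` as a continuous linear map. -/
def imQuatL : (Fin 3 → ℝ) →L[ℝ] ℍ[ℝ] :=
  LinearMap.toContinuousLinearMap
    { toFun := imQuat
      map_add' := fun v w => by ext <;> simp [imQuat]
      map_smul' := fun c v => by ext <;> simp [imQuat] }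

/-- `imVec` as a continuous linear map. -/
def imVecL : ℍ[ℝ] →L[ℝ] (Fin 3 → ℝ) :=
  LinearMap.toContinuousLinearMap
    { toFun := imVec
      map_add' := fun p q => by ext a; fin_cases a <;> simp [imVec]
      map_smul' := fun c q => by ext a; fin_cases a <;> simp [imVec] }

theorem imQuatL_apply (v : Fin 3 → ℝ) : imQuatL v = imQuat v := rfl

theorem imVecL_apply (q : ℍ[ℝ]) : imVecL q = imVec q := rfl

theorem contDiffOn_momentVec (hF : IsHyperbolicEigenfunction U F) (k : Fin 2) :
    ContDiffOn ℝ ∞ (fun z => momentVec F z k) (regularSet ε U F) := by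
  have hs : ContDiffOn ℝ ∞ (fun z : ℝ × ℝ => (√z.1 * F z)⁻¹) (regularSet ε U F) := by
    refine ContDiffOn.inv (ContDiffOn.mul (contDiff_fst.contDiffOn.sqrt fun z hz =>
      (hF.rho_pos z hz.1).ne') (hF.smooth.mono fun z hz => hz.1)) fun z hz =>
        mul_ne_zero (Real.sqrt_pos.2 (hF.rho_pos z hz.1)).ne' hz.2.1
  rw [contDiffOn_pi]
  intro a
  fin_cases k <;> fin_cases a
  exacts [contDiffOn_const, (hs.mul contDiff_fst.contDiffOn).neg, hs.mul contDiff_snd.contDiffOn,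
    contDiffOn_const, contDiffOn_const, hs]

theorem contDiffOn_reducedMap (hF : IsHyperbolicEigenfunction U F) :
    ContDiffOn ℝ ∞ (reducedMap F) (reducedRegion ε U F) := by
  rw [contDiffOn_pi]
  intro k
  have hq : ContDiffOn ℝ ∞ (fun w : Reduced => w.2) (reducedRegion ε U F) := contDiff_snd.contDiffOn
  have hm : ContDiffOn ℝ ∞ (fun w : Reduced => imQuatL (momentVec F w.1 k)) (reducedRegion ε U F) :=
    imQuatL.contDiff.comp_contDiffOn ((contDiffOn_momentVec hF k).comp contDiff_fst.contDiffOn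
      fun w hw => hw.1)
  exact imVecL.contDiff.comp_contDiffOn ((hq.mul hm).mul (contDiff_star_quaternion.comp_contDiffOn hq))

/-- The combinations `(dx_φ - η dx_ψ) / √ρ` and `√ρ dx_ψ`, which are dual to the coframe `(α, β)`,
evaluated on the tangent vector `(δ, q c)` and rotated back by `q`. -/
def frameVec (F : ℝ × ℝ → ℝ) (z δ : ℝ × ℝ) (c : ℍ[ℝ]) : Fin 2 → Fin 3 → ℝ :=
  let dF := (dRho F z * δ.1 + dEta F z * δ.2) / F z
  ![![2 * c.imK / F z, (dF - δ.1 / (2 * z.1) - 2 * c.re) / F z, (δ.2 / z.1 - 2 * c.imI) / F z],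
    ![2 * c.imJ / F z, -2 * c.imI / F z, (2 * c.re - δ.1 / (2 * z.1) - dF) / F z]]

/-- The inverse of the matrix of the coframe `(α, β)`. -/
def invCoframe (z : ℝ × ℝ) : Matrix (Fin 2) (Fin 2) ℝ :=
  !![(√z.1)⁻¹, 0; -z.2 / √z.1, √z.1]

/-- The product rule for `q v q̄`, if `q` varies by `q c` and `v` by `v'`. -/
theorem imVec_variation (q c : ℍ[ℝ]) (v v' : Fin 3 → ℝ) :
    imVec ((q * c * imQuat v + q * imQuat v') * star q + q * imQuat v * star (q * c)) =
      rot q (v' + (2 * c.re) • v + (2 : ℝ) • (imVec c ⨯₃ v)) := by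
  have h : v' + (2 * c.re) • v + (2 : ℝ) • (imVec c ⨯₃ v) =
      ![v' 0 + 2 * c.re * v 0 + 2 * (c.imJ * v 2 - c.imK * v 1),
        v' 1 + 2 * c.re * v 1 + 2 * (c.imK * v 0 - c.imI * v 2),
        v' 2 + 2 * c.re * v 2 + 2 * (c.imI * v 1 - c.imJ * v 0)] := by
    ext a
    rw [cross_apply]
    fin_cases a <;> rfl
  rw [h]
  ext a
  fin_cases a <;> simp [rot_apply, imVec, imQuat] <;> ring

theorem fderiv_reducedMap (hF : IsHyperbolicEigenfunction U F) {w : Reduced}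
    (hw : w ∈ reducedRegion ε U F) (δ : ℝ × ℝ) (c : ℍ[ℝ]) :
    fderiv ℝ (reducedMap F) w (δ, w.2 * c) =
      ![rot w.2 (√w.1.1 • frameVec F w.1 δ c 0 + (w.1.2 / √w.1.1) • frameVec F w.1 δ c 1),
        rot w.2 ((√w.1.1)⁻¹ • frameVec F w.1 δ c 1)] := by
  obtain ⟨z, q⟩ := w
  have hρ := hF.rho_pos _ hw.1.1
  have h0 : F z ≠ 0 := hw.1.2.1
  have hs := Real.sqrt_pos.2 hρ
  have hsq := Real.sq_sqrt hρ.le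
  have hd : DifferentiableAt ℝ (reducedMap F) (z, q) :=
    ((contDiffOn_reducedMap hF).contDiffAt
      ((isOpen_reducedRegion hF ε).mem_nhds hw)).differentiableAt (by simp)
  have hS := hasDerivAt_line_sqrt hρ δ
  have hFl := hF.hasDerivAt_line hw.1.1 δ
  set u' := -(√z.1 * F z)⁻¹ * (δ.1 / (2 * z.1) + (dRho F z * δ.1 + dEta F z * δ.2) / F z) with hu'
  have hu : HasDerivAt (fun t : ℝ => (√(z + t • δ).1 * F (z + t • δ))⁻¹) u' 0 := by
    refine ((hS.mul hFl).inv (by simpa using ⟨hs.ne', h0⟩)).congr_deriv ?_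
    have h2 : δ.1 / (2 * z.1) = δ.1 / (2 * √z.1 ^ 2) := by rw [hsq]
    simp only [Pi.mul_apply, zero_smul, add_zero, hu', h2]
    field_simp
  have hv : ∀ k, HasDerivAt (fun t : ℝ => momentVec F (z + t • δ) k)
      (![![0, -(u' * z.1 + (√z.1 * F z)⁻¹ * δ.1), u' * z.2 + (√z.1 * F z)⁻¹ * δ.2],
        ![0, 0, u']] k : Fin 3 → ℝ) 0 := fun k => by
    refine hasDerivAt_pi.2 fun a => ?_
    fin_cases k <;> fin_cases a
    exacts [hasDerivAt_const _ _, (hu.mul (hasDerivAt_line_fst z δ)).neg.congr_deriv (by simp),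
      (hu.mul (hasDerivAt_line_snd z δ)).congr_deriv (by simp), hasDerivAt_const _ _, hasDerivAt_const _ _,
      hu]
  refine fderiv_apply_eq_of_hasDerivAt hd (hasDerivAt_pi.2 fun k => ?_)
  have hk := imVecL.hasFDerivAt.comp_hasDerivAt (0 : ℝ)
    (((hasDerivAt_line_quaternion q (q * c)).mul (imQuatL.hasFDerivAt.comp_hasDerivAt 0 (hv k))).mul
      (hasDerivAt_line_star q (q * c)))
  refine HasDerivAt.congr_deriv hk ?_
  simp only [Pi.mul_apply, Function.comp_apply, imQuatL_apply, zero_smul, add_zero]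
  rw [imVecL_apply, imVec_variation]
  have h2 : ∀ k, ![![0, -(u' * z.1 + (√z.1 * F z)⁻¹ * δ.1), u' * z.2 + (√z.1 * F z)⁻¹ * δ.2],
        ![0, 0, u']] k + (2 * c.re) • momentVec F z k + (2 : ℝ) • (imVec c ⨯₃ momentVec F z k) =
      ![√z.1 • frameVec F z δ c 0 + (z.2 / √z.1) • frameVec F z δ c 1,
        (√z.1)⁻¹ • frameVec F z δ c 1] k := fun k => by
    clear hk hv hu hS hd
    simp only [hu', momentVec, frameVec]
    have h3 : z.1 = √z.1 ^ 2 := hsq.symm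
    generalize √z.1 = s at *
    fin_cases k <;> ext a <;> fin_cases a <;>
      simp [imVec, cross_apply, h3] <;> field_simp <;> ring
  rw [h2]
  fin_cases k <;> rfl

end Differential

/-! ### The gradient of the Higgs field -/

section Higgs

variable {ε : ℝ} {U : Set (ℝ × ℝ)} {F : ℝ × ℝ → ℝ}

/-- The Higgs field in the coframe `(α, β)`, at `|q| = 1`. -/
def frameHiggs (F : ℝ × ℝ → ℝ) (z : ℝ × ℝ) : Matrix (Fin 2) (Fin 2) ℝ :=
  !![F z * (F z / 2 + z.1 * dRho F z), F z * (z.1 * dEta F z);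
     F z * (z.1 * dEta F z), F z * (F z / 2 - z.1 * dRho F z)]

/-- The Higgs field on the quotient by the translations in `φ` and `ψ`. -/
def reducedHiggs (F : ℝ × ℝ → ℝ) (w : Reduced) : Matrix (Fin 2) (Fin 2) ℝ :=
  (‖w.2‖ ^ 2)⁻¹ • (invCoframe w.1 * frameHiggs F w.1 * (invCoframe w.1)ᵀ)

/-- The entries of the Higgs field are free of `√ρ`. -/
theorem reducedHiggs_eq {w : Reduced} (hρ : 0 < w.1.1) : reducedHiggs F w = (‖w.2‖ ^ 2)⁻¹ •
    !![F w.1 * (F w.1 / (2 * w.1.1) + dRho F w.1),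
       F w.1 * (w.1.1 * dEta F w.1 - w.1.2 * (F w.1 / (2 * w.1.1) + dRho F w.1));
       F w.1 * (w.1.1 * dEta F w.1 - w.1.2 * (F w.1 / (2 * w.1.1) + dRho F w.1)),
       F w.1 * (w.1.2 ^ 2 * (F w.1 / (2 * w.1.1) + dRho F w.1)
        - 2 * w.1.2 * (w.1.1 * dEta F w.1) + w.1.1 * (F w.1 / 2 - w.1.1 * dRho F w.1))] := by
  have hs := Real.sqrt_pos.2 hρ
  have h3 : w.1.1 = √w.1.1 ^ 2 := (Real.sq_sqrt hρ.le).symm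
  rw [reducedHiggs]
  congr 1
  simp only [invCoframe, frameHiggs]
  generalize √w.1.1 = s at *
  ext i j
  fin_cases i <;> fin_cases j <;>
    simp [Matrix.mul_apply, Fin.sum_univ_two, h3] <;> field_simp <;> ring

/-- The gradient of the Higgs field in the coframe `(α, β)`, at `q = 1`.  It is totally symmetric: with
`n` of the three indices equal to `1`, the entry is the imaginary quaternion `t_n j - t_{n+1} k`.
Here `B` is `2ρ²F_ηη`, rewritten by the eigenvalue equation, and `C` is `2ρ²F_ρη`. -/
def frameGradient (F : ℝ × ℝ → ℝ) (z : ℝ × ℝ) : Fin 2 → Fin 2 → Fin 2 → Fin 3 → ℝ :=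
  let f := F z
  let a := 2 * z.1 * dRho F z
  let b := 2 * z.1 * dEta F z
  let B := 3 * f / 2 - 2 * z.1 ^ 2 * dRho (dRho F) z
  let C := 2 * z.1 ^ 2 * dEta (dRho F) z
  let t₀ := f ^ 2 / 2 * B
  let t₁ := -(f ^ 2 / 2 * (b / 2 + C))
  let t₂ := f ^ 2 / 2 * (f + a - B)
  let t₃ := f ^ 2 / 2 * (3 * b / 2 + C)
  let t₄ := f ^ 2 / 2 * (B - 2 * a)
  ![![![![0, t₀, -t₁], ![0, t₁, -t₂]], ![![0, t₁, -t₂], ![0, t₂, -t₃]]],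
    ![![![0, t₁, -t₂], ![0, t₂, -t₃]], ![![0, t₂, -t₃], ![0, t₃, -t₄]]]]

/-- The gradient of the Higgs field in the coordinates `(φ, ψ)`, up to rotation and scale. -/
def gradientVec (F : ℝ × ℝ → ℝ) (z : ℝ × ℝ) (i j k : Fin 2) : Fin 3 → ℝ :=
  ∑ x, ∑ y, ∑ t, (invCoframe z i x * invCoframe z j y * invCoframe z k t) • frameGradient F z x y t

theorem contDiffOn_reducedHiggs (hF : IsHyperbolicEigenfunction U F) (i j : Fin 2) :
    ContDiffOn ℝ ∞ (fun w => reducedHiggs F w i j) (reducedRegion ε U F) := by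
  have hm : Set.MapsTo Prod.fst (reducedRegion ε U F) U := fun w hw => hw.1.1
  have hf : ContDiffOn ℝ ∞ (fun w : Reduced => F w.1) (reducedRegion ε U F) :=
    hF.smooth.comp contDiff_fst.contDiffOn hm
  have hp : ContDiffOn ℝ ∞ (fun w : Reduced => dRho F w.1) (reducedRegion ε U F) :=
    (contDiffOn_dRho hF.isOpen hF.smooth).comp contDiff_fst.contDiffOn hm
  have he : ContDiffOn ℝ ∞ (fun w : Reduced => dEta F w.1) (reducedRegion ε U F) :=
    (contDiffOn_dEta hF.isOpen hF.smooth).comp contDiff_fst.contDiffOn hm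
  have h1 : ContDiffOn ℝ ∞ (fun w : Reduced => w.1.1) (reducedRegion ε U F) :=
    contDiff_fst.fst.contDiffOn
  have h2 : ContDiffOn ℝ ∞ (fun w : Reduced => w.1.2) (reducedRegion ε U F) :=
    contDiff_fst.snd.contDiffOn
  have hN : ContDiffOn ℝ ∞ (fun w : Reduced => (‖w.2‖ ^ 2)⁻¹) (reducedRegion ε U F) :=
    (contDiff_snd.norm_sq ℝ).contDiffOn.inv fun w hw => pow_ne_zero 2 (norm_ne_zero_iff.2 hw.2)
  have hg := (hf.div (contDiffOn_const.mul h1) fun w hw =>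
    mul_ne_zero two_ne_zero (hF.rho_pos _ hw.1.1).ne').add hp
  have e00 := hN.mul (hf.mul hg)
  have e01 := hN.mul (hf.mul ((h1.mul he).sub (h2.mul hg)))
  have e11 := hN.mul (hf.mul ((((h2.pow 2).mul hg).sub ((contDiffOn_const (c := (2 : ℝ)).mul h2).mul
    (h1.mul he))).add (h1.mul ((hf.div_const 2).sub (h1.mul hp)))))
  fin_cases i <;> fin_cases j
  · exact e00.congr fun w hw => by rw [reducedHiggs_eq (hF.rho_pos _ hw.1.1)]; rfl
  · exact e01.congr fun w hw => by rw [reducedHiggs_eq (hF.rho_pos _ hw.1.1)]; rfl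
  · exact e01.congr fun w hw => by rw [reducedHiggs_eq (hF.rho_pos _ hw.1.1)]; rfl
  · exact e11.congr fun w hw => by rw [reducedHiggs_eq (hF.rho_pos _ hw.1.1)]; rfl

theorem hasDerivAt_line_norm_sq (q c : ℍ[ℝ]) :
    HasDerivAt (fun t : ℝ => ‖q + t • (q * c)‖ ^ 2) (2 * ‖q‖ ^ 2 * c.re) 0 := by
  refine (hasDerivAt_line_quaternion q (q * c)).norm_sq.congr_deriv ?_
  have h := inner_mul_mul_left q 1 c
  simp only [zero_smul, add_zero, mul_one] at h ⊢
  rw [h, Quaternion.inner_def]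
  simp
  ring

/-- The differential of the Higgs field is the contraction of a totally symmetric gradient with the
differential of the momentum map. -/
theorem fderiv_reducedHiggs (hF : IsHyperbolicEigenfunction U F) {w : Reduced}
    (hw : w ∈ reducedRegion ε U F) (δ : ℝ × ℝ) (c : ℍ[ℝ]) (i j : Fin 2) :
    fderiv ℝ (fun w => reducedHiggs F w i j) w (δ, w.2 * c) = (‖w.2‖ ^ 2)⁻¹ *
      ∑ x, ∑ y, ∑ t, invCoframe w.1 i x * invCoframe w.1 j y *
        (frameGradient F w.1 x y t ⬝ᵥ frameVec F w.1 δ c t) := by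
  obtain ⟨z, q⟩ := w
  have hρ : 0 < z.1 := hF.rho_pos _ hw.1.1
  have h0 : F z ≠ 0 := hw.1.2.1
  have hr : ‖q‖ ^ 2 ≠ 0 := pow_ne_zero 2 (norm_ne_zero_iff.2 hw.2)
  have hd : DifferentiableAt ℝ (fun w => reducedHiggs F w i j) (z, q) :=
    ((contDiffOn_reducedHiggs hF i j).contDiffAt
      ((isOpen_reducedRegion hF ε).mem_nhds hw)).differentiableAt (by simp)
  refine fderiv_apply_eq_of_hasDerivAt hd ?_
  have hN := (hasDerivAt_line_norm_sq q c).inv (by simpa using hr)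
  have hf := hF.hasDerivAt_line hw.1.1 δ
  have hp := hF.hasDerivAt_line_dRho hw.1.1 δ
  have he := hF.hasDerivAt_line_dEta hw.1.1 δ
  have h1 := hasDerivAt_line_fst z δ
  have h2 := hasDerivAt_line_snd z δ
  have hev : ∀ᶠ t in nhds (0 : ℝ), 0 < (z + t • δ).1 :=
    h1.continuousAt.eventually (lt_mem_nhds (by simpa using hρ))
  have hg := (hf.div (h1.const_mul 2) (by simpa using hρ.ne')).add hp
  have e00 := hN.mul (hf.mul hg)
  have e01 := hN.mul (hf.mul ((h1.mul he).sub (h2.mul hg)))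
  have e11 := hN.mul (hf.mul ((((h2.pow 2).mul hg).sub ((h2.const_mul 2).mul (h1.mul he))).add
    (h1.mul ((hf.div_const 2).sub (h1.mul hp)))))
  have hs := Real.sqrt_pos.2 hρ
  have h3 : z.1 = √z.1 ^ 2 := (Real.sq_sqrt hρ.le).symm
  fin_cases i <;> fin_cases j
  · refine HasDerivAt.congr_deriv (HasDerivAt.congr_of_eventuallyEq e00 ?_) ?_
    · filter_upwards [hev] with t ht
      rw [reducedHiggs_eq ht]
      simp
    · simp [invCoframe, frameGradient, frameVec, Fin.sum_univ_two, dotProduct, Fin.sum_univ_three]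
      clear e00 e01 e11 hg hf hp he h1 h2 hd hN hev
      generalize √z.1 = s at *
      rw [h3]
      field_simp
      ring
  · refine HasDerivAt.congr_deriv (HasDerivAt.congr_of_eventuallyEq e01 ?_) ?_
    · filter_upwards [hev] with t ht
      rw [reducedHiggs_eq ht]
      simp
    · simp [invCoframe, frameGradient, frameVec, Fin.sum_univ_two, dotProduct, Fin.sum_univ_three]
      clear e00 e01 e11 hg hf hp he h1 h2 hd hN hev
      generalize √z.1 = s at *
      rw [h3]
      field_simp
      ring
  · refine HasDerivAt.congr_deriv (HasDerivAt.congr_of_eventuallyEq e01 ?_) ?_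
    · filter_upwards [hev] with t ht
      rw [reducedHiggs_eq ht]
      simp
    · simp [invCoframe, frameGradient, frameVec, Fin.sum_univ_two, dotProduct, Fin.sum_univ_three]
      clear e00 e01 e11 hg hf hp he h1 h2 hd hN hev
      generalize √z.1 = s at *
      rw [h3]
      field_simp
      ring
  · refine HasDerivAt.congr_deriv (HasDerivAt.congr_of_eventuallyEq e11 ?_) ?_
    · filter_upwards [hev] with t ht
      rw [reducedHiggs_eq ht]
      simp
    · simp [invCoframe, frameGradient, frameVec, Fin.sum_univ_two, dotProduct, Fin.sum_univ_three]
      clear e00 e01 e11 hg hf hp he h1 h2 hd hN hev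
      generalize √z.1 = s at *
      rw [h3]
      field_simp
      ring

end Higgs

/-! ### The curvature of the connection -/

section Connection

variable {ε : ℝ} {U : Set (ℝ × ℝ)} {F : ℝ × ℝ → ℝ}

/-- The connection forms in the coframe `(α, β)`, with respect to the `j` and `k` components of
`q⁻¹ dq`. -/
def frameConn (F : ℝ × ℝ → ℝ) (z : ℝ × ℝ) : Matrix (Fin 2) (Fin 2) ℝ :=
  !![F z + 2 * z.1 * dRho F z, -(2 * z.1 * dEta F z);
     2 * z.1 * dEta F z, -(F z - 2 * z.1 * dRho F z)]

/-- The connection forms on the quotient by the translations in `φ` and `ψ`; here `q⁻¹ dq` is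
written as `|q|⁻² q̄ dq`. -/
def reducedConn (F : ℝ × ℝ → ℝ) (i : Fin 2) (w : Reduced) : Reduced →L[ℝ] ℝ :=
  LinearMap.toContinuousLinearMap
    { toFun := fun X => (‖w.2‖ ^ 2)⁻¹ * ((invCoframe w.1 * frameConn F w.1) i 0 * (star w.2 * X.2).imJ
        + (invCoframe w.1 * frameConn F w.1) i 1 * (star w.2 * X.2).imK)
      map_add' := fun X Y => by
        have hJ : (star w.2 * (X + Y).2).imJ = (star w.2 * X.2).imJ + (star w.2 * Y.2).imJ := by
          rw [Prod.snd_add, mul_add, Quaternion.imJ_add]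
        have hK : (star w.2 * (X + Y).2).imK = (star w.2 * X.2).imK + (star w.2 * Y.2).imK := by
          rw [Prod.snd_add, mul_add, Quaternion.imK_add]
        rw [hJ, hK]
        ring
      map_smul' := fun c X => by
        have hJ : (star w.2 * (c • X).2).imJ = c * (star w.2 * X.2).imJ := by
          rw [Prod.smul_snd, mul_smul_comm, Quaternion.imJ_smul, smul_eq_mul]
        have hK : (star w.2 * (c • X).2).imK = c * (star w.2 * X.2).imK := by
          rw [Prod.smul_snd, mul_smul_comm, Quaternion.imK_smul, smul_eq_mul]
        rw [hJ, hK, RingHom.id_apply, smul_eq_mul]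
        ring }

theorem reducedConn_apply (i : Fin 2) (w X : Reduced) :
    reducedConn F i w X =
      (‖w.2‖ ^ 2)⁻¹ * ((invCoframe w.1 * frameConn F w.1) i 0 * (star w.2 * X.2).imJ
        + (invCoframe w.1 * frameConn F w.1) i 1 * (star w.2 * X.2).imK) := rfl

/-- The derivative of `invCoframe z * frameConn F z` in the direction `δ`. -/
def connMatrixDeriv (F : ℝ × ℝ → ℝ) (z δ : ℝ × ℝ) : Matrix (Fin 2) (Fin 2) ℝ :=
  let s := √z.1
  let f := F z
  let a := 2 * z.1 * dRho F z
  let b := 2 * z.1 * dEta F z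
  let df := dRho F z * δ.1 + dEta F z * δ.2
  let da := 2 * δ.1 * dRho F z + 2 * z.1 * (dRho (dRho F) z * δ.1 + dEta (dRho F) z * δ.2)
  let db := 2 * δ.1 * dEta F z + 2 * z.1 * (dEta (dRho F) z * δ.1 +
    (3 * F z / (4 * z.1 ^ 2) - dRho (dRho F) z) * δ.2)
  let ds := δ.1 / (2 * s)
  !![(df + da) / s - (f + a) * ds / s ^ 2, -(db / s - b * ds / s ^ 2);
    ds * b + s * db - (δ.2 * (f + a) / s + z.2 * ((df + da) / s - (f + a) * ds / s ^ 2)),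
    δ.2 * b / s + z.2 * (db / s - b * ds / s ^ 2) - (ds * (f - a) + s * (df - da))]

theorem hasDerivAt_connMatrix (hF : IsHyperbolicEigenfunction U F) {z : ℝ × ℝ} (hz : z ∈ U)
    (δ : ℝ × ℝ) (i l : Fin 2) :
    HasDerivAt (fun t : ℝ => (invCoframe (z + t • δ) * frameConn F (z + t • δ)) i l)
      (connMatrixDeriv F z δ i l) 0 := by
  have hρ : 0 < z.1 := hF.rho_pos _ hz
  have hs := Real.sqrt_pos.2 hρ
  have hS := hasDerivAt_line_sqrt hρ δ
  have hI := hS.inv (by simpa using hs.ne')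
  have hf := hF.hasDerivAt_line hz δ
  have h1 := hasDerivAt_line_fst z δ
  have h2 := hasDerivAt_line_snd z δ
  have ha := (h1.const_mul 2).mul (hF.hasDerivAt_line_dRho hz δ)
  have hb := (h1.const_mul 2).mul (hF.hasDerivAt_line_dEta hz δ)
  have e00 := hI.mul (hf.add ha)
  have e01 := (hI.mul hb).neg
  have e10 := (hS.mul hb).sub (h2.mul (hI.mul (hf.add ha)))
  have e11 := (h2.mul (hI.mul hb)).sub (hS.mul (hf.sub ha))
  fin_cases i <;> fin_cases l
  · refine HasDerivAt.congr_deriv (HasDerivAt.congr_of_eventuallyEq e00 (Filter.Eventually.of_forall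
      fun t => ?_)) ?_
    · simp [invCoframe, frameConn, Matrix.mul_apply]
    · simp [connMatrixDeriv]
      field_simp
      ring
  · refine HasDerivAt.congr_deriv (HasDerivAt.congr_of_eventuallyEq e01 (Filter.Eventually.of_forall
      fun t => ?_)) ?_
    · simp [invCoframe, frameConn, Matrix.mul_apply]
    · simp [connMatrixDeriv]
      field_simp
      ring
  · refine HasDerivAt.congr_deriv (HasDerivAt.congr_of_eventuallyEq e10 (Filter.Eventually.of_forall
      fun t => ?_)) ?_
    · simp [invCoframe, frameConn, Matrix.mul_apply]
      ring
    · simp [connMatrixDeriv]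
      field_simp
      ring
  · refine HasDerivAt.congr_deriv (HasDerivAt.congr_of_eventuallyEq e11 (Filter.Eventually.of_forall
      fun t => ?_)) ?_
    · simp [invCoframe, frameConn, Matrix.mul_apply]
      ring
    · simp [connMatrixDeriv]
      field_simp
      ring

theorem contDiffOn_reducedConn (hF : IsHyperbolicEigenfunction U F) (i : Fin 2) :
    ContDiffOn ℝ ∞ (reducedConn F i) (reducedRegion ε U F) := by
  rw [contDiffOn_clm_apply]
  intro X
  have hm : Set.MapsTo Prod.fst (reducedRegion ε U F) U := fun w hw => hw.1.1
  have hf : ContDiffOn ℝ ∞ (fun w : Reduced => F w.1) (reducedRegion ε U F) :=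
    hF.smooth.comp contDiff_fst.contDiffOn hm
  have hp : ContDiffOn ℝ ∞ (fun w : Reduced => dRho F w.1) (reducedRegion ε U F) :=
    (contDiffOn_dRho hF.isOpen hF.smooth).comp contDiff_fst.contDiffOn hm
  have he : ContDiffOn ℝ ∞ (fun w : Reduced => dEta F w.1) (reducedRegion ε U F) :=
    (contDiffOn_dEta hF.isOpen hF.smooth).comp contDiff_fst.contDiffOn hm
  have h1 : ContDiffOn ℝ ∞ (fun w : Reduced => w.1.1) (reducedRegion ε U F) :=
    contDiff_fst.fst.contDiffOn
  have h2 : ContDiffOn ℝ ∞ (fun w : Reduced => w.1.2) (reducedRegion ε U F) :=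
    contDiff_fst.snd.contDiffOn
  have hN : ContDiffOn ℝ ∞ (fun w : Reduced => (‖w.2‖ ^ 2)⁻¹) (reducedRegion ε U F) :=
    (contDiff_snd.norm_sq ℝ).contDiffOn.inv fun w hw => pow_ne_zero 2 (norm_ne_zero_iff.2 hw.2)
  have hS : ContDiffOn ℝ ∞ (fun w : Reduced => √w.1.1) (reducedRegion ε U F) :=
    h1.sqrt fun w hw => (hF.rho_pos _ hw.1.1).ne'
  have hI := hS.inv fun w hw => (Real.sqrt_pos.2 (hF.rho_pos _ hw.1.1)).ne'
  have ha := (contDiffOn_const (c := (2 : ℝ)).mul h1).mul hp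
  have hb := (contDiffOn_const (c := (2 : ℝ)).mul h1).mul he
  have e00 := hI.mul (hf.add ha)
  have e01 := (hI.mul hb).neg
  have e10 := (hS.mul hb).sub (h2.mul (hI.mul (hf.add ha)))
  have e11 := (h2.mul (hI.mul hb)).sub (hS.mul (hf.sub ha))
  have hv : ContDiffOn ℝ ∞ (fun w : Reduced => imVecL (star w.2 * X.2)) (reducedRegion ε U F) :=
    imVecL.contDiff.comp_contDiffOn
      ((contDiff_star_quaternion.comp contDiff_snd).contDiffOn.mul contDiffOn_const)
  have hJ : ContDiffOn ℝ ∞ (fun w : Reduced => (star w.2 * X.2).imJ) (reducedRegion ε U F) :=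
    (contDiffOn_pi.1 hv) 1
  have hK : ContDiffOn ℝ ∞ (fun w : Reduced => (star w.2 * X.2).imK) (reducedRegion ε U F) :=
    (contDiffOn_pi.1 hv) 2
  fin_cases i
  · refine (hN.mul ((e00.mul hJ).add (e01.mul hK))).congr fun w _ => ?_
    rw [reducedConn_apply]
    simp [invCoframe, frameConn, Matrix.mul_apply]
  · refine (hN.mul ((e10.mul hJ).add (e11.mul hK))).congr fun w _ => ?_
    rw [reducedConn_apply]
    simp [invCoframe, frameConn, Matrix.mul_apply]
    exact Or.inl (by ring)

theorem fderiv_reducedConn (hF : IsHyperbolicEigenfunction U F) {w : Reduced}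
    (hw : w ∈ reducedRegion ε U F) (δ δ' : ℝ × ℝ) (c c' : ℍ[ℝ]) (i : Fin 2) :
    fderiv ℝ (reducedConn F i) w (δ, w.2 * c) (δ', w.2 * c') =
      connMatrixDeriv F w.1 δ i 0 * c'.imJ + connMatrixDeriv F w.1 δ i 1 * c'.imK
      - (invCoframe w.1 * frameConn F w.1) i 0 * (c * c').imJ
      - (invCoframe w.1 * frameConn F w.1) i 1 * (c * c').imK := by
  obtain ⟨z, q⟩ := w
  have hr : ‖q‖ ^ 2 ≠ 0 := pow_ne_zero 2 (norm_ne_zero_iff.2 hw.2)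
  have hr0 : ‖q‖ ≠ 0 := norm_ne_zero_iff.2 hw.2
  have hd : DifferentiableAt ℝ (reducedConn F i) (z, q) :=
    ((contDiffOn_reducedConn hF i).contDiffAt
      ((isOpen_reducedRegion hF ε).mem_nhds hw)).differentiableAt (by simp)
  rw [fderiv_apply_apply (E := Reduced) (V := Reduced) hd]
  refine fderiv_apply_eq_of_hasDerivAt (hd.clm_apply (differentiableAt_const _)) ?_
  have hτ : ∀ t : ℝ, star (q + t • (q * c)) * (q * c') = ‖q‖ ^ 2 • (c' + t • (star c * c')) := by
    intro t
    have hq : star q * q = ((‖q‖ ^ 2 : ℝ) : ℍ[ℝ]) := by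
      rw [Quaternion.star_mul_self, Quaternion.normSq_eq_norm_mul_self, sq]
    rw [star_add, Quaternion.star_smul, star_mul, add_mul, smul_mul_assoc, ← mul_assoc, hq,
      mul_assoc, ← mul_assoc (star q), hq, Quaternion.coe_mul_eq_smul,
      mul_smul_comm, smul_add, smul_comm]
  have hN := (hasDerivAt_line_norm_sq q c).inv (by simpa using hr)
  have hl : ∀ x y : ℝ, HasDerivAt (fun t : ℝ => ‖q‖ ^ 2 * (x + t * y)) (‖q‖ ^ 2 * y) 0 := fun x y => by
    simpa using (((hasDerivAt_id (0 : ℝ)).mul_const y).const_add x).const_mul (‖q‖ ^ 2)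
  have h0 := (hasDerivAt_connMatrix hF hw.1.1 δ i 0).mul (hl c'.imJ (star c * c').imJ)
  have h1 := (hasDerivAt_connMatrix hF hw.1.1 δ i 1).mul (hl c'.imK (star c * c').imK)
  refine HasDerivAt.congr_deriv (HasDerivAt.congr_of_eventuallyEq (hN.mul (h0.add h1))
    (Filter.Eventually.of_forall fun t => ?_)) ?_
  · change reducedConn F i (z + t • δ, q + t • (q * c)) (δ', q * c') = _
    rw [reducedConn_apply]
    dsimp only
    rw [hτ]
    simp only [Pi.inv_apply, Pi.mul_apply, Pi.add_apply, Quaternion.imJ_smul, Quaternion.imK_smul,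
      Quaternion.imJ_add, Quaternion.imK_add, smul_eq_mul]
  · simp only [Pi.inv_apply, Pi.mul_apply, Pi.add_apply, zero_smul, add_zero, zero_mul,
      Quaternion.imJ_mul, Quaternion.imK_mul, Quaternion.re_star, Quaternion.imI_star,
      Quaternion.imJ_star, Quaternion.imK_star]
    field_simp
    ring

/-- The equation `dA_i = -∑ ⟨γ_{kij}, dx_j × dx_k⟩` on the quotient, with the vectors referred to the
coframe `(α, β)`. -/
theorem curvature_reducedConn (hF : IsHyperbolicEigenfunction U F) {w : Reduced}
    (hw : w ∈ reducedRegion ε U F) (δ δ' : ℝ × ℝ) (c c' : ℍ[ℝ]) (i : Fin 2) :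
    fderiv ℝ (reducedConn F i) w (δ, w.2 * c) (δ', w.2 * c') -
      fderiv ℝ (reducedConn F i) w (δ', w.2 * c') (δ, w.2 * c) =
      -∑ x, ∑ y, ∑ t, invCoframe w.1 i x *
        (frameGradient F w.1 x y t ⬝ᵥ (frameVec F w.1 δ c y ⨯₃ frameVec F w.1 δ' c' t)) := by
  rw [fderiv_reducedConn hF hw, fderiv_reducedConn hF hw]
  obtain ⟨z, q⟩ := w
  have hρ : 0 < z.1 := hF.rho_pos _ hw.1.1
  have h0 : F z ≠ 0 := hw.1.2.1
  have hs := Real.sqrt_pos.2 hρ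
  have h3 : z.1 = √z.1 ^ 2 := (Real.sq_sqrt hρ.le).symm
  simp only [cross_apply]
  fin_cases i
  · simp [invCoframe, frameConn, connMatrixDeriv, frameGradient, frameVec, Fin.sum_univ_two,
      dotProduct, Fin.sum_univ_three, Matrix.mul_apply]
    generalize √z.1 = s at *
    rw [h3]
    field_simp
    ring
  · simp [invCoframe, frameConn, connMatrixDeriv, frameGradient, frameVec, Fin.sum_univ_two,
      dotProduct, Fin.sum_univ_three, Matrix.mul_apply]
    generalize √z.1 = s at *
    rw [h3]
    field_simp
    ring

end Connection

/-! ### The metric in terms of the momentum map -/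

section Metric

variable {ε : ℝ} {U : Set (ℝ × ℝ)} {F : ℝ × ℝ → ℝ}

/-- The matrix of the coframe `(α, β)` as a function of `(ρ, η)`. -/
def coframe (z : ℝ × ℝ) : Matrix (Fin 2) (Fin 2) ℝ :=
  !![√z.1, 0; z.2 / √z.1, (√z.1)⁻¹]

theorem coframeMatrix_eq (p : Base) : coframeMatrix p = coframe p.1 := by
  ext i j
  fin_cases i <;> fin_cases j <;> simp [coframeMatrix, coframe, formAlpha, formBeta]
  ring

theorem coframe_mul_invCoframe {z : ℝ × ℝ} (hz : 0 < z.1) : coframe z * invCoframe z = 1 := by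
  have hs := (Real.sqrt_pos.2 hz).ne'
  ext i j
  fin_cases i <;> fin_cases j <;> simp [coframe, invCoframe, Matrix.mul_apply] <;> field_simp
  ring

theorem invCoframe_mul_coframe {z : ℝ × ℝ} (hz : 0 < z.1) : invCoframe z * coframe z = 1 :=
  mul_eq_one_comm.1 (coframe_mul_invCoframe hz)

/-- The inverse of `frameHiggs`. -/
def frameHiggsInv (F : ℝ × ℝ → ℝ) (z : ℝ × ℝ) : Matrix (Fin 2) (Fin 2) ℝ :=
  (2 / (F z * discr F z)) •
    !![F z - 2 * z.1 * dRho F z, -(2 * z.1 * dEta F z);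
       -(2 * z.1 * dEta F z), F z + 2 * z.1 * dRho F z]

theorem frameHiggs_mul_inv {z : ℝ × ℝ} (h0 : F z ≠ 0) (hD : discr F z ≠ 0) :
    frameHiggs F z * frameHiggsInv F z = 1 := by
  have hD' : discr F z = F z ^ 2 - 4 * z.1 ^ 2 * (dRho F z ^ 2 + dEta F z ^ 2) := rfl
  simp only [frameHiggs, frameHiggsInv]
  generalize discr F z = D at *
  ext i j
  fin_cases i <;> fin_cases j <;> simp [Matrix.mul_apply] <;> field_simp <;> simp only [hD'] <;> ring

theorem coframe_mul_reducedHiggs {w : Reduced} (hw : 0 < w.1.1) :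
    coframe w.1 * reducedHiggs F w * (coframe w.1)ᵀ = (‖w.2‖ ^ 2)⁻¹ • frameHiggs F w.1 := by
  have h : (invCoframe w.1)ᵀ * (coframe w.1)ᵀ = 1 := by
    rw [← Matrix.transpose_mul, coframe_mul_invCoframe hw, Matrix.transpose_one]
  rw [reducedHiggs, mul_smul_comm, smul_mul_assoc, mul_assoc, mul_assoc, mul_assoc, h, mul_one,
    ← mul_assoc, coframe_mul_invCoframe hw, one_mul]

theorem reducedHiggs_mul_inv {w : Reduced} (hw : 0 < w.1.1) (hq : w.2 ≠ 0) (h0 : F w.1 ≠ 0)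
    (hD : discr F w.1 ≠ 0) : reducedHiggs F w *
      (‖w.2‖ ^ 2 • ((coframe w.1)ᵀ * frameHiggsInv F w.1 * coframe w.1)) = 1 := by
  have hr : ‖w.2‖ ^ 2 ≠ 0 := pow_ne_zero 2 (norm_ne_zero_iff.2 hq)
  have h : (invCoframe w.1)ᵀ * (coframe w.1)ᵀ = 1 := by
    rw [← Matrix.transpose_mul, coframe_mul_invCoframe hw, Matrix.transpose_one]
  rw [reducedHiggs, smul_mul_smul_comm, inv_mul_cancel₀ hr, one_smul]
  calc invCoframe w.1 * frameHiggs F w.1 * (invCoframe w.1)ᵀ *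
        ((coframe w.1)ᵀ * frameHiggsInv F w.1 * coframe w.1)
      = invCoframe w.1 * (frameHiggs F w.1 * ((invCoframe w.1)ᵀ * (coframe w.1)ᵀ) *
          frameHiggsInv F w.1) * coframe w.1 := by simp only [mul_assoc]
    _ = 1 := by rw [h, mul_one, frameHiggs_mul_inv h0 hD, mul_one, invCoframe_mul_coframe hw]

theorem inv_reducedHiggs {w : Reduced} (hw : 0 < w.1.1) (hq : w.2 ≠ 0) (h0 : F w.1 ≠ 0)
    (hD : discr F w.1 ≠ 0) : (reducedHiggs F w)⁻¹ =
      ‖w.2‖ ^ 2 • ((coframe w.1)ᵀ * frameHiggsInv F w.1 * coframe w.1) :=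
  Matrix.inv_eq_right_inv (reducedHiggs_mul_inv hw hq h0 hD)

/-- The components `α + (F + 2ρF_ρ) τ_j - 2ρF_η τ_k` and `β + 2ρF_η τ_j - (F - 2ρF_ρ) τ_k` of the
connection, on a tangent vector with `τ = q⁻¹ dq` equal to `c`. -/
def frameFibre (F : ℝ × ℝ → ℝ) (p X : Base) (c : ℍ[ℝ]) : Fin 2 → ℝ :=
  ![formAlpha p.1 X + frameConn F p.1 0 0 * c.imJ + frameConn F p.1 0 1 * c.imK,
    formBeta p.1 X + frameConn F p.1 1 0 * c.imJ + frameConn F p.1 1 1 * c.imK]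

/-- The Gibbons–Hawking form of the metric at `q = 1`, in the coframe `(α, β)`. -/
theorem frame_metric_eq {p : Base} (hρ : 0 < p.1.1) (h0 : F p.1 ≠ 0) (hD : discr F p.1 ≠ 0)
    (X Y : Base) (c c' : ℍ[ℝ]) :
    baseMetric F p X Y
      + 4 * inner ℝ (c + connectionForm F p X) (c' + connectionForm F p Y) =
    ∑ x, ∑ y, frameHiggs F p.1 x y * (frameVec F p.1 X.1 c x ⬝ᵥ frameVec F p.1 Y.1 c' y) +
      ∑ x, ∑ y, frameHiggsInv F p.1 x y * (frameFibre F p X c x * frameFibre F p Y c' y) := by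
  have hi : ∀ x y : ℍ[ℝ], inner ℝ x y = x.re * y.re + x.imI * y.imI + x.imJ * y.imJ
      + x.imK * y.imK := fun x y => by
    rw [Quaternion.inner_def]
    simp
  rw [hi, baseMetric_apply, connectionForm_apply, connectionForm_apply, fibreForm₁_apply,
    fibreForm₁_apply, fibreForm₂_apply, fibreForm₂_apply]
  simp only [frameFibre]
  generalize formAlpha p.1 X = α
  generalize formAlpha p.1 Y = α'
  generalize formBeta p.1 X = β
  generalize formBeta p.1 Y = β'
  simp [frameHiggs, frameHiggsInv, frameVec, frameConn, Fin.sum_univ_two, dotProduct,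
    Fin.sum_univ_three]
  rw [discr] at *
  generalize dRho F p.1 = a at *
  generalize dEta F p.1 = b at *
  generalize F p.1 = f at *
  field_simp
  ring

/-- The hyperkähler metric in Gibbons–Hawking form, with the data on the quotient. -/
theorem totalMetric_eq_reduced (hε : ε * ε = 1) (hF : IsHyperbolicEigenfunction U F) {P : Total}
    (hP : P ∈ totalRegion ε U F) (X Y : Total) :
    totalMetric ε F P X Y =
      ∑ i, ∑ j, reducedHiggs F (P.1.1, P.2) i j *
        (fderiv ℝ (reducedMap F) (P.1.1, P.2) (X.1.1, X.2) i ⬝ᵥ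
          fderiv ℝ (reducedMap F) (P.1.1, P.2) (Y.1.1, Y.2) j) +
      ∑ i, ∑ j, (reducedHiggs F (P.1.1, P.2))⁻¹ i j *
        ((X.1.2 i + reducedConn F i (P.1.1, P.2) (X.1.1, X.2)) *
          (Y.1.2 j + reducedConn F j (P.1.1, P.2) (Y.1.1, Y.2))) := by
  obtain ⟨p, q⟩ := P
  obtain ⟨X, x⟩ := X
  obtain ⟨Y, y⟩ := Y
  have hρ : 0 < p.1.1 := hF.rho_pos _ hP.1.1
  have h0 : F p.1 ≠ 0 := hP.1.2.1
  have hq : q ≠ 0 := hP.2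
  have hr : ‖q‖ ≠ 0 := norm_ne_zero_iff.2 hq
  have hD : discr F p.1 ≠ 0 := fun h => by simpa [h] using hP.1.2.2
  obtain ⟨c, rfl⟩ : ∃ c, x = q * c := ⟨q⁻¹ * x, (mul_inv_cancel_left₀ hq x).symm⟩
  obtain ⟨c', rfl⟩ : ∃ c, y = q * c := ⟨q⁻¹ * y, (mul_inv_cancel_left₀ hq y).symm⟩
  have hw : (p.1, q) ∈ reducedRegion ε U F := ⟨hP.1, hq⟩
  dsimp only
  rw [fderiv_reducedMap hF hw, fderiv_reducedMap hF hw,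
    inv_reducedHiggs (w := (p.1, q)) hρ hq h0 hD]
  have hT : ∀ (X : Base) (c : ℍ[ℝ]),
      coframe p.1 *ᵥ (fun i => X.2 i + reducedConn F i (p.1, q) (X.1, q * c)) =
        frameFibre F p X c := fun X c => by
    have hs := (Real.sqrt_pos.2 hρ).ne'
    have hqc : star q * (q * c) = ‖q‖ ^ 2 • c := by
      rw [← mul_assoc, Quaternion.star_mul_self, Quaternion.normSq_eq_norm_mul_self, ← sq,
        Quaternion.coe_mul_eq_smul]
    simp only [reducedConn_apply, hqc]
    ext x
    fin_cases x <;>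
      simp [coframe, invCoframe, frameFibre, formAlpha, formBeta, Matrix.mulVec, dotProduct,
        Matrix.mul_apply, Fin.sum_univ_two] <;> field_simp <;> ring
  have h1 : ∑ i, ∑ j, reducedHiggs F (p.1, q) i j *
        (![rot q (√p.1.1 • frameVec F p.1 X.1 c 0 + (p.1.2 / √p.1.1) • frameVec F p.1 X.1 c 1),
          rot q ((√p.1.1)⁻¹ • frameVec F p.1 X.1 c 1)] i ⬝ᵥ
        ![rot q (√p.1.1 • frameVec F p.1 Y.1 c' 0 + (p.1.2 / √p.1.1) • frameVec F p.1 Y.1 c' 1),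
          rot q ((√p.1.1)⁻¹ • frameVec F p.1 Y.1 c' 1)] j) =
      ‖q‖ ^ 2 * ∑ x, ∑ y,
        frameHiggs F p.1 x y * (frameVec F p.1 X.1 c x ⬝ᵥ frameVec F p.1 Y.1 c' y) := by
    have hs := (Real.sqrt_pos.2 hρ).ne'
    simp only [reducedHiggs]
    generalize frameVec F p.1 X.1 c = N
    generalize frameVec F p.1 Y.1 c' = N'
    generalize frameHiggs F p.1 = φ
    simp only [Matrix.smul_apply, Matrix.mul_apply, Matrix.transpose_apply, Fin.sum_univ_two]
    simp [dotProduct_rot, -map_add, -map_smul, invCoframe]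
    field_simp
    ring
  have h2 : ∀ (P K : Matrix (Fin 2) (Fin 2) ℝ) (u v : Fin 2 → ℝ),
      ∑ i, ∑ j, (‖q‖ ^ 2 • (Pᵀ * K * P)) i j * (u i * v j) =
        ‖q‖ ^ 2 * ∑ x, ∑ y, K x y * ((P *ᵥ u) x * (P *ᵥ v) y) := fun P K u v => by
    simp [Fin.sum_univ_two, Matrix.mul_apply, Matrix.mulVec, dotProduct]
    ring
  have hv : ∀ (X : Base) (c : ℍ[ℝ]), vertForm (connectionForm F) (p, q) (X, q * c) =
      q * (c + connectionForm F p X) := fun X c => by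
    rw [vertForm_apply, mul_add]
  have h3 : ε * ‖q‖ ^ 2 * einsteinMetric ε F p X Y = ‖q‖ ^ 2 * baseMetric F p X Y := by
    have h : einsteinMetric ε F p X Y = ε * baseMetric F p X Y := rfl
    rw [h]
    linear_combination (‖q‖ ^ 2 * baseMetric F p X Y) * hε
  rw [h1, h2 _ _ (fun i => X.2 i + _) (fun j => Y.2 j + _), hT, hT, totalMetric_apply, h3, hv, hv,
    inner_mul_mul_left, ← mul_add, ← frame_metric_eq hρ h0 hD]
  ring

end Metric

/-! ### The monopole equations on the quotient -/

section GradientVector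

variable {ε : ℝ} {U : Set (ℝ × ℝ)} {F : ℝ × ℝ → ℝ}

/-- The gradient `∂Φ_{ij}/∂x_k`, a vector of `ℝ³`, as a function on the quotient by the translations. -/
def higgsGradient (F : ℝ × ℝ → ℝ) (w : Reduced) (i j k : Fin 2) : Fin 3 → ℝ :=
  ((‖w.2‖ ^ 2) ^ 3)⁻¹ • rot w.2 (gradientVec F w.1 i j k)

theorem frameGradient_symm (F : ℝ × ℝ → ℝ) (z : ℝ × ℝ) :
    frameGradient F z 0 1 0 = frameGradient F z 0 0 1 ∧
      frameGradient F z 1 0 0 = frameGradient F z 0 0 1 ∧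
      frameGradient F z 1 0 1 = frameGradient F z 0 1 1 ∧
      frameGradient F z 1 1 0 = frameGradient F z 0 1 1 := ⟨rfl, rfl, rfl, rfl⟩

theorem gradientVec_comm (F : ℝ × ℝ → ℝ) (z : ℝ × ℝ) (i j k : Fin 2) :
    gradientVec F z i j k = gradientVec F z k j i := by
  obtain ⟨h1, h2, h3, h4⟩ := frameGradient_symm F z
  simp only [gradientVec, Fin.sum_univ_two, h1, h2, h3, h4]
  module

theorem fderiv_reducedHiggs_eq (hF : IsHyperbolicEigenfunction U F) {w : Reduced}
    (hw : w ∈ reducedRegion ε U F) (i j : Fin 2) (X : Reduced) :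
    fderiv ℝ (fun w => reducedHiggs F w i j) w X =
      ∑ k, higgsGradient F w i j k ⬝ᵥ fderiv ℝ (reducedMap F) w X k := by
  obtain ⟨δ, x⟩ := X
  have hq : w.2 ≠ 0 := hw.2
  have hr : ‖w.2‖ ≠ 0 := norm_ne_zero_iff.2 hq
  have hs := (Real.sqrt_pos.2 (hF.rho_pos _ hw.1.1)).ne'
  obtain ⟨c, rfl⟩ : ∃ c, x = w.2 * c := ⟨w.2⁻¹ * x, (mul_inv_cancel_left₀ hq x).symm⟩
  rw [fderiv_reducedHiggs hF hw, fderiv_reducedMap hF hw]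
  simp only [higgsGradient, gradientVec]
  generalize frameVec F w.1 δ c = N
  generalize frameGradient F w.1 = g
  simp only [Fin.sum_univ_two, smul_dotProduct, Matrix.cons_val_zero, Matrix.cons_val_one,
    dotProduct_rot, add_dotProduct, dotProduct_add, dotProduct_smul, smul_eq_mul]
  have hQ : invCoframe w.1 0 0 = (√w.1.1)⁻¹ ∧ invCoframe w.1 0 1 = 0 ∧
    invCoframe w.1 1 0 = -w.1.2 / √w.1.1 ∧ invCoframe w.1 1 1 = √w.1.1 := ⟨rfl, rfl, rfl, rfl⟩
  simp only [hQ]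
  field_simp
  ring

theorem curvature_reducedConn_eq (hF : IsHyperbolicEigenfunction U F) {w : Reduced}
    (hw : w ∈ reducedRegion ε U F) (i : Fin 2) (X Y : Reduced) :
    fderiv ℝ (reducedConn F i) w X Y - fderiv ℝ (reducedConn F i) w Y X =
      -∑ j, ∑ k, higgsGradient F w k i j ⬝ᵥ
        (fderiv ℝ (reducedMap F) w X j ⨯₃ fderiv ℝ (reducedMap F) w Y k) := by
  obtain ⟨δ, x⟩ := X
  obtain ⟨δ', y⟩ := Y
  have hq : w.2 ≠ 0 := hw.2
  have hr : ‖w.2‖ ≠ 0 := norm_ne_zero_iff.2 hq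
  have hs := (Real.sqrt_pos.2 (hF.rho_pos _ hw.1.1)).ne'
  obtain ⟨c, rfl⟩ : ∃ c, x = w.2 * c := ⟨w.2⁻¹ * x, (mul_inv_cancel_left₀ hq x).symm⟩
  obtain ⟨c', rfl⟩ : ∃ c, y = w.2 * c := ⟨w.2⁻¹ * y, (mul_inv_cancel_left₀ hq y).symm⟩
  rw [curvature_reducedConn hF hw, fderiv_reducedMap hF hw, fderiv_reducedMap hF hw]
  obtain ⟨h1, h2, h3, h4⟩ := frameGradient_symm F w.1
  have hQ : invCoframe w.1 0 0 = (√w.1.1)⁻¹ ∧ invCoframe w.1 0 1 = 0 ∧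
    invCoframe w.1 1 0 = -w.1.2 / √w.1.1 ∧ invCoframe w.1 1 1 = √w.1.1 := ⟨rfl, rfl, rfl, rfl⟩
  simp only [higgsGradient, gradientVec]
  generalize frameVec F w.1 δ c = N
  generalize frameVec F w.1 δ' c' = N'
  generalize frameGradient F w.1 = g at *
  simp only [Fin.sum_univ_two, smul_dotProduct, Matrix.cons_val_zero, Matrix.cons_val_one,
    cross_rot, dotProduct_rot, add_dotProduct, dotProduct_add, dotProduct_smul, smul_eq_mul,
    map_add, map_smul, LinearMap.add_apply, LinearMap.smul_apply, hQ, h1, h2, h3, h4]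
  field_simp
  ring

end GradientVector

/-! ### Descent along a map with invertible differential -/

section Descent

/-- The function on `f '' D` induced by a function `g` on `D` which is constant on the fibres
of `f`. -/
def descend {H E V : Type*} [Nonempty H] (f : H → E) (D : Set H) (g : H → V) (y : E) : V :=
  g (Function.invFunOn f D y)

theorem descend_apply {H E V : Type*} [Nonempty H] {f : H → E} {D : Set H} {g : H → V} {w : H}
    (hg : ∀ w ∈ D, ∀ w' ∈ D, f w = f w' → g w = g w') (hw : w ∈ D) :
    descend f D g (f w) = g w :=
  hg _ (Function.invFunOn_apply_mem hw) _ hw (Function.invFunOn_apply_eq hw)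

variable {H E V : Type*} [NormedAddCommGroup H] [NormedSpace ℝ H] [NormedAddCommGroup E]
  [NormedSpace ℝ E] [NormedAddCommGroup V] [NormedSpace ℝ V]
  {f : H → E} {D : Set H} {g : H → V} {w : H}

/-- The exterior derivative of `1`-forms commutes with pullback. -/
theorem dOne_pullback {a : E → E →L[ℝ] V} {b : H → H →L[ℝ] V}
    (hab : ∀ᶠ w' in nhds w, b w' = a (f w') ∘L fderiv ℝ f w') (ha : DifferentiableAt ℝ a (f w))
    (hf : ContDiffAt ℝ ∞ f w) (X Y : H) :
    dOne b w ![X, Y] = dOne a (f w) ![fderiv ℝ f w X, fderiv ℝ f w Y] := by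
  have h1 : DifferentiableAt ℝ f w := hf.differentiableAt (by simp)
  have h2 : DifferentiableAt ℝ (fderiv ℝ f) w :=
    (hf.fderiv_right (m := ∞) (by simp)).differentiableAt (by simp)
  have h3 : DifferentiableAt ℝ (fun w => a (f w)) w := ha.comp w h1
  have h4 : b =ᶠ[nhds w] fun w => a (f w) ∘L fderiv ℝ f w := hab
  have hsymm : IsSymmSndFDerivAt ℝ f w := hf.isSymmSndFDerivAt (by
    simp only [minSmoothness_of_isRCLikeNormedField]
    exact WithTop.coe_le_coe.2 (le_top (a := (2 : ℕ∞))))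
  have h5 : ∀ X Y, fderiv ℝ b w X Y =
      a (f w) (fderiv ℝ (fderiv ℝ f) w X Y) + fderiv ℝ a (f w) (fderiv ℝ f w X) (fderiv ℝ f w Y) := by
    intro X Y
    rw [h4.fderiv_eq, fderiv_clm_comp h3 h2]
    have h6 : fderiv ℝ (fun w => a (f w)) w = fderiv ℝ a (f w) ∘L fderiv ℝ f w :=
      fderiv_comp w ha h1
    simp [h6]
  rw [dOne_apply ((h3.clm_comp h2).congr_of_eventuallyEq h4), dOne_apply ha, h5, h5, hsymm X Y]
  abel

variable [CompleteSpace H]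

theorem isOpen_image_of_isInvertible (hD : IsOpen D) (hf : ContDiffOn ℝ ∞ f D)
    (hi : ∀ w ∈ D, (fderiv ℝ f w).IsInvertible) : IsOpen (f '' D) := by
  rw [isOpen_iff_mem_nhds]
  rintro _ ⟨w, hw, rfl⟩
  obtain ⟨e, he⟩ := hi w hw
  have hc : ContDiffAt ℝ ∞ f w := hf.contDiffAt (hD.mem_nhds hw)
  have hd : HasFDerivAt f (e : H →L[ℝ] E) w := by
    rw [he]
    exact (hc.differentiableAt (by simp)).hasFDerivAt
  rw [← (hc.hasStrictFDerivAt' hd (by simp)).map_nhds_eq_of_equiv]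
  exact Filter.image_mem_map (hD.mem_nhds hw)

theorem contDiffOn_descend (hD : IsOpen D) (hf : ContDiffOn ℝ ∞ f D)
    (hi : ∀ w ∈ D, (fderiv ℝ f w).IsInvertible) (hg : ContDiffOn ℝ ∞ g D)
    (hfg : ∀ w ∈ D, ∀ w' ∈ D, f w = f w' → g w = g w') :
    ContDiffOn ℝ ∞ (descend f D g) (f '' D) := by
  rintro _ ⟨w, hw, rfl⟩
  obtain ⟨e, he⟩ := hi w hw
  have hc : ContDiffAt ℝ ∞ f w := hf.contDiffAt (hD.mem_nhds hw)
  have hd : HasFDerivAt f (e : H →L[ℝ] E) w := by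
    rw [he]
    exact (hc.differentiableAt (by simp)).hasFDerivAt
  have h0 : (∞ : WithTop ℕ∞) ≠ 0 := by simp
  have hl := hc.localInverse_apply_image hd h0
  have hg' : ContDiffAt ℝ ∞ g (hc.localInverse hd h0 (f w)) := by
    rw [hl]
    exact hg.contDiffAt (hD.mem_nhds hw)
  have hs := hc.to_localInverse hd h0
  have hmem : ∀ᶠ y in nhds (f w), hc.localInverse hd h0 y ∈ D :=
    hs.continuousAt.eventually_mem (by rw [hl]; exact hD.mem_nhds hw)
  refine ((hg'.comp (f w) hs).congr_of_eventuallyEq ?_).contDiffWithinAt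
  filter_upwards [hmem, (hc.hasStrictFDerivAt' hd h0).eventually_right_inverse] with y hy hy'
  have h := descend_apply hfg hy
  exact (congrArg (descend f D g) hy').symm.trans h

theorem fderiv_descend (hD : IsOpen D) (hf : ContDiffOn ℝ ∞ f D)
    (hi : ∀ w ∈ D, (fderiv ℝ f w).IsInvertible) (hg : ContDiffOn ℝ ∞ g D)
    (hfg : ∀ w ∈ D, ∀ w' ∈ D, f w = f w' → g w = g w') (hw : w ∈ D) (X : H) :
    fderiv ℝ (descend f D g) (f w) (fderiv ℝ f w X) = fderiv ℝ g w X := by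
  have h1 : DifferentiableAt ℝ (descend f D g) (f w) :=
    ((contDiffOn_descend hD hf hi hg hfg).contDiffAt
      ((isOpen_image_of_isInvertible hD hf hi).mem_nhds ⟨w, hw, rfl⟩)).differentiableAt (by simp)
  have h2 : DifferentiableAt ℝ f w :=
    (hf.contDiffAt (hD.mem_nhds hw)).differentiableAt (by simp)
  have h3 : g =ᶠ[nhds w] descend f D g ∘ f := by
    filter_upwards [hD.mem_nhds hw] with w' hw'
    exact (descend_apply hfg hw').symm
  rw [h3.fderiv_eq, fderiv_comp w h1 h2]
  rfl

theorem contDiffOn_comp_inverse (hD : IsOpen D) (hf : ContDiffOn ℝ ∞ f D)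
    (hi : ∀ w ∈ D, (fderiv ℝ f w).IsInvertible) {b : H → H →L[ℝ] V} (hb : ContDiffOn ℝ ∞ b D) :
    ContDiffOn ℝ ∞ (fun w => b w ∘L (fderiv ℝ f w).inverse) D := by
  refine hb.clm_comp fun w hw => ContDiffAt.contDiffWithinAt ?_
  obtain ⟨e, he⟩ := hi w hw
  have h1 : ContDiffAt ℝ ∞ (fderiv ℝ f) w :=
    (hf.fderiv_of_isOpen hD (by simp)).contDiffAt (hD.mem_nhds hw)
  have h2 : ContDiffAt ℝ ∞ ContinuousLinearMap.inverse (fderiv ℝ f w) := by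
    rw [← he]
    exact contDiffAt_map_inverse e
  exact h2.comp w h1

end Descent

/-! ### Invertibility of the differential and invariance under `q ↦ -q` -/

section Reduction

variable {ε : ℝ} {U : Set (ℝ × ℝ)} {F : ℝ × ℝ → ℝ}

theorem fderiv_momentMap (hF : IsHyperbolicEigenfunction U F) {P : Total}
    (hP : P ∈ totalRegion ε U F) (X : Total) :
    fderiv ℝ (momentMap F) P X = fderiv ℝ (reducedMap F) (P.1.1, P.2) (X.1.1, X.2) := by
  have hw : (P.1.1, P.2) ∈ reducedRegion ε U F := ⟨hP.1, hP.2⟩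
  have hd : DifferentiableAt ℝ (reducedMap F) (P.1.1, P.2) :=
    ((contDiffOn_reducedMap hF).contDiffAt
      ((isOpen_reducedRegion hF ε).mem_nhds hw)).differentiableAt (by simp)
  let π : Total →L[ℝ] Reduced :=
    ((ContinuousLinearMap.fst ℝ (ℝ × ℝ) (Fin 2 → ℝ)) ∘L ContinuousLinearMap.fst ℝ Base ℍ[ℝ]).prod
      (ContinuousLinearMap.snd ℝ Base ℍ[ℝ])
  have hπ : HasFDerivAt (fun P : Total => (P.1.1, P.2)) π P := π.hasFDerivAt
  have h : momentMap F = reducedMap F ∘ fun P => (P.1.1, P.2) :=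
    funext fun P => momentMap_eq_reducedMap F P
  rw [h, (hd.hasFDerivAt.comp P hπ).fderiv]
  rfl

theorem finrank_reduced : Module.finrank ℝ Reduced = Module.finrank ℝ MomentumSpace := by
  rw [Module.finrank_prod, Module.finrank_prod, Quaternion.finrank_eq_four, Module.finrank_pi_fintype]
  simp

/-- A kernel vector, lifted horizontally, would lie in the kernel of the hyperkähler metric. -/
theorem fderiv_reducedMap_injective (hε : ε * ε = 1) (hF : IsHyperbolicEigenfunction U F)
    {w : Reduced} (hw : w ∈ reducedRegion ε U F) :
    Function.Injective (fderiv ℝ (reducedMap F) w) := by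
  rw [injective_iff_map_eq_zero]
  intro X hX
  obtain ⟨z, q⟩ := w
  obtain ⟨δ, x⟩ := X
  have hP : (((z, 0), q) : Total) ∈ totalRegion ε U F := ⟨hw.1, hw.2⟩
  have h0 : (((δ, fun i => -reducedConn F i (z, q) (δ, x)), x) : Total) = 0 := by
    refine totalMetric_separating hε hF hP fun Y => ?_
    rw [totalMetric_eq_reduced hε hF hP]
    dsimp only
    rw [hX]
    simp
  exact Prod.ext (congrArg (fun X : Total => X.1.1) h0) (congrArg (fun X : Total => X.2) h0)

theorem isInvertible_fderiv_reducedMap (hε : ε * ε = 1) (hF : IsHyperbolicEigenfunction U F)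
    {w : Reduced} (hw : w ∈ reducedRegion ε U F) : (fderiv ℝ (reducedMap F) w).IsInvertible :=
  ⟨(LinearEquiv.ofInjectiveOfFinrankEq (fderiv ℝ (reducedMap F) w).toLinearMap
    (fderiv_reducedMap_injective hε hF hw) finrank_reduced).toContinuousLinearEquiv,
    ContinuousLinearMap.ext fun _ => rfl⟩

theorem image_momentMap (ε : ℝ) (U : Set (ℝ × ℝ)) (F : ℝ × ℝ → ℝ) :
    momentMap F '' totalRegion ε U F = reducedMap F '' reducedRegion ε U F := by
  ext y
  constructor
  · rintro ⟨P, hP, rfl⟩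
    exact ⟨(P.1.1, P.2), ⟨hP.1, hP.2⟩, (momentMap_eq_reducedMap F P).symm⟩
  · rintro ⟨w, hw, rfl⟩
    exact ⟨((w.1, 0), w.2), ⟨hw.1, hw.2⟩, momentMap_eq_reducedMap F _⟩

/-- Functions of `((ρ, η), q)` which are even in `q` are constant on the fibres of the momentum
map. -/
theorem eq_of_reducedMap_eq {V : Type*} {g : Reduced → V} (hg : ∀ z q, g (z, -q) = g (z, q))
    (hF : IsHyperbolicEigenfunction U F) :
    ∀ w ∈ reducedRegion ε U F, ∀ w' ∈ reducedRegion ε U F, reducedMap F w = reducedMap F w' →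
      g w = g w' := by
  intro w hw w' hw' h
  obtain ⟨h1, h2⟩ := reducedMap_injective hF hw hw' h
  obtain ⟨z, q⟩ := w
  obtain ⟨z', q'⟩ := w'
  obtain rfl : z = z' := h1
  rcases h2 with h2 | h2
  · obtain rfl : q = q' := h2
    rfl
  · obtain rfl : q = -q' := h2
    exact hg z q'

theorem reducedHiggs_neg (z : ℝ × ℝ) (q : ℍ[ℝ]) :
    reducedHiggs F (z, -q) = reducedHiggs F (z, q) := by
  simp [reducedHiggs]

/-- The change of sign of `q`. -/
def flipSign : Reduced ≃L[ℝ] Reduced :=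
  (ContinuousLinearEquiv.refl ℝ (ℝ × ℝ)).prodCongr (ContinuousLinearEquiv.neg ℝ)

theorem reducedConn_comp_inverse_neg (i : Fin 2) (z : ℝ × ℝ) (q : ℍ[ℝ]) :
    reducedConn F i (z, -q) ∘L (fderiv ℝ (reducedMap F) (z, -q)).inverse =
      reducedConn F i (z, q) ∘L (fderiv ℝ (reducedMap F) (z, q)).inverse := by
  have hs : flipSign (z, q) = (z, -q) := rfl
  have h1 : reducedMap F ∘ flipSign = reducedMap F :=
    funext fun w => reducedMap_neg F w.1 w.2
  have h2 : fderiv ℝ (reducedMap F) (z, q) =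
      fderiv ℝ (reducedMap F) (z, -q) ∘L (flipSign : Reduced →L[ℝ] Reduced) := by
    rw [← hs, ← flipSign.comp_right_fderiv, h1]
  have h3 : reducedConn F i (z, q) =
      reducedConn F i (z, -q) ∘L (flipSign : Reduced →L[ℝ] Reduced) := by
    refine ContinuousLinearMap.ext fun X => ?_
    change reducedConn F i (z, q) X = reducedConn F i (z, -q) (X.1, -X.2)
    rw [reducedConn_apply, reducedConn_apply]
    simp
  rw [h2, h3, ContinuousLinearMap.inverse_comp_equiv]
  refine ContinuousLinearMap.ext fun X => ?_
  simp

end Reduction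

/-! ### The generalized Gibbons–Hawking Ansatz -/

section Ansatz

variable {ε : ℝ} {U : Set (ℝ × ℝ)} {F : ℝ × ℝ → ℝ}

/-- The Higgs field on the image of the momentum map. -/
def higgsField (ε : ℝ) (U : Set (ℝ × ℝ)) (F : ℝ × ℝ → ℝ) (y : MomentumSpace) :
    Matrix (Fin 2) (Fin 2) ℝ :=
  descend (reducedMap F) (reducedRegion ε U F) (reducedHiggs F) y

/-- The connection forms on the image of the momentum map. -/
def higgsConn (ε : ℝ) (U : Set (ℝ × ℝ)) (F : ℝ × ℝ → ℝ) (i : Fin 2) (y : MomentumSpace) :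
    MomentumSpace →L[ℝ] ℝ :=
  descend (reducedMap F) (reducedRegion ε U F)
    (fun w => reducedConn F i w ∘L (fderiv ℝ (reducedMap F) w).inverse) y

theorem higgsField_reducedMap (hF : IsHyperbolicEigenfunction U F) {w : Reduced}
    (hw : w ∈ reducedRegion ε U F) :
    higgsField ε U F (reducedMap F w) = reducedHiggs F w :=
  descend_apply (eq_of_reducedMap_eq reducedHiggs_neg hF) hw

theorem higgsConn_reducedMap (hF : IsHyperbolicEigenfunction U F) {w : Reduced}
    (hw : w ∈ reducedRegion ε U F) (i : Fin 2) :
    higgsConn ε U F i (reducedMap F w) =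
      reducedConn F i w ∘L (fderiv ℝ (reducedMap F) w).inverse :=
  descend_apply (g := fun w => reducedConn F i w ∘L (fderiv ℝ (reducedMap F) w).inverse)
    (eq_of_reducedMap_eq (reducedConn_comp_inverse_neg i) hF) hw

theorem higgsConn_comp_fderiv (hε : ε * ε = 1) (hF : IsHyperbolicEigenfunction U F) {w : Reduced}
    (hw : w ∈ reducedRegion ε U F) (i : Fin 2) :
    higgsConn ε U F i (reducedMap F w) ∘L fderiv ℝ (reducedMap F) w = reducedConn F i w := by
  rw [higgsConn_reducedMap hF hw]
  obtain ⟨e, he⟩ := isInvertible_fderiv_reducedMap hε hF hw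
  rw [← he, ContinuousLinearMap.inverse_equiv]
  refine ContinuousLinearMap.ext fun X => ?_
  simp

theorem contDiffOn_higgsConn (hε : ε * ε = 1) (hF : IsHyperbolicEigenfunction U F) (i : Fin 2) :
    ContDiffOn ℝ ∞ (higgsConn ε U F i) (reducedMap F '' reducedRegion ε U F) :=
  contDiffOn_descend (isOpen_reducedRegion hF ε) (contDiffOn_reducedMap hF)
    (fun _ hw => isInvertible_fderiv_reducedMap hε hF hw)
    (contDiffOn_comp_inverse (isOpen_reducedRegion hF ε) (contDiffOn_reducedMap hF)
      (fun _ hw => isInvertible_fderiv_reducedMap hε hF hw) (contDiffOn_reducedConn hF i))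
    (eq_of_reducedMap_eq (reducedConn_comp_inverse_neg i) hF)

theorem fderiv_higgsField (hε : ε * ε = 1) (hF : IsHyperbolicEigenfunction U F) {w : Reduced}
    (hw : w ∈ reducedRegion ε U F) (i j k : Fin 2) (u : Fin 3 → ℝ) :
    fderiv ℝ (fun y => higgsField ε U F y i j) (reducedMap F w) (Pi.single k u) =
      higgsGradient F w i j k ⬝ᵥ u := by
  obtain ⟨e, he⟩ := isInvertible_fderiv_reducedMap hε hF hw
  have hX : fderiv ℝ (reducedMap F) w (e.symm (Pi.single k u)) = Pi.single k u := by
    rw [← he]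
    exact e.apply_symm_apply _
  have h := fderiv_descend (isOpen_reducedRegion hF ε) (contDiffOn_reducedMap hF)
    (fun _ hw => isInvertible_fderiv_reducedMap hε hF hw) (contDiffOn_reducedHiggs hF i j)
    (eq_of_reducedMap_eq (fun z q => by rw [reducedHiggs_neg]) hF) hw (e.symm (Pi.single k u))
  rw [fderiv_reducedHiggs_eq hF hw, hX] at h
  refine h.trans ?_
  rw [Finset.sum_eq_single k (fun l _ hl => by rw [Pi.single_eq_of_ne hl, dotProduct_zero])
    (by simp), Pi.single_eq_same]

theorem reducedHiggs_isSymm (w : Reduced) : (reducedHiggs F w).IsSymm := by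
  have h : (frameHiggs F w.1)ᵀ = frameHiggs F w.1 := by
    ext i j
    fin_cases i <;> fin_cases j <;> rfl
  rw [Matrix.IsSymm, reducedHiggs, Matrix.transpose_smul, Matrix.transpose_mul, Matrix.transpose_mul,
    Matrix.transpose_transpose, h, mul_assoc]

theorem isGeneralizedMonopole (hε : ε * ε = 1) (hF : IsHyperbolicEigenfunction U F) :
    IsGeneralizedMonopole (reducedMap F '' reducedRegion ε U F) (higgsField ε U F)
      (higgsConn ε U F) where
  isOpen := isOpen_image_of_isInvertible (isOpen_reducedRegion hF ε) (contDiffOn_reducedMap hF)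
    fun _ hw => isInvertible_fderiv_reducedMap hε hF hw
  smooth_higgs i j := contDiffOn_descend (isOpen_reducedRegion hF ε) (contDiffOn_reducedMap hF)
    (fun _ hw => isInvertible_fderiv_reducedMap hε hF hw) (contDiffOn_reducedHiggs hF i j)
    (eq_of_reducedMap_eq (fun z q => by rw [reducedHiggs_neg]) hF)
  smooth_connection := contDiffOn_higgsConn hε hF
  symm := by
    rintro _ ⟨w, hw, rfl⟩
    rw [higgsField_reducedMap hF hw]
    exact reducedHiggs_isSymm w
  invertible := by
    rintro _ ⟨w, hw, rfl⟩
    rw [higgsField_reducedMap hF hw]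
    have hD : discr F w.1 ≠ 0 := fun h => by simpa [h] using hw.1.2.2
    exact Matrix.isUnit_det_of_right_inverse
      (reducedHiggs_mul_inv (hF.rho_pos _ hw.1.1) hw.2 hw.1.2.1 hD)
  gradient := by
    rintro _ ⟨w, hw, rfl⟩ i j k u
    rw [fderiv_higgsField hε hF hw, fderiv_higgsField hε hF hw, higgsGradient, higgsGradient,
      gradientVec_comm]
  curvature := by
    rintro _ ⟨w, hw, rfl⟩ i X Y
    obtain ⟨e, he⟩ := isInvertible_fderiv_reducedMap hε hF hw
    have hX : ∀ X, fderiv ℝ (reducedMap F) w (e.symm X) = X := fun X => by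
      rw [← he]
      exact e.apply_symm_apply X
    have hD := isOpen_reducedRegion hF ε
    have hB := isOpen_image_of_isInvertible hD (contDiffOn_reducedMap hF)
      fun _ hw => isInvertible_fderiv_reducedMap hε hF hw
    have ha : DifferentiableAt ℝ (higgsConn ε U F i) (reducedMap F w) :=
      ((contDiffOn_higgsConn hε hF i).contDiffAt (hB.mem_nhds ⟨w, hw, rfl⟩)).differentiableAt
        (by simp)
    have hb : DifferentiableAt ℝ (reducedConn F i) w :=
      ((contDiffOn_reducedConn hF i).contDiffAt (hD.mem_nhds hw)).differentiableAt (by simp)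
    have hab : ∀ᶠ w' in nhds w, reducedConn F i w' =
        higgsConn ε U F i (reducedMap F w') ∘L fderiv ℝ (reducedMap F) w' := by
      filter_upwards [hD.mem_nhds hw] with w' hw'
      exact (higgsConn_comp_fderiv hε hF hw' i).symm
    have h := dOne_pullback hab ha ((contDiffOn_reducedMap hF).contDiffAt (hD.mem_nhds hw))
      (e.symm X) (e.symm Y)
    rw [hX, hX, dOne_apply hb, curvature_reducedConn_eq hF hw, hX, hX] at h
    rw [← h]
    simp only [fderiv_higgsField hε hF hw]

theorem coframeMatrix_mul_higgsField (hF : IsHyperbolicEigenfunction U F) {P : Total}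
    (hP : P ∈ totalRegion ε U F) :
    coframeMatrix P.1 * higgsField ε U F (momentMap F P) * (coframeMatrix P.1)ᵀ =
      higgsMatrix F P := by
  have hw : (P.1.1, P.2) ∈ reducedRegion ε U F := ⟨hP.1, hP.2⟩
  rw [momentMap_eq_reducedMap, higgsField_reducedMap hF hw, coframeMatrix_eq]
  refine (coframe_mul_reducedHiggs (w := (P.1.1, P.2)) (hF.rho_pos _ hP.1.1)).trans ?_
  ext i j
  fin_cases i <;> fin_cases j <;> simp [frameHiggs, higgsMatrix] <;> ring

theorem totalMetric_eq_gibbonsHawkingMetric (hε : ε * ε = 1) (hF : IsHyperbolicEigenfunction U F)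
    {P : Total} (hP : P ∈ totalRegion ε U F) (X Y : Total) :
    totalMetric ε F P X Y =
      gibbonsHawkingMetric (higgsField ε U F) (higgsConn ε U F) (momentMap F P)
        (fderiv ℝ (momentMap F) P X, X.1.2) (fderiv ℝ (momentMap F) P Y, Y.1.2) := by
  have hw : (P.1.1, P.2) ∈ reducedRegion ε U F := ⟨hP.1, hP.2⟩
  have hA : ∀ i X, higgsConn ε U F i (reducedMap F (P.1.1, P.2))
      (fderiv ℝ (reducedMap F) (P.1.1, P.2) X) = reducedConn F i (P.1.1, P.2) X := fun i X => by
    rw [← higgsConn_comp_fderiv hε hF hw]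
    rfl
  rw [totalMetric_eq_reduced hε hF hP, gibbonsHawkingMetric, fderiv_momentMap hF hP,
    fderiv_momentMap hF hP, momentMap_eq_reducedMap, higgsField_reducedMap hF hw]
  simp only [hA]

end Ansatz

end SwannGH

end

theorem mainTheorem7 (ε : ℝ) (hε : ε = 1 ∨ ε = -1) (U : Set (ℝ × ℝ)) (F : ℝ × ℝ → ℝ)
    (hF : SwannGH.IsHyperbolicEigenfunction U F) :
    -- a trivialization of the Swann bundle of the selfdual Einstein metric `ε g`
    SwannGH.IsSwannTrivialization ε (SwannGH.baseRegion ε U F) (SwannGH.einsteinMetric ε F)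
      (SwannGH.einsteinFrame ε F) (SwannGH.connectionForm F) (ε / 4) ∧
    -- the metric on the Swann bundle is hyperkähler
    SwannGH.IsHyperkahler (SwannGH.totalRegion ε U F) (SwannGH.totalMetric ε F)
      (SwannGH.totalForm ε F) ∧
    -- the momentum maps of `∂_φ` and `∂_ψ`
    SwannGH.IsMomentumMap (SwannGH.totalRegion ε U F) (SwannGH.totalForm ε F)
      (SwannGH.killingField 0) (SwannGH.momentPhi F) ∧
    SwannGH.IsMomentumMap (SwannGH.totalRegion ε U F) (SwannGH.totalForm ε F)
      (SwannGH.killingField 1) (SwannGH.momentPsi F) ∧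
    -- the map `(x_φ, x_ψ, φ, ψ)` identifies exactly `q` and `-q`
    (∀ P ∈ SwannGH.totalRegion ε U F, ∀ P' ∈ SwannGH.totalRegion ε U F,
      SwannGH.momentMap F P = SwannGH.momentMap F P' ↔
        P.1.1 = P'.1.1 ∧ (P.2 = P'.2 ∨ P.2 = -P'.2)) ∧
    -- through this map the metric is given by the generalized Gibbons–Hawking Ansatz
    ∃ (Φ : SwannGH.MomentumSpace → Matrix (Fin 2) (Fin 2) ℝ)
      (A : Fin 2 → SwannGH.MomentumSpace → SwannGH.MomentumSpace →L[ℝ] ℝ),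
      SwannGH.IsGeneralizedMonopole (SwannGH.momentMap F '' SwannGH.totalRegion ε U F) Φ A ∧
      (∀ P ∈ SwannGH.totalRegion ε U F,
        SwannGH.coframeMatrix P.1 * Φ (SwannGH.momentMap F P) * (SwannGH.coframeMatrix P.1)ᵀ =
          SwannGH.higgsMatrix F P) ∧
      (∀ P ∈ SwannGH.totalRegion ε U F, ∀ X Y : SwannGH.Total,
        SwannGH.totalMetric ε F P X Y =
          SwannGH.gibbonsHawkingMetric Φ A (SwannGH.momentMap F P)
            (fderiv ℝ (SwannGH.momentMap F) P X, X.1.2)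
            (fderiv ℝ (SwannGH.momentMap F) P Y, Y.1.2)) := by
  have hε' : ε * ε = 1 := by rcases hε with rfl | rfl <;> norm_num
  refine ⟨SwannGH.isSwannTrivialization hε' hF, SwannGH.isHyperkahler_total hε' hF,
    SwannGH.isMomentumMap_of_eq hε' hF 0 fun P hP => SwannGH.momentPhi_eq hF hP,
    SwannGH.isMomentumMap_of_eq hε' hF 1 fun P hP => SwannGH.momentPsi_eq,
    fun P hP P' hP' => SwannGH.momentMap_eq_iff hF hP hP',
    SwannGH.higgsField ε U F, SwannGH.higgsConn ε U F, ?_,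
    fun P hP => SwannGH.coframeMatrix_mul_higgsField hF hP,
    fun P hP X Y => SwannGH.totalMetric_eq_gibbonsHawkingMetric hε' hF hP X Y⟩
  rw [SwannGH.image_momentMap]
  exact SwannGH.isGeneralizedMonopole hε' hF
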